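/- Let $f\colon Y\to X$ be a separated morphism of schemes, $g\colon X\to Y$ a section of $f$ (so that $f\circ g=\mathrm{id}_X$ and $g$ is a closed immersion), $i\colon D\to X$ an effective Cartier divisor with (invertible) ideal sheaf $\mathcal I\subset\mathcal O_X$, and put $\mathcal O_X(D)=\mathcal Hom(\mathcal I,\mathcal O_X)$, $\mathcal O_D(D)=i^*\mathcal O_X(D)$. Let $\mathcal K\subset\mathcal O_Y$ be the ideal of $g$, $\mathcal N_g=g^*\mathcal K=\mathcal K/\mathcal K^2$ the conormal sheaf of $g$, and $\mathcal J\subset\mathcal O_Y$ the ideal of the closed subscheme $g(D)$, i.e. of the closed immersion $g\circ i$; then $\mathcal I\mathcal O_Y\subset\mathcal J$. Let $Y'=\mathrm{Proj}\bigl(\bigoplus_{n\ge 0}\mathcal J^n\bigr)$ be the blow-up of $Y$ in $g(D)$. The dilatation of $Y$ along $g$ of thickness $D$ is the open subscheme $Y_{(D)}\subset Y'$ which, over an affine open $V\subset Y$, is the union of the basic opens $D_+(b)$, where $n>0$ and $b\in(\mathcal I\mathcal O_Y)^n(V)\subset\mathcal J^n(V)$ is placed in degree $n$. Let $\pi\colon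 Y_{(D)}\to Y$ be the projection, let the exceptional divisor $E_{(D)}=\pi^{-1}(g(D))$ be the inverse image of $g(D)$ in $Y_{(D)}$, and let $p\colon E_{(D)}\to D$ be the projection obtained by identifying $g(D)$ with $D$. Assume that $g$ is a regular immersion: every point of $g(X)$ has an affine open neighbourhood $V$ in $Y$ such that $\mathcal K(V)$ is generated by a finite sequence $r_1,\dots,r_m$ with $r_j$ a nonzerodivisor on $\mathcal O_Y(V)/(r_1,\dots,r_{j-1})$ for every $j$. Then there is a unique morphism of $D$-schemes $$\varphi\colon E_{(D)}\longrightarrow \mathbf V\bigl(\mathcal N_g\otimes_{\mathcal O_X}\mathcal O_D(D)\bigr)=\mathrm{Spec}_D\,\mathrm{Sym}_{\mathcal O_D}\bigl(i^*\mathcal N_g\otimes_{\mathcal O_D}\mathcal O_D(D)\bigr)$$ that is canonical in the following sense: for all affine opens $U\subset X$ and $V\subset f^{-1}(U)$, all $\tau\in\mathcal I(U)$, $k\in\mathcal K(V)$, $\mu\in\mathcal O_X(D)(g^{-1}(V))$, and every function $q$ on $\pi^{-1}(V)$ with $\pi^*(f^*\tau)\cdot q=\pi^*k$, the section $k\otimes\mu$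 satisfies $$\varphi^*(k\otimes\mu)=p^*\bigl(i^*(\mu(\tau|_{g^{-1}(V)}))\bigr)\cdot q|_{E_{(D)}},$$ that is, $\varphi^*(k\otimes\mu)=\mu(\tau)\cdot(k/\tau)|_{E_{(D)}}$; and this canonical morphism $\varphi$ is an isomorphism. -/

import Mathlib

open CategoryTheory CategoryTheory.Limits AlgebraicGeometry TopologicalSpace
open scoped TensorProduct Polynomial

universe u

noncomputable section

namespace Dilatation

/-! ### The Rees algebra as a graded ring -/

section Rees

variable {R : Type u} [CommRing R]

/-- The degree `n` part `Iⁿ Tⁿ` of the Rees algebra `⨁ₙ Iⁿ Tⁿ ⊆ R[T]`. -/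
def reesGrading (I : Ideal R) (n : ℕ) : Submodule R (reesAlgebra I) where
  carrier := {p | ∀ m, m ≠ n → (p : R[X]).coeff m = 0}
  add_mem' := fun {a b} ha hb m hm => by simp [ha m hm, hb m hm]
  zero_mem' := fun m _ => by simp
  smul_mem' := fun c p hp m hm => by simp [hp m hm]

/-- The element `a Tⁿ` of degree `n` of the Rees algebra, for `a ∈ Iⁿ`. -/
def reesMonomial (I : Ideal R) (n : ℕ) (a : R) (ha : a ∈ I ^ n) : reesAlgebra I :=
  ⟨Polynomial.monomial n a, reesAlgebra.monomial_mem.mpr ha⟩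

lemma reesMonomial_mem (I : Ideal R) (n : ℕ) (a : R) (ha : a ∈ I ^ n) :
    reesMonomial I n a ha ∈ reesGrading I n := fun m hm => by
  simp [reesMonomial, Polynomial.coeff_monomial, hm.symm]

lemma eq_reesMonomial {I : Ideal R} {n : ℕ} {p : reesAlgebra I} (hp : p ∈ reesGrading I n) :
    p = reesMonomial I n ((p : R[X]).coeff n) ((mem_reesAlgebra_iff I _).mp p.2 n) := by
  ext m
  by_cases h : m = n
  · subst h; simp [reesMonomial]
  · rw [hp m h]; simp [reesMonomial, Polynomial.coeff_monomial, Ne.symm h]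

instance (I : Ideal R) : SetLike.GradedMonoid (reesGrading I) where
  one_mem := fun m hm => by
    simp [Polynomial.coeff_one, hm]
  mul_mem := by
    intro i j a b ha hb m hm
    rw [eq_reesMonomial ha, eq_reesMonomial hb]
    simp only [reesMonomial, MulMemClass.mk_mul_mk, Polynomial.monomial_mul_monomial]
    rw [Polynomial.coeff_monomial, if_neg (Ne.symm hm)]

/-- The decomposition of an element of the Rees algebra into its homogeneous parts. -/
def reesDecompose (I : Ideal R) (p : reesAlgebra I) : DirectSum ℕ fun n => reesGrading I n :=
  DirectSum.mk (fun n => reesGrading I n) (p : R[X]).support fun n =>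
    ⟨reesMonomial I n ((p : R[X]).coeff n) ((mem_reesAlgebra_iff I _).mp p.2 n),
      reesMonomial_mem _ _ _ _⟩

lemma reesDecompose_apply (I : Ideal R) (p : reesAlgebra I) (n : ℕ) :
    reesDecompose I p n =
      ⟨reesMonomial I n ((p : R[X]).coeff n) ((mem_reesAlgebra_iff I _).mp p.2 n),
        reesMonomial_mem _ _ _ _⟩ := by
  classical
  by_cases h : n ∈ (p : R[X]).support
  · exact DirectSum.mk_apply_of_mem h
  · rw [reesDecompose, DirectSum.mk_apply_of_notMem h]
    have : (p : R[X]).coeff n = 0 := by simpa using h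
    apply Subtype.ext
    apply Subtype.ext
    simp [reesMonomial, this]

lemma coeff_coeAddMonoidHom (I : Ideal R) (x : DirectSum ℕ fun n => reesGrading I n) (m : ℕ) :
    ((DirectSum.coeAddMonoidHom (reesGrading I) x : reesAlgebra I) : R[X]).coeff m =
      ((x m : reesAlgebra I) : R[X]).coeff m := by
  induction x using DirectSum.induction_on with
  | zero => simp
  | of n p =>
    rw [DirectSum.coeAddMonoidHom_of]
    by_cases h : m = n
    · subst h
      rw [DirectSum.of_eq_same]
    · rw [DirectSum.of_eq_of_ne _ _ _ h, p.2 m h]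
      simp
  | add x y hx hy => simp [hx, hy]

instance (I : Ideal R) : DirectSum.Decomposition (reesGrading I) where
  decompose' := reesDecompose I
  left_inv p := by
    apply Subtype.ext
    ext m
    rw [coeff_coeAddMonoidHom, reesDecompose_apply]
    simp [reesMonomial]
  right_inv x := by
    refine DFinsupp.ext fun n => ?_
    rw [reesDecompose_apply]
    apply Subtype.ext
    simp only [coeff_coeAddMonoidHom]
    exact (eq_reesMonomial (x n).2).symm

instance (I : Ideal R) : GradedRing (reesGrading I) where

variable {R' : Type u} [CommRing R']

/-- The graded homomorphism of Rees algebras induced by a ring homomorphism `φ` with `φ(I) ⊆ I'`. -/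
def reesMap (φ : R →+* R') (I : Ideal R) (I' : Ideal R') (h : I.map φ ≤ I') :
    GradedRingHom (reesGrading I) (reesGrading I') where
  toRingHom := ((Polynomial.mapRingHom φ).comp (reesAlgebra I).subtype).codRestrict
    (reesAlgebra I') fun p => by
      rw [mem_reesAlgebra_iff]
      intro n
      have : φ ((p : R[X]).coeff n) ∈ I' ^ n := by
        apply Ideal.pow_right_mono h
        rw [← Ideal.map_pow]
        exact Ideal.mem_map_of_mem _ ((mem_reesAlgebra_iff I _).mp p.2 n)
      change (Polynomial.map φ (p : R[X])).coeff n ∈ I' ^ n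
      rwa [Polynomial.coeff_map]
  map_mem {n p} hp m hm := by
    have := hp m hm
    change (Polynomial.map φ (p : R[X])).coeff m = 0
    rw [Polynomial.coeff_map, this, map_zero]

lemma coe_reesMap (φ : R →+* R') (I : Ideal R) (I' : Ideal R') (h : I.map φ ≤ I')
    (p : reesAlgebra I) : (reesMap φ I I' h p : R'[X]) = (p : R[X]).map φ := rfl

lemma reesMap_reesMonomial (φ : R →+* R') (I : Ideal R) (I' : Ideal R') (h : I.map φ ≤ I')
    (n : ℕ) (a : R) (ha : a ∈ I ^ n) :
    reesMap φ I I' h (reesMonomial I n a ha) = reesMonomial I' n (φ a)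
      (Ideal.pow_right_mono h n (by rw [← Ideal.map_pow]; exact Ideal.mem_map_of_mem _ ha)) := by
  apply Subtype.ext
  rw [coe_reesMap]
  simp [reesMonomial]

open HomogeneousIdeal in
lemma irrelevant_le_map_reesMap (φ : R →+* R') (I : Ideal R) (I' : Ideal R')
    (h : I.map φ = I') :
    HomogeneousIdeal.irrelevant (reesGrading I') ≤
      (HomogeneousIdeal.irrelevant (reesGrading I)).map (reesMap φ I I' h.le) := by
  rw [HomogeneousIdeal.irrelevant_le]
  intro n hn p hp
  suffices H : ∀ c ∈ (I ^ n).map φ, ∀ hc : c ∈ I' ^ n, reesMonomial I' n c hc ∈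
      Ideal.map (reesMap φ I I' h.le) (HomogeneousIdeal.irrelevant (reesGrading I)).toIdeal by
    rw [eq_reesMonomial (p := p) hp]
    refine H _ ?_ _
    rw [Ideal.map_pow, h]
    exact (mem_reesAlgebra_iff I' _).mp p.2 n
  intro c hc'
  rw [Ideal.map] at hc'
  refine Submodule.span_induction (p := fun c _ => ∀ hc : c ∈ I' ^ n, reesMonomial I' n c hc ∈
    Ideal.map (reesMap φ I I' h.le) (HomogeneousIdeal.irrelevant (reesGrading I)).toIdeal)
    ?_ ?_ ?_ ?_ hc'
  · rintro _ ⟨a, ha, rfl⟩ hc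
    rw [← reesMap_reesMonomial φ I I' h.le n a ha]
    exact Ideal.mem_map_of_mem _
      (HomogeneousIdeal.mem_irrelevant_of_mem _ hn (reesMonomial_mem I n a ha))
  · intro hc
    convert Ideal.zero_mem _
    apply Subtype.ext; simp [reesMonomial]
  · intro x y hx hy hx' hy' hc
    have hm : ∀ z ∈ Submodule.span R' (⇑φ '' ((I ^ n : Ideal R) : Set R)), z ∈ I' ^ n := by
      intro z hz
      rw [← h, ← Ideal.map_pow]
      exact hz
    convert Ideal.add_mem _ (hx' (hm x hx)) (hy' (hm y hy))
    apply Subtype.ext; simp [reesMonomial]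
  · intro r x hx hx' hc
    have hm : ∀ z ∈ Submodule.span R' (⇑φ '' ((I ^ n : Ideal R) : Set R)), z ∈ I' ^ n := by
      intro z hz
      rw [← h, ← Ideal.map_pow]
      exact hz
    convert Ideal.mul_mem_left _ (algebraMap R' (reesAlgebra I') r) (hx' (hm x hx))
    apply Subtype.ext
    simp [reesMonomial, ← Polynomial.C_mul_monomial]

end Rees

section ReesProj

open HomogeneousLocalization

variable {R R' : Type u} [CommRing R] [CommRing R']

/-- The structure map from `R` to a homogeneous localization of the Rees algebra. -/
def reesToAway (I : Ideal R) (s : reesAlgebra I) : R →+* Away (reesGrading I) s :=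
  (fromZeroRingHom (reesGrading I) _).comp (algebraMap R (reesGrading I 0))

lemma val_reesToAway (I : Ideal R) (s : reesAlgebra I) (r : R) :
    (reesToAway I s r).val = Localization.mk (algebraMap R (reesAlgebra I) r) 1 := rfl

/-- `Proj (⨁ₙ Iⁿ)`, the blow-up of `Spec R` in the closed subscheme defined by `I`. -/
abbrev reesProj (I : Ideal R) : Scheme.{u} := Proj (reesGrading I)

/-- The structure morphism `Proj (⨁ₙ Iⁿ) ⟶ Spec R`. -/
def reesProjToSpec (I : Ideal R) : reesProj I ⟶ Spec (.of R) :=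
  Proj.toSpecZero (reesGrading I) ≫ Spec.map (CommRingCat.ofHom (algebraMap R (reesGrading I 0)))

lemma awayι_reesProjToSpec (I : Ideal R) {n : ℕ} (s : reesAlgebra I) (hs : s ∈ reesGrading I n)
    (hn : 0 < n) :
    Proj.awayι (reesGrading I) s hs hn ≫ reesProjToSpec I =
      Spec.map (CommRingCat.ofHom (reesToAway I s)) := by
  rw [reesProjToSpec, Proj.awayι_toSpecZero_assoc, ← Spec.map_comp]
  rfl

variable (φ : R →+* R') (I : Ideal R) (I' : Ideal R') (h : I.map φ = I')

/-- The morphism of `Proj`s induced by a ring homomorphism `φ` with `φ(I) R' = I'`. -/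
def reesProjMap : reesProj I' ⟶ reesProj I :=
  Proj.map (reesMap φ I I' h.le) (irrelevant_le_map_reesMap φ I I' h)

lemma map_comp_reesToAway (s : reesAlgebra I) :
    (Away.map (reesMap φ I I' h.le) s).comp (reesToAway I s) =
      (reesToAway I' (reesMap φ I I' h.le s)).comp φ := by
  ext r
  have h1 : reesToAway I s r = HomogeneousLocalization.mk
      ⟨0, algebraMap R (reesGrading I 0) r, 1, one_mem _⟩ := rfl
  rw [RingHom.comp_apply, h1, Away.map, HomogeneousLocalization.map_mk,
    RingHom.comp_apply]
  rw [HomogeneousLocalization.val_mk, val_reesToAway]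
  congr 1
  · apply Subtype.ext
    exact Polynomial.map_C φ
  · exact Subtype.ext (map_one _)

lemma reesProjMap_toSpec :
    reesProjMap φ I I' h ≫ reesProjToSpec I =
      reesProjToSpec I' ≫ Spec.map (CommRingCat.ofHom φ) := by
  have H (n : ℕ) (hn : 0 < n) (s : reesAlgebra I) (hs : s ∈ reesGrading I n) :
      Proj.awayι (reesGrading I') (reesMap φ I I' h.le s) (GradedRingHom.map_mem _ hs) hn ≫
        reesProjMap φ I I' h ≫ reesProjToSpec I =
      Proj.awayι (reesGrading I') (reesMap φ I I' h.le s) (GradedRingHom.map_mem _ hs) hn ≫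
        reesProjToSpec I' ≫ Spec.map (CommRingCat.ofHom φ) := by
    rw [reesProjMap, Proj.awayι_comp_map_assoc _ _ hn _ hs, awayι_reesProjToSpec,
      ← Spec.map_comp, ← CommRingCat.ofHom_comp, map_comp_reesToAway φ I I' h,
      CommRingCat.ofHom_comp, Spec.map_comp, ← Category.assoc, awayι_reesProjToSpec]
  exact (Proj.mapAffineOpenCover _
    (irrelevant_le_map_reesMap φ I I' h)).openCover.hom_ext _ _
      fun s ↦ H s.1.1 s.1.2 s.2.1 s.2.2

lemma mk_eq_zero_iff {n d : ℕ} {s : reesAlgebra I} (hs : s ∈ reesGrading I d) (x : reesAlgebra I)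
    (hx : x ∈ reesGrading I (n • d)) :
    Away.mk (reesGrading I) hs n x hx = 0 ↔ ∃ k : ℕ, s ^ k * x = 0 := by
  rw [HomogeneousLocalization.ext_iff_val, Away.val_mk, HomogeneousLocalization.val_zero,
    ← Localization.mk_zero 1, Localization.mk_eq_mk_iff, Localization.r_iff_exists]
  constructor
  · rintro ⟨⟨_, k, rfl⟩, hk⟩
    exact ⟨k, by simpa using hk⟩
  · rintro ⟨k, hk⟩
    exact ⟨⟨_, k, rfl⟩, by simpa using hk⟩

lemma reesToAway_mul_mk {n d : ℕ} {s : reesAlgebra I} (hs : s ∈ reesGrading I d) (x : reesAlgebra I)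
    (hx : x ∈ reesGrading I (n • d)) (r : R) :
    reesToAway I s r * Away.mk (reesGrading I) hs n x hx =
      Away.mk (reesGrading I) hs n (r • x) (Submodule.smul_mem _ _ hx) := by
  rw [HomogeneousLocalization.ext_iff_val, HomogeneousLocalization.val_mul, val_reesToAway,
    Away.val_mk, Away.val_mk, Localization.mk_mul, one_mul, Algebra.smul_def]

lemma isLocalizationAway_of {S T : Type*} [CommRing S] [CommRing T] (ψ : S →+* T) (b : S)
    (h1 : IsUnit (ψ b)) (h2 : ∀ t : T, ∃ (m : ℕ) (s : S), t * ψ b ^ m = ψ s)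
    (h3 : ∀ x : S, ψ x = 0 → ∃ m : ℕ, b ^ m * x = 0) :
    @IsLocalization.Away _ _ b T _ ψ.toAlgebra := by
  let := ψ.toAlgebra
  refine ⟨?_, ?_, ?_⟩
  · rintro ⟨_, m, rfl⟩
    change IsUnit (ψ (b ^ m))
    rw [map_pow]
    exact h1.pow m
  · intro t
    obtain ⟨m, s, hs⟩ := h2 t
    refine ⟨⟨s, ⟨_, m, rfl⟩⟩, ?_⟩
    change t * ψ (b ^ m) = ψ s
    rw [map_pow, hs]
  · intro x y hxy
    obtain ⟨m, hm⟩ := h3 (x - y) (by rw [map_sub, sub_eq_zero]; exact hxy)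
    exact ⟨⟨_, m, rfl⟩, by rwa [mul_sub, sub_eq_zero] at hm⟩

/-- The homogeneous localizations of the Rees algebra are compatible with localizing the base. -/
lemma isLocalization_away_map (b : R) (hφ : @IsLocalization.Away _ _ b R' _ φ.toAlgebra)
    {d : ℕ} (s : reesAlgebra I) (hs : s ∈ reesGrading I d) :
    @IsLocalization.Away _ _ (reesToAway I s b)
      (Away (reesGrading I') (reesMap φ I I' h.le s)) _
      (Away.map (reesMap φ I I' h.le) s).toAlgebra := by
  let := φ.toAlgebra
  have hcomp (r : R) : Away.map (reesMap φ I I' h.le) s (reesToAway I s r) =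
      reesToAway I' _ (φ r) :=
    RingHom.congr_fun (map_comp_reesToAway φ I I' h s) r
  refine isLocalizationAway_of _ _ ?_ ?_ ?_
  · rw [hcomp]
    exact (IsLocalization.Away.algebraMap_isUnit (S := R') b).map _
  · intro t
    obtain ⟨n, x, hx, rfl⟩ := Away.mk_surjective _ (GradedRingHom.map_mem _ hs) t
    have hc : (x : R'[X]).coeff (n • d) ∈ (I ^ (n • d)).map φ := by
      rw [Ideal.map_pow, h]
      exact (mem_reesAlgebra_iff I' _).mp x.2 (n • d)
    obtain ⟨⟨c0, ⟨_, m, rfl⟩⟩, hm⟩ :=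
      (IsLocalization.mem_map_algebraMap_iff (Submonoid.powers b) R').mp hc
    refine ⟨m, Away.mk _ hs n (reesMonomial I (n • d) c0.1 c0.2) (reesMonomial_mem _ _ _ _), ?_⟩
    rw [hcomp, ← map_pow, ← map_pow]
    refine Eq.trans (mul_comm (G := Away (reesGrading I') (reesMap φ I I' h.le s)) _ _) ?_
    refine Eq.trans (reesToAway_mul_mk I' _ x hx _) ?_
    rw [Away.map_mk]
    congr 1
    rw [reesMap_reesMonomial, eq_reesMonomial hx]
    apply Subtype.ext
    have hm' : (x : R'[X]).coeff (n • d) * φ (b ^ m) = φ c0.1 := hm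
    simp only [reesMonomial, SetLike.val_smul, Polynomial.smul_monomial, smul_eq_mul, ← hm']
    congr 1
    rw [mul_comm]
  · intro x hx0
    obtain ⟨n, x, hx, rfl⟩ := Away.mk_surjective _ hs x
    rw [Away.map_mk, mk_eq_zero_iff] at hx0
    obtain ⟨k, hk⟩ := hx0
    rw [← map_pow, ← map_mul] at hk
    have hx' : s ^ k * x ∈ reesGrading I (k • d + n • d) :=
      SetLike.mul_mem_graded (SetLike.pow_mem_graded k hs) hx
    have h0 : φ (((s ^ k * x : reesAlgebra I) : R[X]).coeff (k • d + n • d)) = 0 := by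
      rw [← Polynomial.coeff_map, ← coe_reesMap φ I I' h.le, hk]
      simp
    have h0' : algebraMap R R' (((s ^ k * x : reesAlgebra I) : R[X]).coeff (k • d + n • d)) =
      algebraMap R R' 0 := by rw [map_zero]; exact h0
    obtain ⟨⟨_, m, rfl⟩, hm⟩ :=
      (IsLocalization.eq_iff_exists (Submonoid.powers b) R').mp h0'
    refine ⟨m, ?_⟩
    rw [← map_pow, reesToAway_mul_mk, mk_eq_zero_iff]
    refine ⟨k, ?_⟩
    rw [mul_smul_comm, eq_reesMonomial hx']
    apply Subtype.ext
    simp only [mul_zero] at hm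
    change b ^ m • Polynomial.monomial (k • d + n • d) _ = 0
    rw [Polynomial.smul_monomial]
    exact (congrArg _ hm).trans (Polynomial.monomial_zero_right _)

/-- The formation of `Proj (⨁ₙ Iⁿ)` is compatible with localizing the base. -/
lemma isPullback_reesProjMap (b : R) (hφ : @IsLocalization.Away _ _ b R' _ φ.toAlgebra) :
    IsPullback (reesProjMap φ I I' h) (reesProjToSpec I') (reesProjToSpec I)
      (Spec.map (CommRingCat.ofHom φ)) := by
  have H (n : ℕ) (hn : 0 < n) (s : reesAlgebra I) (hs : s ∈ reesGrading I n) :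
      IsPullback (pullback.snd (reesProjMap φ I I' h) (Proj.awayι (reesGrading I) s hs hn))
        (pullback.fst (reesProjMap φ I I' h) (Proj.awayι (reesGrading I) s hs hn) ≫
          reesProjToSpec I')
        (Proj.awayι (reesGrading I) s hs hn ≫ reesProjToSpec I)
        (Spec.map (CommRingCat.ofHom φ)) := by
    have h0 : IsOpenImmersion (Proj.awayι (reesGrading I') (reesMap φ I I' h.le s)
      (GradedRingHom.map_mem _ hs) hn) := inferInstance
    have h1 : IsPullback (Spec.map (CommRingCat.ofHom (Away.map (reesMap φ I I' h.le) s)))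
        (Proj.awayι (reesGrading I') (reesMap φ I I' h.le s) (GradedRingHom.map_mem _ hs) hn)
        (Proj.awayι (reesGrading I) s hs hn) (reesProjMap φ I I' h) := by
      refine IsOpenImmersion.isPullback _ _ _ _ ?_ ?_
      · rw [reesProjMap, Proj.awayι_comp_map _ _ hn _ hs]
      · rw [Proj.opensRange_awayι, Proj.opensRange_awayι]
        rfl
    have h2 : IsPullback (Spec.map (CommRingCat.ofHom (Away.map (reesMap φ I I' h.le) s)))
        (Spec.map (CommRingCat.ofHom (reesToAway I' (reesMap φ I I' h.le s))))
        (Spec.map (CommRingCat.ofHom (reesToAway I s))) (Spec.map (CommRingCat.ofHom φ)) := by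
      let := φ.toAlgebra
      let := (Away.map (reesMap φ I I' h.le) s).toAlgebra
      have hl := isLocalization_away_map φ I I' h b hφ s hs
      have : IsLocalization ((Submonoid.powers b).map (reesToAway I s))
          (Away (reesGrading I') (reesMap φ I I' h.le s)) := by
        rw [Submonoid.map_powers]; exact hl
      exact isPullback_SpecMap_of_isPushout _ _ _ _
        (CommRingCat.isPushout_of_isLocalization (reesToAway I s)
          (reesToAway I' (reesMap φ I I' h.le s)) (map_comp_reesToAway φ I I' h s).symm
          (Submonoid.powers b))
    refine h2.of_iso h1.flip.isoPullback (Iso.refl _) (Iso.refl _) (Iso.refl _) ?_ ?_ ?_ ?_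
    · simp
    · rw [Iso.refl_hom, Category.comp_id, ← Category.assoc, IsPullback.isoPullback_hom_fst,
        awayι_reesProjToSpec]
    · rw [awayι_reesProjToSpec]; simp
    · simp
  exact Scheme.isPullback_of_openCover _ _ _ _ (Proj.affineOpenCover (reesGrading I)).openCover
    fun s ↦ H s.1.1 s.1.2 s.2.1 s.2.2


lemma projMap_congr {I : Ideal R} {I' : Ideal R'}
    {f g : GradedRingHom (reesGrading I) (reesGrading I')} (e : f = g)
    (hf : HomogeneousIdeal.irrelevant (reesGrading I') ≤
      (HomogeneousIdeal.irrelevant (reesGrading I)).map f)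
    (hg : HomogeneousIdeal.irrelevant (reesGrading I') ≤
      (HomogeneousIdeal.irrelevant (reesGrading I)).map g) :
    Proj.map f hf = Proj.map g hg := by
  subst e; rfl

lemma reesProjMap_id (φ : R →+* R) (hφ : φ = RingHom.id R) (I : Ideal R) (h : I.map φ = I) :
    reesProjMap φ I I h = 𝟙 _ := by
  subst hφ
  refine (projMap_congr ?_ _ (by simp)).trans Proj.map_id
  refine GradedRingHom.ext fun p => Subtype.ext ?_
  exact Polynomial.map_id

lemma reesProjMap_comp {R'' : Type u} [CommRing R''] (φ : R →+* R') (ψ : R' →+* R'')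
    (χ : R →+* R'') (hχ : χ = ψ.comp φ)
    (I : Ideal R) (I' : Ideal R') (I'' : Ideal R'') (h : I.map φ = I') (h' : I'.map ψ = I'')
    (h'' : I.map χ = I'') :
    reesProjMap χ I I'' h'' = reesProjMap ψ I' I'' h' ≫ reesProjMap φ I I' h := by
  subst hχ
  refine (projMap_congr ?_ _ _).trans (Proj.map_comp _ _ _ _)
  refine GradedRingHom.ext fun p => Subtype.ext ?_
  exact (Polynomial.map_map φ ψ _).symm

end ReesProj

/-! ### Blow-ups -/

section BlowUp

variable {Y : Scheme.{u}} (J : Y.IdealSheafData)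

open Scheme.AffineZariskiSite

lemma map_ideal_site {V W : Y.AffineZariskiSite} (i : V ⟶ W) :
    (J.ideal ⟨W.1, W.2⟩).map
      (Y.presheaf.map ((toOpensFunctor Y).map i).op).hom = J.ideal ⟨V.1, V.2⟩ :=
  J.map_ideal' (U := ⟨V.1, V.2⟩) (V := ⟨W.1, W.2⟩) _

/-- The functor sending an affine open `V` of `Y` to the blow-up `Proj (⨁ₙ J(V)ⁿ)` of `V`. -/
def blowUpFunctor : Y.AffineZariskiSite ⥤ Scheme.{u} where
  obj V := reesProj (J.ideal ⟨V.1, V.2⟩)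
  map i := reesProjMap (Y.presheaf.map ((toOpensFunctor Y).map i).op).hom _ _
    (map_ideal_site J i)
  map_id V := reesProjMap_id _ (by simp) _ _
  map_comp i j := reesProjMap_comp _ _ _ (by
    rw [← CommRingCat.hom_comp, ← Functor.map_comp, ← op_comp, ← Functor.map_comp]) _ _ _ _ _ _

/-- The structure morphisms of the local blow-ups, with target `Spec Γ(Y, V)`. -/
def blowUpNatTrans :
    blowUpFunctor J ⟶ toOpensFunctor Y ⋙ Y.presheaf.rightOp ⋙ Scheme.Spec where
  app V := reesProjToSpec (J.ideal ⟨V.1, V.2⟩)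
  naturality _ _ i := reesProjMap_toSpec _ _ _ (map_ideal_site J i)

lemma blowUpNatTrans_equifibered : (blowUpNatTrans J).Equifibered := by
  rintro ⟨V, hV⟩ W ⟨b, hb⟩
  obtain rfl : Y.basicOpen b = V := hb
  exact isPullback_reesProjMap _ _ _ (map_ideal_site J (homOfLE (W.basicOpen_le b))) b
    (W.2.isLocalization_basicOpen b)

lemma restrictIsoSpec_inv_equifibered (Y : Scheme.{u}) : (restrictIsoSpec Y).inv.Equifibered :=
  .of_isIso _

/-- The gluing data of the blow-up of `Y` in the closed subscheme defined by `J`. -/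
def blowUpGluingData : (directedCover Y).RelativeGluingData where
  functor := blowUpFunctor J
  natTrans := blowUpNatTrans J ≫ (restrictIsoSpec Y).inv
  equifibered := (blowUpNatTrans_equifibered J).comp (restrictIsoSpec_inv_equifibered Y)

/-- The blow-up `Proj (⨁ₙ Jⁿ)` of `Y` in the closed subscheme defined by `J`. -/
def blowUp : Scheme.{u} := (blowUpGluingData J).glued

/-- The structure morphism of the blow-up. -/
def blowUpπ : blowUp J ⟶ Y := (blowUpGluingData J).toBase

/-- The open immersion of `Proj (⨁ₙ J(V)ⁿ)` in the blow-up, for `V` affine. It identifies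
`Proj (⨁ₙ J(V)ⁿ)` with the preimage of `V`. -/
def blowUpι (V : Y.affineOpens) : reesProj (J.ideal V) ⟶ blowUp J :=
  (blowUpGluingData J).cover.f ⟨V.1, V.2⟩

instance (V : Y.affineOpens) : IsOpenImmersion (blowUpι J V) :=
  (blowUpGluingData J).cover.map_prop ⟨V.1, V.2⟩

lemma blowUpι_π (V : Y.affineOpens) :
    blowUpι J V ≫ blowUpπ J = reesProjToSpec (J.ideal V) ≫ V.2.fromSpec := by
  refine (Scheme.Cover.RelativeGluingData.ι_toBase (blowUpGluingData J) ⟨V.1, V.2⟩).trans ?_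
  exact Category.assoc _ _ _

lemma blowUpπ_preimage (V : Y.affineOpens) :
    blowUpπ J ⁻¹ᵁ V.1 = (blowUpι J V).opensRange := by
  simpa using! (blowUpGluingData J).toBase_preimage_eq_opensRange_ι ⟨V.1, V.2⟩

end BlowUp

/-! ### Dilatations -/

section DilatationOpen

variable {Y : Scheme.{u}} (J I' : Y.IdealSheafData) (h : I' ≤ J)

/-- The open subscheme of the blow-up `Proj (⨁ₙ Jⁿ)` on which the inclusion `⨁ₙ I'ⁿ → ⨁ₙ Jⁿ`
induces a morphism to `Proj (⨁ₙ I'ⁿ)`: over an affine open `V` it is the union of the basic opens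
`D₊(b Tⁿ)`, where `n > 0` and `b ∈ I'(V)ⁿ`. -/
def dilatationOpen : (blowUp J).Opens :=
  ⨆ (V : Y.affineOpens) (n : ℕ) (_ : 0 < n) (b : (I'.ideal V ^ n : Ideal Γ(Y, V))),
    blowUpι J V ''ᵁ Proj.basicOpen (reesGrading (J.ideal V))
      (reesMonomial (J.ideal V) n b.1 (Ideal.pow_right_mono (h V) n b.2))

end DilatationOpen

section SectionDilatation


/-- For a section `g : X ⟶ Y` and a closed subscheme `D` of `X` with ideal `I`, this is the ideal of
the closed subscheme `g(D)` of `Y`. -/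
def imageIdeal {X Y : Scheme.{u}} (g : X ⟶ Y) (I : X.IdealSheafData) : Y.IdealSheafData := (I.subschemeι ≫ g).ker

lemma comap_le_imageIdeal {X Y : Scheme.{u}} (f : Y ⟶ X) (g : X ⟶ Y) (hg : g ≫ f = 𝟙 X)
    (I : X.IdealSheafData) : I.comap f ≤ imageIdeal g I := by
  rw [← Scheme.IdealSheafData.le_map_iff_comap_le]
  change I ≤ (I.map g).map f
  rw [← Scheme.IdealSheafData.map_comp, hg, Scheme.IdealSheafData.map_id]

variable {X Y : Scheme.{u}} (f : Y ⟶ X) (g : X ⟶ Y) (hg : g ≫ f = 𝟙 X) (I : X.IdealSheafData)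

/-- The dilatation `Y_(D)` of `Y` along the section `g` of thickness `D`, where `D` is the closed
subscheme of `X` with ideal `I`: it is an open subscheme of the blow-up of `Y` in `g(D)`. -/
def dilatation : Scheme.{u} :=
  (dilatationOpen (imageIdeal g I) (I.comap f) (comap_le_imageIdeal f g hg I)).toScheme

/-- The structure morphism `Y_(D) ⟶ Y`. -/
def dilatationπ : dilatation f g hg I ⟶ Y :=
  (dilatationOpen (imageIdeal g I) (I.comap f) (comap_le_imageIdeal f g hg I)).ι ≫
    blowUpπ (imageIdeal g I)

/-- The exceptional divisor `E_(D)` of the dilatation, the preimage of `g(D)` in `Y_(D)`. -/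
def exceptionalDivisor : Scheme.{u} :=
  pullback (dilatationπ f g hg I) (I.subschemeι ≫ g)

/-- The projection of the exceptional divisor `E_(D)` to `D`, which is identified with `g(D)`. -/
def exceptionalDivisorToDivisor : exceptionalDivisor f g hg I ⟶ I.subscheme :=
  pullback.snd (dilatationπ f g hg I) (I.subschemeι ≫ g)

/-- The inclusion of the exceptional divisor in the dilatation. -/
def exceptionalDivisorι : exceptionalDivisor f g hg I ⟶ dilatation f g hg I :=
  pullback.fst (dilatationπ f g hg I) (I.subschemeι ≫ g)

end SectionDilatation

/-! ### The symmetric algebra of the twisted conormal module -/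

section TwistedConormal

variable {B A R : Type u} [CommRing B] [CommRing A] [CommRing R]
  (φ : B →+* A) (ψ : A →+* R) (K : Ideal B) (I : Ideal A)

/-- The `R`-module `(R ⊗_B K) ⊗_R (R ⊗_A Hom_A(I, A))`. If `K` is the kernel of a surjection
`φ : B → A`, then `A ⊗_B K` is the conormal module `K / K²`. -/
def TwistedConormal : Type u :=
  letI := φ.toAlgebra
  letI := ψ.toAlgebra
  letI := (ψ.comp φ).toAlgebra
  (R ⊗[B] K) ⊗[R] (R ⊗[A] Module.Dual A I)

instance : AddCommGroup (TwistedConormal φ ψ K I) :=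
  letI := φ.toAlgebra
  letI := ψ.toAlgebra
  letI := (ψ.comp φ).toAlgebra
  (inferInstance : AddCommGroup ((R ⊗[B] K) ⊗[R] (R ⊗[A] Module.Dual A I)))

instance : Module R (TwistedConormal φ ψ K I) :=
  letI := φ.toAlgebra
  letI := ψ.toAlgebra
  letI := (ψ.comp φ).toAlgebra
  (inferInstance : Module R ((R ⊗[B] K) ⊗[R] (R ⊗[A] Module.Dual A I)))

/-- The element `(1 ⊗ k) ⊗ (1 ⊗ μ)`. -/
def TwistedConormal.mk (k : K) (μ : Module.Dual A I) : TwistedConormal φ ψ K I :=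
  letI := φ.toAlgebra
  letI := ψ.toAlgebra
  letI := (ψ.comp φ).toAlgebra
  ((1 : R) ⊗ₜ[B] k) ⊗ₜ[R] ((1 : R) ⊗ₜ[A] μ)

/-- The symmetric algebra of the `R`-module `(R ⊗_B K) ⊗_R (R ⊗_A Hom_A(I, A))`. -/
abbrev TwistedSym : Type u := SymmetricAlgebra R (TwistedConormal φ ψ K I)

/-- The structure map of the symmetric algebra. -/
abbrev twistedStr : R →+* TwistedSym φ ψ K I := algebraMap R (TwistedSym φ ψ K I)

variable {K I}

/-- The element of degree one of the symmetric algebra given by `(1 ⊗ k) ⊗ (1 ⊗ μ)`. -/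
def twistedGen (k : K) (μ : Module.Dual A I) : TwistedSym φ ψ K I :=
  SymmetricAlgebra.ι R _ (TwistedConormal.mk φ ψ K I k μ)

lemma twistedGen_add_left (k k' : K) (μ : Module.Dual A I) :
    twistedGen φ ψ (k + k') μ = twistedGen φ ψ k μ + twistedGen φ ψ k' μ := by
  let := φ.toAlgebra
  let := ψ.toAlgebra
  let := (ψ.comp φ).toAlgebra
  rw [twistedGen, twistedGen, twistedGen, ← map_add]
  congr 1
  refine Eq.trans ?_ (TensorProduct.add_tmul _ _ _)
  exact congrArg (· ⊗ₜ[R] _) (TensorProduct.tmul_add _ _ _)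

lemma twistedGen_add_right (k : K) (μ μ' : Module.Dual A I) :
    twistedGen φ ψ k (μ + μ') = twistedGen φ ψ k μ + twistedGen φ ψ k μ' := by
  let := φ.toAlgebra
  let := ψ.toAlgebra
  let := (ψ.comp φ).toAlgebra
  rw [twistedGen, twistedGen, twistedGen, ← map_add]
  congr 1
  refine Eq.trans ?_ (TensorProduct.tmul_add _ _ _)
  exact congrArg (_ ⊗ₜ[R] ·) (TensorProduct.tmul_add _ _ _)

lemma twistedGen_smul_left (b : B) (k : K) (μ : Module.Dual A I) :
    twistedGen φ ψ (b • k) μ =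
      algebraMap R (TwistedSym φ ψ K I) (ψ (φ b)) * twistedGen φ ψ k μ := by
  let := φ.toAlgebra
  let := ψ.toAlgebra
  let := (ψ.comp φ).toAlgebra
  rw [twistedGen, twistedGen, ← Algebra.smul_def, ← map_smul]
  congr 1
  refine Eq.trans ?_ (TensorProduct.smul_tmul' (ψ (φ b)) _ _).symm
  refine congrArg (· ⊗ₜ[R] _) ?_
  rw [TensorProduct.tmul_smul, TensorProduct.smul_tmul', TensorProduct.smul_tmul',
    Algebra.smul_def, mul_one]
  rw [smul_eq_mul, mul_one]
  rfl

lemma twistedGen_smul_right (a : A) (k : K) (μ : Module.Dual A I) :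
    twistedGen φ ψ k (a • μ) =
      algebraMap R (TwistedSym φ ψ K I) (ψ a) * twistedGen φ ψ k μ := by
  let := φ.toAlgebra
  let := ψ.toAlgebra
  let := (ψ.comp φ).toAlgebra
  rw [twistedGen, twistedGen, ← Algebra.smul_def, ← map_smul]
  congr 1
  refine Eq.trans ?_ (TensorProduct.tmul_smul (ψ a) _ _)
  refine congrArg (_ ⊗ₜ[R] ·) ?_
  rw [TensorProduct.tmul_smul, TensorProduct.smul_tmul', TensorProduct.smul_tmul',
    Algebra.smul_def, mul_one]
  rw [smul_eq_mul, mul_one]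
  rfl

variable {T : Type*} [CommRing T]

lemma twistedConormal_hom_ext {N : Type*} [AddCommGroup N] [Module R N]
    {a b : TwistedConormal φ ψ K I →ₗ[R] N}
    (h : ∀ k μ, a (TwistedConormal.mk φ ψ K I k μ) = b (TwistedConormal.mk φ ψ K I k μ)) :
    a = b := by
  let := φ.toAlgebra
  let := ψ.toAlgebra
  let := (ψ.comp φ).toAlgebra
  let a' : (R ⊗[B] K) ⊗[R] (R ⊗[A] Module.Dual A I) →ₗ[R] N := a
  let b' : (R ⊗[B] K) ⊗[R] (R ⊗[A] Module.Dual A I) →ₗ[R] N := b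
  suffices H : a' = b' from H
  refine TensorProduct.ext' fun x y => ?_
  induction x with
  | zero => simp
  | add x x' hx hx' => rw [TensorProduct.add_tmul, map_add, map_add, hx, hx']
  | tmul r k =>
    induction y with
    | zero => simp
    | add y y' hy hy' => rw [TensorProduct.tmul_add, map_add, map_add, hy, hy']
    | tmul s μ =>
      have e : (r ⊗ₜ[B] k) ⊗ₜ[R] (s ⊗ₜ[A] μ) =
          (r * s) • (((1 : R) ⊗ₜ[B] k) ⊗ₜ[R] ((1 : R) ⊗ₜ[A] μ)) := by
        rw [mul_smul, ← TensorProduct.tmul_smul, TensorProduct.smul_tmul',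
          TensorProduct.smul_tmul', TensorProduct.smul_tmul', smul_eq_mul, smul_eq_mul,
          mul_one, mul_one]
      rw [e, map_smul, map_smul]
      exact congrArg _ (h k μ)

lemma twistedSym_hom_ext {u v : TwistedSym φ ψ K I →+* T}
    (h : u.comp (algebraMap R _) = v.comp (algebraMap R _))
    (h' : ∀ k μ, u (twistedGen φ ψ k μ) = v (twistedGen φ ψ k μ)) : u = v := by
  let : Algebra R T := (u.comp (algebraMap R (TwistedSym φ ψ K I))).toAlgebra
  let u' : TwistedSym φ ψ K I →ₐ[R] T := { u with commutes' := fun r => rfl }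
  let v' : TwistedSym φ ψ K I →ₐ[R] T :=
    { v with commutes' := fun r => (RingHom.congr_fun h r).symm }
  suffices H : u' = v' by
    exact congrArg (fun w : TwistedSym φ ψ K I →ₐ[R] T => (w : TwistedSym φ ψ K I →+* T)) H
  exact SymmetricAlgebra.algHom_ext (twistedConormal_hom_ext φ ψ h')

variable (ρ : R →+* T) (β : K → Module.Dual A I → T)
  (hl : ∀ k k' μ, β (k + k') μ = β k μ + β k' μ) (hr : ∀ k μ μ', β k (μ + μ') = β k μ + β k μ')
  (sl : ∀ b k μ, β (b • k) μ = ρ (ψ (φ b)) * β k μ)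
  (sr : ∀ a k μ, β k (a • μ) = ρ (ψ a) * β k μ)

/-- The ring homomorphism out of the symmetric algebra given by a biadditive map. -/
def twistedSymLift : TwistedSym φ ψ K I →+* T :=
  letI := φ.toAlgebra
  letI := ψ.toAlgebra
  letI := (ψ.comp φ).toAlgebra
  letI : Algebra R T := ρ.toAlgebra
  letI : Algebra A T := (ρ.comp ψ).toAlgebra
  letI : Algebra B T := (ρ.comp (ψ.comp φ)).toAlgebra
  haveI : IsScalarTower A R T := .of_algebraMap_eq' rfl
  haveI : IsScalarTower B R T := .of_algebraMap_eq' rfl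
  letI l2 (k : K) : Module.Dual A I →ₗ[A] T :=
    { toFun := β k, map_add' := hr k, map_smul' := fun a μ => (sr a k μ).trans
        (Algebra.smul_def (R := A) (A := T) a (β k μ)).symm }
  letI l1 : K →ₗ[B] (R ⊗[A] Module.Dual A I →ₗ[R] T) :=
    { toFun := fun k => (l2 k).liftBaseChange R
      map_add' := fun k k' => by
        apply TensorProduct.AlgebraTensorModule.curry_injective
        refine LinearMap.ext_ring (LinearMap.ext fun μ => ?_)
        simpa [l2] using hl k k' μ
      map_smul' := fun b k => by
        apply TensorProduct.AlgebraTensorModule.curry_injective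
        refine LinearMap.ext_ring (LinearMap.ext fun μ => ?_)
        simpa [l2, Algebra.smul_def] using! sl b k μ }
  letI L : (R ⊗[B] K) ⊗[R] (R ⊗[A] Module.Dual A I) →ₗ[R] T :=
    TensorProduct.lift (l1.liftBaseChange R)
  letI L' : TwistedConormal φ ψ K I →ₗ[R] T := L
  (SymmetricAlgebra.lift L' : TwistedSym φ ψ K I →ₐ[R] T).toRingHom

lemma twistedSymLift_algebraMap (r : R) :
    twistedSymLift φ ψ ρ β hl hr sl sr (algebraMap R _ r) = ρ r := by
  let : Algebra R T := ρ.toAlgebra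
  exact AlgHom.commutes (SymmetricAlgebra.lift _) r

lemma twistedSymLift_gen (k : K) (μ : Module.Dual A I) :
    twistedSymLift φ ψ ρ β hl hr sl sr (twistedGen φ ψ k μ) = β k μ := by
  let := φ.toAlgebra
  let := ψ.toAlgebra
  let := (ψ.comp φ).toAlgebra
  let : Algebra R T := ρ.toAlgebra
  let : Algebra A T := (ρ.comp ψ).toAlgebra
  let : Algebra B T := (ρ.comp (ψ.comp φ)).toAlgebra
  have : IsScalarTower A R T := .of_algebraMap_eq' rfl
  have : IsScalarTower B R T := .of_algebraMap_eq' rfl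
  refine Eq.trans (SymmetricAlgebra.lift_ι_apply ..) ?_
  refine Eq.trans (TensorProduct.lift.tmul _ _) ?_
  rw [LinearMap.liftBaseChange_tmul, one_smul]
  exact (LinearMap.liftBaseChange_tmul ..).trans (one_smul _ _)

end TwistedConormal

section TwistedRes

/-- Compatible localizations of the rings and ideals entering in the definition of
`TwistedSym φ ψ K I`. -/
structure TwistedRes {B A R B' A' R' : Type u} [CommRing B] [CommRing A] [CommRing R]
    [CommRing B'] [CommRing A'] [CommRing R'] (φ : B →+* A) (ψ : A →+* R) (K : Ideal B)
    (I : Ideal A) (φ' : B' →+* A') (ψ' : A' →+* R') (K' : Ideal B') (I' : Ideal A') where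
  /-- the localization of `B` -/
  b : B →+* B'
  /-- the localization of `A` -/
  a : A →+* A'
  /-- the localization of `R` -/
  r : R →+* R'
  hφ : a.comp φ = φ'.comp b
  hψ : r.comp ψ = ψ'.comp a
  hK : K.map b = K'
  hI : I.map a = I'
  loc : ∃ s : B, @IsLocalization.Away _ _ s B' _ b.toAlgebra ∧
    @IsLocalization.Away _ _ (φ s) A' _ a.toAlgebra ∧
    @IsLocalization.Away _ _ (ψ (φ s)) R' _ r.toAlgebra

variable {B A R B' A' R' : Type u} [CommRing B] [CommRing A] [CommRing R]
    [CommRing B'] [CommRing A'] [CommRing R'] {φ : B →+* A} {ψ : A →+* R} {K : Ideal B}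
    {I : Ideal A} {φ' : B' →+* A'} {ψ' : A' →+* R'} {K' : Ideal B'} {I' : Ideal A'}

lemma map_mem_of_map_eq {a : A →+* A'} (hI : I.map a = I') (x : I) : a x ∈ I' := by
  rw [← hI]
  exact Ideal.mem_map_of_mem a x.2

lemma dual_ext_of_map_eq {a : A →+* A'} (hI : I.map a = I') {N : Type*} [AddCommGroup N]
    [Module A' N] {μ ν : I' →ₗ[A'] N}
    (h : ∀ x : I, μ ⟨a x, map_mem_of_map_eq hI x⟩ = ν ⟨a x, map_mem_of_map_eq hI x⟩) : μ = ν := by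
  subst hI
  refine LinearMap.ext ?_
  rintro ⟨y, hy⟩
  refine Submodule.span_induction (p := fun y hy => μ ⟨y, hy⟩ = ν ⟨y, hy⟩) ?_ ?_ ?_ ?_ hy
  · rintro _ ⟨x, hx, rfl⟩
    exact h ⟨x, hx⟩
  · exact (map_zero μ).trans (map_zero ν).symm
  · intro x y hx hy hx' hy'
    exact (map_add μ ⟨x, hx⟩ ⟨y, hy⟩).trans
      ((congrArg₂ _ hx' hy').trans (map_add ν ⟨x, hx⟩ ⟨y, hy⟩).symm)
  · intro c x hx hx'
    exact (map_smul μ c ⟨x, hx⟩).trans ((congrArg _ hx').trans (map_smul ν c ⟨x, hx⟩).symm)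

/-- A linear map to a module over a localization extends to the localized module. -/
lemma exists_extend {M M' N : Type*} [AddCommGroup M] [AddCommGroup M'] [AddCommGroup N]
    [Algebra A A'] (S : Submonoid A) [IsLocalization S A'] [Module A M] [Module A M'] [Module A' M']
    [IsScalarTower A A' M'] [Module A N] [Module A' N] [IsScalarTower A A' N]
    (f : M →ₗ[A] M') [IsLocalizedModule S f] (h : M →ₗ[A] N) :
    ∃! h' : M' →ₗ[A'] N, ∀ m, h' (f m) = h m := by
  have hu : ∀ x : S, IsUnit (algebraMap A (Module.End A N) x) := fun x => by
    rw [Module.End.isUnit_iff]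
    have hx := IsLocalization.map_units A' x
    constructor
    · intro n n' e
      have e' : algebraMap A A' x • n = algebraMap A A' x • n' := by
        simpa [algebraMap_smul] using e
      exact hx.smul_left_cancel.mp e'
    · intro n
      refine ⟨(hx.unit⁻¹ : A'ˣ) • n, ?_⟩
      change (x : A) • (((hx.unit⁻¹ : A'ˣ) : A') • n) = n
      rw [← algebraMap_smul A' (x : A), ← mul_smul, IsUnit.mul_val_inv, one_smul]
  refine ⟨(IsLocalizedModule.lift S f h hu).extendScalarsOfIsLocalization S A',
    fun m => IsLocalizedModule.lift_apply S f h hu m, fun h'' hh => ?_⟩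
  refine LinearMap.ext fun m' => ?_
  have := IsLocalizedModule.lift_unique S f h hu (h''.restrictScalars A) (LinearMap.ext hh)
  exact (LinearMap.congr_fun this m').symm

lemma existsUnique_dual (a : A →+* A') (hI : I.map a = I')
    (ha : ∃ s : A, @IsLocalization.Away _ _ s A' _ a.toAlgebra) (μ : Module.Dual A I) :
    ∃! ν : Module.Dual A' I', ∀ x : I, ν ⟨a x, map_mem_of_map_eq hI x⟩ = a (μ x) := by
  obtain ⟨s, hs⟩ := ha
  let := a.toAlgebra
  subst hI
  exact exists_extend (Submonoid.powers s) (Algebra.idealMap (S := A') I)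
    (Algebra.linearMap A A' ∘ₗ μ)

namespace TwistedRes

variable (d : TwistedRes φ ψ K I φ' ψ' K' I')

lemma exists_loc_a : ∃ s : A, @IsLocalization.Away _ _ s A' _ d.a.toAlgebra :=
  ⟨_, d.loc.choose_spec.2.1⟩

/-- The localization of elements of `K`. -/
def mapK (k : K) : K' := ⟨d.b k, map_mem_of_map_eq d.hK k⟩

/-- The localization of linear forms on `I`. -/
def mapDual (μ : Module.Dual A I) : Module.Dual A' I' :=
  (existsUnique_dual d.a d.hI d.exists_loc_a μ).choose

lemma mapDual_apply (μ : Module.Dual A I) (x : I) :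
    d.mapDual μ ⟨d.a x, map_mem_of_map_eq d.hI x⟩ = d.a (μ x) :=
  (existsUnique_dual d.a d.hI d.exists_loc_a μ).choose_spec.1 x

lemma eq_mapDual {μ : Module.Dual A I} {ν : Module.Dual A' I'}
    (h : ∀ x : I, ν ⟨d.a x, map_mem_of_map_eq d.hI x⟩ = d.a (μ x)) : ν = d.mapDual μ :=
  dual_ext_of_map_eq d.hI fun x => (h x).trans (d.mapDual_apply μ x).symm

lemma mapDual_add (μ ν : Module.Dual A I) : d.mapDual (μ + ν) = d.mapDual μ + d.mapDual ν :=
  (d.eq_mapDual fun x => by simp [mapDual_apply]).symm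

lemma mapDual_smul (c : A) (μ : Module.Dual A I) : d.mapDual (c • μ) = d.a c • d.mapDual μ :=
  (d.eq_mapDual fun x => by simp [mapDual_apply]).symm

lemma mapK_add (k l : K) : d.mapK (k + l) = d.mapK k + d.mapK l :=
  Subtype.ext (map_add d.b _ _)

lemma mapK_smul (c : B) (k : K) : d.mapK (c • k) = d.b c • d.mapK k :=
  Subtype.ext (map_mul d.b _ _)

/-- The homomorphism of symmetric algebras induced by localization. -/
def map : TwistedSym φ ψ K I →+* TwistedSym φ' ψ' K' I' :=
  twistedSymLift φ ψ ((algebraMap R' _).comp d.r)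
    (fun k μ => twistedGen φ' ψ' (d.mapK k) (d.mapDual μ))
    (fun k l μ => by rw [mapK_add, twistedGen_add_left])
    (fun k μ ν => by rw [mapDual_add, twistedGen_add_right])
    (fun c k μ => by
      rw [mapK_smul, twistedGen_smul_left, ← RingHom.comp_apply φ', ← d.hφ, RingHom.comp_apply,
        ← RingHom.comp_apply ψ', ← d.hψ]
      rfl)
    (fun c k μ => by
      rw [mapDual_smul, twistedGen_smul_right, ← RingHom.comp_apply ψ', ← d.hψ]
      rfl)

lemma map_algebraMap (x : R) : d.map (algebraMap R _ x) = algebraMap R' _ (d.r x) :=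
  twistedSymLift_algebraMap ..

lemma map_gen (k : K) (μ : Module.Dual A I) :
    d.map (twistedGen φ ψ k μ) = twistedGen φ' ψ' (d.mapK k) (d.mapDual μ) :=
  twistedSymLift_gen ..

lemma map_comp_str : d.map.comp ((twistedStr φ ψ K I).comp (ψ.comp φ)) =
    ((twistedStr φ' ψ' K' I').comp (ψ'.comp φ')).comp d.b := by
  refine RingHom.ext fun x => ?_
  have h1 : d.r (ψ (φ x)) = ψ' (d.a (φ x)) := RingHom.congr_fun d.hψ _
  have h2 : d.a (φ x) = φ' (d.b x) := RingHom.congr_fun d.hφ _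
  refine (d.map_algebraMap _).trans ?_
  exact congrArg (algebraMap R' (TwistedSym φ' ψ' K' I')) (h1.trans (congrArg ψ' h2))

lemma map_eq_id (e : TwistedRes φ ψ K I φ ψ K I) (hb : e.b = RingHom.id B) (ha : e.a = RingHom.id A)
    (hr : e.r = RingHom.id R) : e.map = RingHom.id _ := by
  have ha' (y) : e.a y = y := by rw [ha]; rfl
  have hb' (y) : e.b y = y := by rw [hb]; rfl
  refine twistedSym_hom_ext φ ψ (RingHom.ext fun x => ?_) fun k μ => ?_
  · rw [RingHom.comp_apply, map_algebraMap, hr]; rfl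
  · rw [map_gen]
    have h1 : e.mapK k = k := Subtype.ext (hb' k)
    have h2 : μ = e.mapDual μ := e.eq_mapDual fun x => by
      exact (congrArg μ (Subtype.ext (ha' x))).trans (ha' _).symm
    rw [h1, ← h2]; rfl

lemma map_eq_comp {B'' A'' R'' : Type u} [CommRing B''] [CommRing A''] [CommRing R'']
    {φ'' : B'' →+* A''} {ψ'' : A'' →+* R''} {K'' : Ideal B''} {I'' : Ideal A''}
    (d' : TwistedRes φ' ψ' K' I' φ'' ψ'' K'' I'') (d'' : TwistedRes φ ψ K I φ'' ψ'' K'' I'')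
    (hb : d''.b = d'.b.comp d.b) (ha : d''.a = d'.a.comp d.a) (hr : d''.r = d'.r.comp d.r) :
    d''.map = d'.map.comp d.map := by
  have ha' (y) : d''.a y = d'.a (d.a y) := by rw [ha]; rfl
  refine twistedSym_hom_ext φ ψ (RingHom.ext fun x => ?_) fun k μ => ?_
  · simp [map_algebraMap, hr]
  · rw [RingHom.comp_apply, map_gen, map_gen, map_gen]
    congr 1
    · exact Subtype.ext (by simp [mapK, hb])
    · refine (d''.eq_mapDual fun x => ?_).symm
      rw [ha' (μ x), ← mapDual_apply, ← mapDual_apply]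
      exact congrArg _ (Subtype.ext (ha' x))

/-- The localization of linear forms, as a linear map. -/
def mapDualₗ : letI := d.a.toAlgebra
    Module.Dual A I →ₗ[A] Module.Dual A' I' :=
  letI := d.a.toAlgebra
  { toFun := d.mapDual, map_add' := d.mapDual_add, map_smul' := d.mapDual_smul }

/-- The localization of `K`, as a linear map. -/
def mapKₗ : letI := d.b.toAlgebra
    K →ₗ[B] K' :=
  letI := d.b.toAlgebra
  { toFun := d.mapK, map_add' := d.mapK_add, map_smul' := d.mapK_smul }

lemma isLocalizedModule_mapKₗ (s : B) (hs : @IsLocalization.Away _ _ s B' _ d.b.toAlgebra) :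
    letI := d.b.toAlgebra
    IsLocalizedModule (Submonoid.powers s) d.mapKₗ := by
  obtain ⟨b, a, r, hφ, hψ, rfl, rfl, loc⟩ := d
  let := b.toAlgebra
  exact inferInstanceAs (IsLocalizedModule (Submonoid.powers s) (Algebra.idealMap (S := B') K))

lemma isLocalizedModule_mapDualₗ [Module.Invertible A I] (s : A)
    (hs : @IsLocalization.Away _ _ s A' _ d.a.toAlgebra) :
    letI := d.a.toAlgebra
    IsLocalizedModule (Submonoid.powers s) d.mapDualₗ := by
  obtain ⟨b, a, r, hφ, hψ, rfl, rfl, loc⟩ := d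
  let := a.toAlgebra
  have : Module.FinitePresentation A I := Module.finitePresentation_of_projective A I
  let d : TwistedRes φ ψ K I φ' ψ' _ _ := ⟨b, a, r, hφ, hψ, rfl, rfl, loc⟩
  have e : d.mapDualₗ = IsLocalizedModule.mapExtendScalars (Submonoid.powers s)
      (Algebra.idealMap (S := A') I) (Algebra.linearMap A A') A' := by
    refine LinearMap.ext fun μ => (d.eq_mapDual fun x => ?_).symm
    exact IsLocalizedModule.map_apply (Submonoid.powers s) (Algebra.idealMap (S := A') I)
      (Algebra.linearMap A A') μ x
  change IsLocalizedModule (Submonoid.powers s) d.mapDualₗ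
  rw [e]
  infer_instance

lemma exists_extend_hom [Module.Invertible A I] {T : Type u} [CommRing T]
    (u : TwistedSym φ ψ K I →+* T) (ρ : R' →+* T)
    (hρ : ρ.comp d.r = u.comp (algebraMap R _)) :
    ∃ v : TwistedSym φ' ψ' K' I' →+* T, v.comp (algebraMap R' _) = ρ ∧ v.comp d.map = u := by
  obtain ⟨s, hb, ha, -⟩ := d.loc
  let := d.b.toAlgebra
  let := d.a.toAlgebra
  let : Algebra B' T := (ρ.comp (ψ'.comp φ')).toAlgebra
  let : Algebra A' T := (ρ.comp ψ').toAlgebra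
  let : Algebra B T := (ρ.comp (ψ'.comp (φ'.comp d.b))).toAlgebra
  let : Algebra A T := (ρ.comp (ψ'.comp d.a)).toAlgebra
  have : IsScalarTower B B' T := .of_algebraMap_eq' rfl
  have : IsScalarTower A A' T := .of_algebraMap_eq' rfl
  have hr (x) : ρ (d.r x) = u (algebraMap R _ x) := RingHom.congr_fun hρ x
  have hψ (x) : d.r (ψ x) = ψ' (d.a x) := RingHom.congr_fun d.hψ x
  have hφ (x) : d.a (φ x) = φ' (d.b x) := RingHom.congr_fun d.hφ x
  have := d.isLocalizedModule_mapDualₗ _ ha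
  have := d.isLocalizedModule_mapKₗ _ hb
  let β (k : K) : Module.Dual A I →ₗ[A] T :=
    { toFun := fun μ => u (twistedGen φ ψ k μ)
      map_add' := fun μ ν => by rw [twistedGen_add_right, map_add]
      map_smul' := fun c μ => by
        rw [twistedGen_smul_right, map_mul, ← hr, hψ]; rfl }
  choose β1 hβ1 hβ1' using fun k =>
    exists_extend (A' := A') (Submonoid.powers (φ s)) d.mapDualₗ (β k)
  let β2 : K →ₗ[B] (Module.Dual A' I' →ₗ[A'] T) :=
    { toFun := β1
      map_add' := fun k l => (hβ1' _ _ fun μ => by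
        rw [LinearMap.add_apply, hβ1, hβ1]
        exact (map_add u _ _).symm.trans (congrArg u (twistedGen_add_left ..).symm)).symm
      map_smul' := fun c k => (hβ1' _ _ fun μ => by
        rw [LinearMap.smul_apply, RingHom.id_apply, hβ1]
        refine Eq.trans ?_ (congrArg u (twistedGen_smul_left ..).symm)
        rw [map_mul, ← hr, hψ, hφ]; rfl).symm }
  obtain ⟨β3, hβ3, -⟩ := exists_extend (A' := B') (Submonoid.powers s) d.mapKₗ β2
  have hβ (k μ) : β3 (d.mapK k) (d.mapDual μ) = u (twistedGen φ ψ k μ) :=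
    (LinearMap.congr_fun (hβ3 k) (d.mapDual μ)).trans (hβ1 k μ)
  refine ⟨twistedSymLift φ' ψ' ρ (fun k μ => β3 k μ) (fun k l μ => by simp) (fun k μ ν => by simp)
    (fun c k μ => by rw [map_smul]; rfl) (fun c k μ => by rw [map_smul]; rfl), ?_, ?_⟩
  · exact RingHom.ext fun x => by rw [RingHom.comp_apply, twistedSymLift_algebraMap]
  · refine twistedSym_hom_ext φ ψ (RingHom.ext fun x => ?_) fun k μ => ?_
    · rw [RingHom.comp_apply, RingHom.comp_apply, map_algebraMap, twistedSymLift_algebraMap, hr]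
      rfl
    · rw [RingHom.comp_apply, map_gen, twistedSymLift_gen, hβ]

lemma hom_ext' [Module.Invertible A I] {T : Type*} [CommRing T]
    {v w : TwistedSym φ' ψ' K' I' →+* T}
    (h : v.comp (algebraMap R' _) = w.comp (algebraMap R' _)) (h' : v.comp d.map = w.comp d.map) :
    v = w := by
  refine twistedSym_hom_ext φ' ψ' h fun k μ => ?_
  obtain ⟨s, hb, ha, -⟩ := d.loc
  let := d.b.toAlgebra
  let := d.a.toAlgebra
  have := d.isLocalizedModule_mapDualₗ _ ha
  have := d.isLocalizedModule_mapKₗ _ hb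
  obtain ⟨⟨k0, x⟩, hk⟩ := IsLocalizedModule.surj (Submonoid.powers s) d.mapKₗ k
  obtain ⟨⟨μ0, y⟩, hμ⟩ := IsLocalizedModule.surj (Submonoid.powers (φ s)) d.mapDualₗ μ
  have hk' : d.b x • k = d.mapK k0 := hk
  have hμ' : d.a y • μ = d.mapDual μ0 := hμ
  have hx : IsUnit (v (algebraMap R' _ (ψ' (φ' (d.b x))))) :=
    ((((IsLocalization.map_units B' x).map φ').map ψ').map (algebraMap R' _)).map v
  have hy : IsUnit (v (algebraMap R' _ (ψ' (d.a y)))) :=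
    (((IsLocalization.map_units A' y).map ψ').map (algebraMap R' _)).map v
  have hvw (z) : v (algebraMap R' _ z) = w (algebraMap R' _ z) := RingHom.congr_fun h z
  have e : v (twistedGen φ' ψ' (d.mapK k0) (d.mapDual μ0)) =
      w (twistedGen φ' ψ' (d.mapK k0) (d.mapDual μ0)) := by
    rw [← map_gen]
    exact RingHom.congr_fun h' _
  rw [← hk', ← hμ', twistedGen_smul_left, twistedGen_smul_right] at e
  rw [map_mul, map_mul, map_mul w, map_mul w, ← hvw, ← hvw] at e
  exact hy.mul_left_cancel (hx.mul_left_cancel e)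

lemma isLocalization_map [Module.Invertible A I] (x : R)
    (hx : @IsLocalization.Away _ _ x R' _ d.r.toAlgebra) :
    @IsLocalization.Away _ _ (algebraMap R (TwistedSym φ ψ K I) x) (TwistedSym φ' ψ' K' I') _
      d.map.toAlgebra := by
  let := d.r.toAlgebra
  set y := algebraMap R (TwistedSym φ ψ K I) x
  let L := Localization.Away y
  let j := algebraMap (TwistedSym φ ψ K I) L
  have hy : IsUnit (j y) := IsLocalization.Away.algebraMap_isUnit y
  let ρ : R' →+* L := IsLocalization.Away.lift x (g := j.comp (algebraMap R _)) hy
  obtain ⟨v, hv1, hv2⟩ := d.exists_extend_hom j ρ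
    (RingHom.ext fun z => IsLocalization.Away.lift_eq x hy z)
  have hy' : IsUnit (d.map y) := by
    rw [map_algebraMap]
    exact (IsLocalization.Away.algebraMap_isUnit (S := R') x).map _
  let w : L →+* TwistedSym φ' ψ' K' I' := IsLocalization.Away.lift y hy'
  have hw (z) : w (j z) = d.map z := IsLocalization.Away.lift_eq y hy' z
  have hv2' (z) : v (d.map z) = j z := RingHom.congr_fun hv2 z
  have h1 : v.comp w = RingHom.id _ := by
    refine IsLocalization.ringHom_ext (Submonoid.powers y) (RingHom.ext fun z => ?_)
    exact (congrArg v (hw z)).trans (hv2' z)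
  have h2 : w.comp v = RingHom.id _ := by
    refine d.hom_ext' ?_ (RingHom.ext fun z => (congrArg w (hv2' z)).trans (hw z))
    rw [RingHom.comp_assoc, hv1]
    refine IsLocalization.ringHom_ext (Submonoid.powers x) (RingHom.ext fun z => ?_)
    have e1 : ρ (d.r z) = j (algebraMap R _ z) := IsLocalization.Away.lift_eq x hy z
    have e2 : w (ρ (d.r z)) = algebraMap R' _ (d.r z) := by
      rw [e1, hw, map_algebraMap]
    exact e2
  let := d.map.toAlgebra
  let e : L ≃ₐ[TwistedSym φ ψ K I] TwistedSym φ' ψ' K' I' :=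
    AlgEquiv.ofAlgHom { w with commutes' := hw } { v with commutes' := hv2' }
      (AlgHom.ext fun z => RingHom.congr_fun h2 z) (AlgHom.ext fun z => RingHom.congr_fun h1 z)
  exact IsLocalization.isLocalization_of_algEquiv (Submonoid.powers y) e

end TwistedRes

end TwistedRes

/-! ### Effective Cartier divisors and the bundle `V(𝓝_g ⊗ 𝓞_D(D))` -/

/-- An effective Cartier divisor on `X`: a closed subscheme whose ideal sheaf is invertible. -/
structure EffectiveCartierDivisor (X : Scheme.{u}) where
  /-- the ideal sheaf -/
  ideal : X.IdealSheafData
  invertible : ∀ U : X.affineOpens, Module.Invertible Γ(X, U) (ideal.ideal U)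

section NormalBundle

open Scheme.AffineZariskiSite

/-- Morphisms out of a glued scheme. -/
def gluedDesc {S : Scheme.{u}} {𝒰 : S.OpenCover} [Category 𝒰.I₀] [𝒰.LocallyDirected]
    (d : 𝒰.RelativeGluingData) [Small.{u} 𝒰.I₀] [Quiver.IsThin 𝒰.I₀] (c : Cocone d.functor) :
    d.glued ⟶ c.pt :=
  colimit.desc _ c

lemma ι_gluedDesc {S : Scheme.{u}} {𝒰 : S.OpenCover} [Category 𝒰.I₀] [𝒰.LocallyDirected]
    (d : 𝒰.RelativeGluingData) [Small.{u} 𝒰.I₀] [Quiver.IsThin 𝒰.I₀] (c : Cocone d.functor)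
    (i : 𝒰.I₀) : d.cover.f i ≫ gluedDesc d c = c.ι.app i :=
  colimit.ι_desc _ _

lemma isLocalization_of_eq_basicOpen {Z : Scheme.{u}} {W : Z.Opens} (hW : IsAffineOpen W)
    (s : Γ(Z, W)) (W' : Z.Opens) (e : W' = Z.basicOpen s) (h : W' ≤ W) :
    @IsLocalization.Away _ _ s Γ(Z, W') _ (Z.presheaf.map (homOfLE h).op).hom.toAlgebra := by
  subst e
  exact hW.isLocalization_basicOpen s

lemma preimage_eq_basicOpen {Z Y : Scheme.{u}} (p : Z ⟶ Y) {V W : Y.Opens} (s : Γ(Y, W))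
    (h : V = Y.basicOpen s) : p ⁻¹ᵁ V = Z.basicOpen (p.app W s) := by
  rw [h, Scheme.preimage_basicOpen]

lemma SpecMap_app_fromSpec {X Y : Scheme.{u}} (g : X ⟶ Y) [IsAffineHom g] {V : Y.Opens} (hV : IsAffineOpen V) :
    Spec.map (g.app V) ≫ hV.fromSpec = (hV.preimage g).fromSpec ≫ g := by
  rw [Scheme.Hom.app_eq_appLE]
  exact IsAffineOpen.SpecMap_appLE_fromSpec g hV (hV.preimage g) le_rfl

lemma SpecMap_comp_fromSpec {X Y : Scheme.{u}} (g : X ⟶ Y) [IsAffineHom g] {Z : Scheme.{u}} (i : Z ⟶ X) [IsAffineHom i]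
    {V : Y.Opens} (hV : IsAffineOpen V) {T : CommRingCat.{u}} (s : Γ(Z, i ⁻¹ᵁ g ⁻¹ᵁ V) ⟶ T) :
    Spec.map (g.app V ≫ i.app (g ⁻¹ᵁ V) ≫ s) ≫ hV.fromSpec =
      Spec.map s ≫ ((hV.preimage g).preimage i).fromSpec ≫ i ≫ g := by
  rw [Spec.map_comp, Spec.map_comp, Category.assoc, Category.assoc, SpecMap_app_fromSpec,
    ← Category.assoc (Spec.map (i.app _)), SpecMap_app_fromSpec, Category.assoc]

/-- The objects of the affine Zariski site as affine opens. -/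
abbrev aff {Y : Scheme.{u}} (V : Y.AffineZariskiSite) : Y.affineOpens := ⟨V.toOpens, V.2⟩

variable {X Y : Scheme.{u}} (g : X ⟶ Y) [IsClosedImmersion g] (D : EffectiveCartierDivisor X)

/-- The ideal of `D` on the preimage of an affine open of `Y`. -/
def divisorIdeal (V : Y.affineOpens) : Ideal Γ(X, g ⁻¹ᵁ V.1) :=
  D.ideal.ideal ⟨g ⁻¹ᵁ V.1, V.2.preimage g⟩

instance (V : Y.affineOpens) : Module.Invertible Γ(X, g ⁻¹ᵁ V.1) (divisorIdeal g D V) :=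
  D.invertible ⟨g ⁻¹ᵁ V.1, V.2.preimage g⟩

/-- For an affine open `V` of `Y`, the symmetric algebra of the module of sections of
`𝓝_g ⊗ 𝓞_D(D)` over the preimage of `V` in `D`. Here `𝓝_g` is the conormal sheaf `g^* 𝓚`, where
`𝓚` is the ideal of `g`, and `𝓞_X(D)` is the dual of the ideal of `D`. -/
abbrev NormalSym (V : Y.affineOpens) : Type u :=
  TwistedSym (g.app V.1).hom (D.ideal.subschemeι.app (g ⁻¹ᵁ V.1)).hom (g.ker.ideal V)
    (divisorIdeal g D V)

/-- The restriction to a basic open. -/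
def normalRes {V W : Y.AffineZariskiSite} (i : V ⟶ W) :
    TwistedRes (g.app (aff W).1).hom (D.ideal.subschemeι.app (g ⁻¹ᵁ (aff W).1)).hom (g.ker.ideal (aff W))
      (divisorIdeal g D (aff W)) (g.app (aff V).1).hom (D.ideal.subschemeι.app (g ⁻¹ᵁ (aff V).1)).hom
      (g.ker.ideal (aff V)) (divisorIdeal g D (aff V)) where
  b := (Y.presheaf.map (homOfLE (toOpens_mono i.le)).op).hom
  a := (X.presheaf.map (homOfLE (g.preimage_mono (toOpens_mono i.le))).op).hom
  r := (D.ideal.subscheme.presheaf.map (homOfLE (D.ideal.subschemeι.preimage_mono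
    (g.preimage_mono (toOpens_mono i.le)))).op).hom
  hφ := congrArg CommRingCat.Hom.hom (g.naturality (homOfLE (toOpens_mono i.le)).op).symm
  hψ := congrArg CommRingCat.Hom.hom (D.ideal.subschemeι.naturality
    (homOfLE (g.preimage_mono (toOpens_mono i.le))).op).symm
  hK := g.ker.map_ideal' (U := aff V) (V := aff W) _
  hI := D.ideal.map_ideal' (U := ⟨g ⁻¹ᵁ (aff V).1, V.2.preimage g⟩) (V := ⟨g ⁻¹ᵁ (aff W).1, W.2.preimage g⟩) _
  loc := by
    obtain ⟨s, hs⟩ := i.le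
    refine ⟨s, isLocalization_of_eq_basicOpen W.2 s _ hs.symm _,
      isLocalization_of_eq_basicOpen (W.2.preimage g) _ _ ?_ _,
      isLocalization_of_eq_basicOpen ((W.2.preimage g).preimage D.ideal.subschemeι) _ _ ?_ _⟩
    · exact preimage_eq_basicOpen g s hs.symm
    · exact preimage_eq_basicOpen D.ideal.subschemeι _ (preimage_eq_basicOpen g s hs.symm)

/-- The quasi-coherent algebra `Sym(𝓝_g ⊗ 𝓞_D(D))`, pushed forward to `Y`. -/
def normalAlgebra : Y.AffineZariskiSiteᵒᵖ ⥤ CommRingCat.{u} where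
  obj V := .of (NormalSym g D (aff V.unop))
  map i := CommRingCat.ofHom (normalRes g D i.unop).map
  map_id V := by
    ext1
    refine TwistedRes.map_eq_id _ ?_ ?_ ?_
    · exact congrArg CommRingCat.Hom.hom (Y.presheaf.map_id _)
    · exact congrArg CommRingCat.Hom.hom (X.presheaf.map_id _)
    · exact congrArg CommRingCat.Hom.hom (D.ideal.subscheme.presheaf.map_id _)
  map_comp i j := by
    ext1
    refine TwistedRes.map_eq_comp _ _ _ ?_ ?_ ?_
    · exact congrArg CommRingCat.Hom.hom (Y.presheaf.map_comp _ _)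
    · exact congrArg CommRingCat.Hom.hom (X.presheaf.map_comp _ _)
    · exact congrArg CommRingCat.Hom.hom (D.ideal.subscheme.presheaf.map_comp _ _)

/-- The structure map from `𝓞_D`. -/
def normalStr (V : Y.affineOpens) :
    Γ(D.ideal.subscheme, D.ideal.subschemeι ⁻¹ᵁ g ⁻¹ᵁ V.1) ⟶ .of (NormalSym g D V) :=
  CommRingCat.ofHom (twistedStr _ _ _ _)

/-- The structure map from `𝓞_Y`. -/
def normalAlgebraMap : (toOpensFunctor Y).op ⋙ Y.presheaf ⟶ normalAlgebra g D where
  app V := g.app (aff V.unop).1 ≫ D.ideal.subschemeι.app (g ⁻¹ᵁ (aff V.unop).1) ≫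
    normalStr g D (aff V.unop)
  naturality _ _ i := CommRingCat.hom_ext (normalRes g D i.unop).map_comp_str.symm

lemma coequifibered_normalAlgebraMap : (normalAlgebraMap g D).Coequifibered := by
  refine coequifibered_iff_forall_isLocalizationAway.mpr fun U s => ?_
  exact (normalRes g D (homOfLE (U.basicOpen_le s))).isLocalization_map _
    (isLocalization_of_eq_basicOpen ((U.2.preimage g).preimage D.ideal.subschemeι) _ _
      (preimage_eq_basicOpen D.ideal.subschemeι _ (preimage_eq_basicOpen g s rfl)) _)

/-- The gluing data of the vector bundle `V(𝓝_g ⊗ 𝓞_D(D))`. -/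
def normalGluingData : (directedCover Y).RelativeGluingData :=
  relativeGluingData (coequifibered_normalAlgebraMap g D)

/-- The vector bundle `V(𝓝_g ⊗ 𝓞_D(D))`, the relative spectrum of `Sym(𝓝_g ⊗ 𝓞_D(D))`. -/
def normalBundle : Scheme.{u} := (normalGluingData g D).glued

/-- The open immersion in the vector bundle of its part over an affine open of `Y`. -/
def normalBundleι (V : Y.affineOpens) : Spec (.of (NormalSym g D V)) ⟶ normalBundle g D :=
  (normalGluingData g D).cover.f ⟨V.1, V.2⟩

instance (V : Y.affineOpens) : IsOpenImmersion (normalBundleι g D V) :=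
  (normalGluingData g D).cover.map_prop ⟨V.1, V.2⟩

lemma normalBundle_cocone {V W : Y.AffineZariskiSite} (i : V ⟶ W) :
    Spec.map (CommRingCat.ofHom (normalRes g D i).map) ≫ Spec.map (normalStr g D (aff W)) ≫
      ((W.2.preimage g).preimage D.ideal.subschemeι).fromSpec =
    Spec.map (normalStr g D (aff V)) ≫
      ((V.2.preimage g).preimage D.ideal.subschemeι).fromSpec := by
  have h : normalStr g D (aff W) ≫ CommRingCat.ofHom (normalRes g D i).map =
      D.ideal.subscheme.presheaf.map (homOfLE (D.ideal.subschemeι.preimage_mono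
        (g.preimage_mono (toOpens_mono i.le)))).op ≫ normalStr g D (aff V) := by
    ext x
    exact (normalRes g D i).map_algebraMap x
  rw [← Spec.map_comp_assoc, h, Spec.map_comp, Category.assoc, IsAffineOpen.map_fromSpec]

/-- The projection of the vector bundle to `D`. -/
def normalBundleToDivisor : normalBundle g D ⟶ D.ideal.subscheme :=
  gluedDesc (normalGluingData g D)
    { pt := D.ideal.subscheme
      ι :=
        { app := fun V => Spec.map (normalStr g D ⟨V.1, V.2⟩) ≫
            ((V.2.preimage g).preimage D.ideal.subschemeι).fromSpec
          naturality := fun _ _ i =>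
            (normalBundle_cocone g D i).trans (Category.comp_id _).symm } }

lemma normalBundleι_toDivisor (V : Y.affineOpens) :
    normalBundleι g D V ≫ normalBundleToDivisor g D = Spec.map (normalStr g D V) ≫
      ((V.2.preimage g).preimage D.ideal.subschemeι).fromSpec :=
  ι_gluedDesc (normalGluingData g D) _ ⟨V.1, V.2⟩

lemma normalBundleToDivisor_comp :
    normalBundleToDivisor g D ≫ D.ideal.subschemeι ≫ g = (normalGluingData g D).toBase := by
  refine (normalGluingData g D).cover.hom_ext _ _ fun V => ?_
  refine Eq.trans ?_ (Scheme.Cover.RelativeGluingData.ι_toBase (normalGluingData g D) V).symm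
  have h1 := normalBundleι_toDivisor g D (aff V)
  have h2 : Spec.map (g.app (aff V).1 ≫ D.ideal.subschemeι.app (g ⁻¹ᵁ (aff V).1) ≫
      normalStr g D (aff V)) ≫ V.2.fromSpec = Spec.map (normalStr g D (aff V)) ≫
      ((V.2.preimage g).preimage D.ideal.subschemeι).fromSpec ≫ D.ideal.subschemeι ≫ g :=
    SpecMap_comp_fromSpec g D.ideal.subschemeι V.2 _
  have h3 : ((normalGluingData g D).natTrans.app V) ≫ (directedCover Y).f V =
      Spec.map (g.app (aff V).1 ≫ D.ideal.subschemeι.app (g ⁻¹ᵁ (aff V).1) ≫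
      normalStr g D (aff V)) ≫ V.2.fromSpec := Category.assoc _ _ _
  refine Eq.trans ?_ (h2.symm.trans h3.symm)
  refine (Category.assoc _ _ _).symm.trans ?_
  refine (congrArg (fun q => q ≫ D.ideal.subschemeι ≫ g) h1).trans ?_
  exact Category.assoc _ _ _

lemma normalBundle_preimage (V : Y.affineOpens) :
    normalBundleToDivisor g D ⁻¹ᵁ D.ideal.subschemeι ⁻¹ᵁ g ⁻¹ᵁ V.1 =
      normalBundleι g D V ''ᵁ ⊤ := by
  have h := (normalGluingData g D).toBase_preimage_eq_opensRange_ι ⟨V.1, V.2⟩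
  rw [← normalBundleToDivisor_comp] at h
  rw [Scheme.Hom.image_top_eq_opensRange]
  simpa using! h

/-- The function on the part of the vector bundle over `V` given by an element of
`Sym(𝓝_g ⊗ 𝓞_D(D))(V)`. -/
def normalBundleFun (V : Y.affineOpens) (s : NormalSym g D V) :
    Γ(normalBundle g D, normalBundleToDivisor g D ⁻¹ᵁ D.ideal.subschemeι ⁻¹ᵁ g ⁻¹ᵁ V.1) :=
  ((Scheme.ΓSpecIso (.of (NormalSym g D V))).inv ≫ ((normalBundleι g D V).appIso ⊤).inv ≫
    (normalBundle g D).presheaf.map (eqToHom (normalBundle_preimage g D V)).op).hom s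

end NormalBundle

/-! ### The canonical morphism -/

section Canonical

/-- A closed immersion is regular if, locally around the points of its image, its ideal is generated
by a regular sequence `r₁, …, rₘ`: multiplication by `rᵢ` is injective modulo `r₁, …, rᵢ₋₁`. -/
def IsRegularImmersion {X Y : Scheme.{u}} (g : X ⟶ Y) [IsClosedImmersion g] : Prop :=
  ∀ x : X, ∃ V : Y.affineOpens, g x ∈ V.1 ∧ ∃ rs : List Γ(Y, V),
    RingTheory.Sequence.IsWeaklyRegular Γ(Y, V) rs ∧ Ideal.ofList rs = g.ker.ideal V

lemma isClosedImmersion_section {X Y : Scheme.{u}} (f : Y ⟶ X) [IsSeparated f] (g : X ⟶ Y)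
    (hg : g ≫ f = 𝟙 X) : IsClosedImmersion g :=
  have : IsClosedImmersion (g ≫ f) := by rw [hg]; infer_instance
  IsClosedImmersion.of_comp g f

variable {X Y : Scheme.{u}} (f : Y ⟶ X) (g : X ⟶ Y) (hg : g ≫ f = 𝟙 X)
  (D : EffectiveCartierDivisor X)

/-- The part of the exceptional divisor over an open subset of `Y`. -/
abbrev exceptionalOpen (V : Y.Opens) : (exceptionalDivisor f g hg D.ideal).Opens :=
  exceptionalDivisorToDivisor f g hg D.ideal ⁻¹ᵁ D.ideal.subschemeι ⁻¹ᵁ g ⁻¹ᵁ V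

lemma exceptionalOpen_le (V : Y.Opens) : exceptionalOpen f g hg D V ≤
    exceptionalDivisorι f g hg D.ideal ⁻¹ᵁ dilatationπ f g hg D.ideal ⁻¹ᵁ V := by
  have h : exceptionalDivisorι f g hg D.ideal ≫ dilatationπ f g hg D.ideal =
    exceptionalDivisorToDivisor f g hg D.ideal ≫ D.ideal.subschemeι ≫ g := pullback.condition
  change _ ≤ (exceptionalDivisorι f g hg D.ideal ≫ dilatationπ f g hg D.ideal) ⁻¹ᵁ V
  rw [h]
  exact le_rfl

lemma preimage_le_of_le {X Y : Scheme.{u}} (f : Y ⟶ X) (g : X ⟶ Y) (hg : g ≫ f = 𝟙 X) {U : X.Opens} {V : Y.Opens} (h : V ≤ f ⁻¹ᵁ U) : g ⁻¹ᵁ V ≤ U := by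
  refine (g.preimage_mono h).trans ?_
  change (g ≫ f) ⁻¹ᵁ U ≤ U
  rw [hg]
  exact le_rfl

variable [IsClosedImmersion g]

/-- The restriction of a section `τ` of the ideal of `D` over `U` to the preimage of `V`. -/
def restrictDivisorIdeal {U : X.affineOpens} {V : Y.affineOpens} (h : V.1 ≤ f ⁻¹ᵁ U.1)
    (τ : D.ideal.ideal U) : divisorIdeal g D V :=
  ⟨X.presheaf.map (homOfLE (preimage_le_of_le f g hg h)).op τ.1,
    D.ideal.ideal_le_comap_ideal (U := ⟨g ⁻¹ᵁ V.1, V.2.preimage g⟩) (V := U)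
      (preimage_le_of_le f g hg h) τ.2⟩

lemma exceptionalOpen_le_preimage (φ : exceptionalDivisor f g hg D.ideal ⟶ normalBundle g D)
    (h : φ ≫ normalBundleToDivisor g D = exceptionalDivisorToDivisor f g hg D.ideal)
    (V : Y.Opens) : exceptionalOpen f g hg D V ≤
      φ ⁻¹ᵁ normalBundleToDivisor g D ⁻¹ᵁ D.ideal.subschemeι ⁻¹ᵁ g ⁻¹ᵁ V := by
  have e : exceptionalOpen f g hg D V = (φ ≫ normalBundleToDivisor g D) ⁻¹ᵁ
      D.ideal.subschemeι ⁻¹ᵁ g ⁻¹ᵁ V := by rw [h]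
  exact e.le

/-- A morphism `φ : E_(D) ⟶ V(𝓝_g ⊗ 𝓞_D(D))` is the canonical morphism if it is a morphism over
`D` and `φ^*(k ⊗ μ) = μ(τ) · (k / τ)|_{E_(D)}` locally, for sections `k` of the ideal of `g`, `μ` of
`𝓞_X(D)` and `τ` of the ideal of `D`. Here `k / τ` is a function `q` on (an open part of) `Y_(D)`
with `τ · q = k`. -/
def IsCanonicalMap (φ : exceptionalDivisor f g hg D.ideal ⟶ normalBundle g D) : Prop :=
  ∃ h : φ ≫ normalBundleToDivisor g D = exceptionalDivisorToDivisor f g hg D.ideal,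
    ∀ (U : X.affineOpens) (V : Y.affineOpens) (hUV : V.1 ≤ f ⁻¹ᵁ U.1) (τ : D.ideal.ideal U)
      (k : g.ker.ideal V) (μ : Module.Dual Γ(X, g ⁻¹ᵁ V.1) (divisorIdeal g D V))
      (q : Γ(dilatation f g hg D.ideal, dilatationπ f g hg D.ideal ⁻¹ᵁ V.1)),
      (dilatationπ f g hg D.ideal).app V.1 (f.appLE U.1 V.1 hUV τ.1) * q =
          (dilatationπ f g hg D.ideal).app V.1 k.1 →
        φ.appLE _ (exceptionalOpen f g hg D V.1) (exceptionalOpen_le_preimage f g hg D φ h V.1)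
            (normalBundleFun g D V (twistedGen _ _ k μ)) =
          (exceptionalDivisorToDivisor f g hg D.ideal).app _
            (D.ideal.subschemeι.app _ (μ (restrictDivisorIdeal f g hg D hUV τ))) *
          (exceptionalDivisorι f g hg D.ideal).appLE _ _ (exceptionalOpen_le f g hg D V.1) q

end Canonical

end Dilatation

end

open Dilatation

/-!
# The exceptional divisor of a dilatation along a regular section

The question is local on `Y`, and becomes one about rings. Choose an affine open `V` on which the
inverse image of `D` under `f` has an equation `t = f^*τ` and on which the ideal `K` of `g` is
generated by a regular sequence `a₁, …, aₘ`. Write `B` for the ring of functions on `V`, so that the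
ideal of `g(D)` is `J = K + (t)` and `t` is a nonzerodivisor modulo `K`. Over `V` the dilatation is
the basic open `D₊(t T)` of `Proj (⨁ₙ Jⁿ)` (`image_basicOpen_eq`), that is, the spectrum of the affine
dilatation algebra `C = B[J / t]`; the exceptional divisor is the spectrum of `C / JC = C / tC`. The
formula prescribed for the canonical morphism is a homomorphism of algebras over `B / J` from the
symmetric algebra to `C / JC` (`IsDilatationChart.symHom`). A linear form `μ` with `μ(τ) = 1` is a
basis of the dual of the ideal of `D`, so the classes `aᵢ ⊗ μ` generate the symmetric algebra, and
they are sent to the classes of `aᵢ / t`.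

* `symHom` is surjective since `C` is generated over `B` by the fractions `j / t` with `j ∈ J`, and
  `J = K + (t)`.
* `symHom` is injective since `C / JC` is a polynomial ring over `B / J` in the classes of `aᵢ / t`
  (`IsDilatationAlgebra.mem_map_C_of_eval₂_mem`). Indeed a polynomial relation of degree `N` modulo
  `t` becomes, after homogenizing with `t` and multiplying by a power of `t`, a form in `t, a₁, …, aₘ`
  whose value lies in a higher power of `J` than its degree. As `a₁, …, aₘ, t` is again a regular
  sequence, it is quasi-regular (`QuasiRegular.cons`), so the coefficients of the form lie in `J`.

Affine opens `V` as above, here called good charts, form a basis of neighbourhoods of the points of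
`g(D)` in `Y`, because the ideal of `D` is locally principal and regular sequences localize
(`exists_isGoodChart`). Both `E_(D)` and the bundle are covered by their parts over the good charts,
which in both cases are the base changes of the corresponding open part of `D`
(`isPullback_exceptionalι`, `isPullback_normalBundleι`). The local morphisms agree on smaller good
charts because each is determined by the formula `k ⊗ μ ↦ μ(τ) · (k / τ)`, whose right hand side is a
section over the larger chart (`evalAt_canonicalSection`). So they glue to a morphism over `D`, which
is an isomorphism since it is one locally on the target. The formula for arbitrary `U`, `V`, `τ` and
`q` is checked on good charts, where `q` has to be `k / τ` because `t` is a nonzerodivisor on the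
dilatation, and uniqueness holds because on good charts the generators `k ⊗ μ` and the structure map
from `D` determine a morphism to the bundle.
-/

noncomputable section

namespace Dilatation

/-! ### Regular sequences are quasi-regular -/

section QuasiRegular

variable {B : Type*} [CommRing B]

/-- A finite family `a` in a ring is quasi-regular if every homogeneous polynomial vanishing at `a`
has its coefficients in the ideal generated by `a`. The polynomials with coefficients in an ideal
`I` are encoded as the extension `I.map C`. -/
def QuasiRegular {n : ℕ} (a : Fin n → B) : Prop :=
  ∀ (d : ℕ) (F : MvPolynomial (Fin n) B), F.IsHomogeneous d → MvPolynomial.eval a F = 0 →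
    F ∈ (Ideal.span (Set.range a)).map (MvPolynomial.C : B →+* MvPolynomial (Fin n) B)

lemma exists_isHomogeneous_of_mem_pow_mul {n : ℕ} (a : Fin n → B) (K : Ideal B) (d : ℕ) {y : B}
    (hy : y ∈ Ideal.span (Set.range a) ^ d * K) :
    ∃ F : MvPolynomial (Fin n) B, F.IsHomogeneous d ∧
      F ∈ K.map (MvPolynomial.C : B →+* MvPolynomial (Fin n) B) ∧ MvPolynomial.eval a F = y := by
  refine Submodule.mul_induction_on hy ?_ ?_
  · intro u hu k hk
    obtain ⟨F, hF, rfl⟩ := (Ideal.mem_span_pow_iff_exists_isHomogeneous a u).mp hu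
    refine ⟨F * MvPolynomial.C k, by simpa using hF.mul (MvPolynomial.isHomogeneous_C _ k),
      Ideal.mul_mem_left _ _ (Ideal.mem_map_of_mem _ hk), by simp⟩
  · rintro _ _ ⟨F, hF, hF', rfl⟩ ⟨G, hG, hG', rfl⟩
    exact ⟨F + G, hF.add hG, Ideal.add_mem _ hF' hG', by simp⟩

lemma eval_mem_of_mem_map_C {n : ℕ} (a : Fin n → B) (K : Ideal B) (d : ℕ)
    {F : MvPolynomial (Fin n) B} (hF : F.IsHomogeneous d)
    (hK : F ∈ K.map (MvPolynomial.C : B →+* MvPolynomial (Fin n) B)) :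
    MvPolynomial.eval a F ∈ Ideal.span (Set.range a) ^ d * K := by
  rw [MvPolynomial.mem_map_C_iff] at hK
  rw [MvPolynomial.eval_eq, mul_comm]
  refine Ideal.sum_mem _ fun m hm => Ideal.mul_mem_mul (hK m) ?_
  refine (Ideal.mem_span_pow_iff_exists_isHomogeneous a _).mpr
    ⟨MvPolynomial.monomial m 1, ?_, by simp [MvPolynomial.eval_monomial, Finsupp.prod]⟩
  refine MvPolynomial.isHomogeneous_monomial _ ?_
  have := hF (MvPolynomial.mem_support_iff.mp hm)
  exact (DFunLike.congr_fun (Finsupp.degree_eq_weight_one (R := ℕ)) m).trans this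

/-- An element that is a nonzerodivisor modulo a quasi-regular ideal is a nonzerodivisor modulo each
of its powers. -/
lemma QuasiRegular.mem_pow_of_mul_mem {n : ℕ} {a : Fin n → B} (ha : QuasiRegular a) {t : B}
    (ht : ∀ y, t * y ∈ Ideal.span (Set.range a) → y ∈ Ideal.span (Set.range a)) (d : ℕ) :
    ∀ y, t * y ∈ Ideal.span (Set.range a) ^ d → y ∈ Ideal.span (Set.range a) ^ d := by
  induction d with
  | zero => simp
  | succ d ih =>
    intro y hy
    obtain ⟨G, hG, rfl⟩ := (Ideal.mem_span_pow_iff_exists_isHomogeneous a _).mp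
      (ih y (Ideal.pow_le_pow_right d.le_succ hy))
    rw [pow_succ] at hy
    obtain ⟨H, hH, hH', e⟩ := exists_isHomogeneous_of_mem_pow_mul a _ d hy
    have h0 : MvPolynomial.C t * G - H ∈
        (Ideal.span (Set.range a)).map (MvPolynomial.C : B →+* MvPolynomial (Fin n) B) :=
      ha d _ (((by simpa using (MvPolynomial.isHomogeneous_C _ t).mul hG :
        (MvPolynomial.C t * G).IsHomogeneous d)).sub hH) (by simp [e])
    have h1 := Ideal.add_mem _ h0 hH'
    rw [sub_add_cancel, MvPolynomial.mem_map_C_iff] at h1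
    rw [pow_succ]
    refine eval_mem_of_mem_map_C a _ d hG (MvPolynomial.mem_map_C_iff.mpr fun m => ht _ ?_)
    simpa using h1 m

/-- The inductive step: a form in one more variable `t`, written as `∑ Pⱼ tʲ`, that vanishes at
`(t, a)` has its coefficients in `(a) + (t)`. -/
lemma QuasiRegular.mem_map_C_of_sum_eq_zero {n : ℕ} {a : Fin n → B} (ha : QuasiRegular a) {t : B}
    (ht : ∀ y, t * y ∈ Ideal.span (Set.range a) → y ∈ Ideal.span (Set.range a)) (N : ℕ) :
    ∀ (P : ℕ → MvPolynomial (Fin n) B), (∀ j ≤ N, (P j).IsHomogeneous (N - j)) →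
      ∑ j ∈ Finset.range (N + 1), t ^ j * MvPolynomial.eval a (P j) = 0 →
      ∀ j ≤ N, P j ∈ (Ideal.span (Set.range a) ⊔ Ideal.span {t}).map
        (MvPolynomial.C : B →+* MvPolynomial (Fin n) B) := by
  have hle : (Ideal.span (Set.range a)).map (MvPolynomial.C : B →+* MvPolynomial (Fin n) B) ≤
      (Ideal.span (Set.range a) ⊔ Ideal.span {t}).map
        (MvPolynomial.C : B →+* MvPolynomial (Fin n) B) := Ideal.map_mono le_sup_left
  have htC (F : MvPolynomial (Fin n) B) : MvPolynomial.C t * F ∈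
      (Ideal.span (Set.range a) ⊔ Ideal.span {t}).map
        (MvPolynomial.C : B →+* MvPolynomial (Fin n) B) :=
    Ideal.mul_mem_right _ _ (Ideal.mem_map_of_mem _
      (Ideal.mem_sup_right (Ideal.mem_span_singleton_self t)))
  induction N with
  | zero =>
    intro P hP h0 j hj
    obtain rfl : j = 0 := by omega
    exact hle (ha 0 _ (hP 0 le_rfl) (by simpa using h0))
  | succ N ih =>
    intro P hP h0
    -- `P 0` vanishes at `a` up to `t * y`, so `y` lies in the `(N + 1)`-st power of the ideal
    set y := ∑ j ∈ Finset.range (N + 1), t ^ j * MvPolynomial.eval a (P (j + 1)) with hy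
    have e : MvPolynomial.eval a (P 0) + t * y = 0 := by
      rw [Finset.sum_range_succ'] at h0
      rw [← h0, hy, Finset.mul_sum, add_comm]
      congr 1
      · exact Finset.sum_congr rfl fun j _ => by ring
      · simp
    have hyI : y ∈ Ideal.span (Set.range a) ^ (N + 1) := by
      refine ha.mem_pow_of_mul_mem ht (N + 1) y ?_
      rw [← neg_eq_of_add_eq_zero_right e]
      exact neg_mem ((Ideal.mem_span_pow_iff_exists_isHomogeneous a _).mpr ⟨_, hP 0 (by omega), rfl⟩)
    obtain ⟨h, hh, hh'⟩ := (Ideal.mem_span_pow_iff_exists_isHomogeneous a _).mp hyI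
    have h00 : P 0 ∈ (Ideal.span (Set.range a) ⊔ Ideal.span {t}).map
        (MvPolynomial.C : B →+* MvPolynomial (Fin n) B) := by
      have := ha (N + 1) (P 0 + MvPolynomial.C t * h) ((hP 0 (by omega)).add
        (by simpa using (MvPolynomial.isHomogeneous_C _ t).mul hh)) (by simp [hh', e])
      simpa using Ideal.sub_mem _ (hle this) (htC h)
    rw [pow_succ] at hyI
    obtain ⟨h', hh1, hh2, hh3⟩ := exists_isHomogeneous_of_mem_pow_mul a _ N hyI
    have key := ih (fun j => P (j + 1) - if j = 0 then h' else 0) (fun j hj => by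
      refine MvPolynomial.IsHomogeneous.sub (by simpa using hP (j + 1) (by omega)) ?_
      split_ifs with hj0
      · subst hj0; simpa using hh1
      · exact MvPolynomial.isHomogeneous_zero _ _ _) (by
      simp only [map_sub, mul_sub, Finset.sum_sub_distrib]
      rw [← hy, sub_eq_zero, Finset.sum_eq_single 0 (by intro j _ hj; simp [hj]) (by simp)]
      simp [hh3])
    intro j hj
    obtain _ | j := j
    · exact h00
    · have := key j (by omega)
      split_ifs at this
      · simpa using Ideal.add_mem _ this (hle hh2)
      · simpa using this

lemma span_range_cons {n : ℕ} (t : B) (a : Fin n → B) :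
    Ideal.span (Set.range (Fin.cons t a : Fin (n + 1) → B)) =
      Ideal.span (Set.range a) ⊔ Ideal.span {t} := by
  rw [Fin.range_cons, Ideal.span_insert, sup_comm]

lemma eval_cons_eq_sum {n d : ℕ} (t : B) (a : Fin n → B) {F : MvPolynomial (Fin (n + 1)) B}
    (hF : F.IsHomogeneous d) :
    MvPolynomial.eval (Fin.cons t a : Fin (n + 1) → B) F = ∑ j ∈ Finset.range (d + 1),
      t ^ j * MvPolynomial.eval a ((MvPolynomial.finSuccEquiv B n F).coeff j) := by
  rw [MvPolynomial.eval_eq_eval_mv_eval', Polynomial.eval_eq_sum_range' (n := d + 1)]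
  · simp [mul_comm]
  · refine Nat.lt_succ_of_le ((Polynomial.natDegree_map_le).trans ?_)
    rw [MvPolynomial.natDegree_finSuccEquiv]
    exact (MvPolynomial.degreeOf_le_totalDegree _ _).trans hF.totalDegree_le

/-- Quasi-regularity is preserved by adding a nonzerodivisor modulo the ideal. The new element is
put in front so that `MvPolynomial.finSuccEquiv` expands forms in its powers. -/
lemma QuasiRegular.cons {n : ℕ} {a : Fin n → B} (ha : QuasiRegular a) {t : B}
    (ht : ∀ y, t * y ∈ Ideal.span (Set.range a) → y ∈ Ideal.span (Set.range a)) :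
    QuasiRegular (Fin.cons t a : Fin (n + 1) → B) := by
  intro d F hF h0
  rw [eval_cons_eq_sum t a hF] at h0
  have key := ha.mem_map_C_of_sum_eq_zero ht d _ (fun j hj =>
    MvPolynomial.IsHomogeneous.finSuccEquiv_coeff_isHomogeneous hF j (d - j) (by omega)) h0
  rw [MvPolynomial.mem_map_C_iff]
  intro m
  by_cases hm : m.degree = d
  · have := MvPolynomial.mem_map_C_iff.mp (key (m 0) (hm ▸ Finsupp.le_degree 0 m)) m.tail
    rwa [MvPolynomial.finSuccEquiv_coeff_coeff, Finsupp.cons_tail, ← span_range_cons] at this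
  · rw [hF.coeff_eq_zero (by simpa using hm)]
    exact zero_mem _

/-- Let `a` be quasi-regular and `t` a nonzerodivisor modulo `a`. A polynomial whose homogenization
with respect to `t` takes at `a` a value in the next power of `(a) + (t)` has its coefficients in
`(a) + (t)`. -/
lemma QuasiRegular.mem_map_C_of_homogenization_mem {n : ℕ} {a : Fin n → B} (ha : QuasiRegular a)
    {t : B} (ht : ∀ y, t * y ∈ Ideal.span (Set.range a) → y ∈ Ideal.span (Set.range a))
    (N : ℕ) (F : MvPolynomial (Fin n) B) (hN : F.totalDegree ≤ N)
    (hF : ∑ j ∈ Finset.range (N + 1), t ^ j * MvPolynomial.eval a (F.homogeneousComponent (N - j)) ∈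
      (Ideal.span (Set.range a) ⊔ Ideal.span {t}) ^ (N + 1)) :
    F ∈ (Ideal.span (Set.range a) ⊔ Ideal.span {t}).map
      (MvPolynomial.C : B →+* MvPolynomial (Fin n) B) := by
  rw [← span_range_cons, pow_succ] at hF
  obtain ⟨G, hG, hG', e⟩ := exists_isHomogeneous_of_mem_pow_mul _ _ N hF
  rw [eval_cons_eq_sum t a hG] at e
  have hG'' (j : ℕ) : (MvPolynomial.finSuccEquiv B n G).coeff j ∈
      (Ideal.span (Set.range a) ⊔ Ideal.span {t}).map
        (MvPolynomial.C : B →+* MvPolynomial (Fin n) B) := by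
    rw [MvPolynomial.mem_map_C_iff]
    intro m
    rw [MvPolynomial.finSuccEquiv_coeff_coeff, ← span_range_cons]
    exact MvPolynomial.mem_map_C_iff.mp hG' _
  have key := ha.mem_map_C_of_sum_eq_zero ht N
    (fun j => F.homogeneousComponent (N - j) - (MvPolynomial.finSuccEquiv B n G).coeff j)
    (fun j hj => (MvPolynomial.homogeneousComponent_isHomogeneous _ _).sub
      (MvPolynomial.IsHomogeneous.finSuccEquiv_coeff_isHomogeneous hG j (N - j) (by omega)))
    (by simp only [map_sub, mul_sub, Finset.sum_sub_distrib]; rw [e, sub_self])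
  rw [← MvPolynomial.sum_homogeneousComponent F]
  refine Ideal.sum_mem _ fun i hi => ?_
  rw [Finset.mem_range] at hi
  have := Ideal.add_mem _ (key (N - i) (by omega)) (hG'' (N - i))
  simpa [show N - (N - i) = i by omega] using this

lemma isSMulRegular_quotient_iff (I : Ideal B) (t : B) :
    IsSMulRegular (B ⧸ (I • ⊤ : Submodule B B)) t ↔ ∀ y, t * y ∈ I → y ∈ I := by
  rw [isSMulRegular_quotient_iff_mem_of_smul_mem]
  simp

/-- A weakly regular sequence generates its ideal by a quasi-regular family. -/
lemma exists_quasiRegular (rs : List B) (h : RingTheory.Sequence.IsWeaklyRegular B rs) :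
    ∃ (n : ℕ) (a : Fin n → B), QuasiRegular a ∧ Ideal.span (Set.range a) = Ideal.ofList rs := by
  induction rs using List.reverseRecOn with
  | nil =>
    refine ⟨0, Fin.elim0, fun d F hF h0 => ?_, by simp⟩
    rw [MvPolynomial.eq_C_of_isEmpty F] at h0 ⊢
    rw [show MvPolynomial.coeff 0 F = 0 by simpa using h0, map_zero]
    exact zero_mem _
  | append_singleton rs t ih =>
    rw [RingTheory.Sequence.isWeaklyRegular_append_iff,
      RingTheory.Sequence.isWeaklyRegular_singleton_iff] at h
    obtain ⟨n, a, ha, e⟩ := ih h.1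
    refine ⟨n + 1, Fin.cons t a, ha.cons ?_, ?_⟩
    · rw [e]
      exact (isSMulRegular_quotient_iff _ _).mp h.2
    · rw [span_range_cons, e, Ideal.ofList_append, Ideal.ofList_singleton]

end QuasiRegular

/-! ### The affine dilatation algebra -/

section AffineDilatation

/-- The properties characterizing a ring homomorphism `α : B → C` as the affine dilatation algebra
`B[J/t]`, for `t ∈ J`: the element `t` is a nonzerodivisor in `C`, the elements of `J` are
divisible by `t` in `C`, every element of `C` is a fraction `y / tⁿ` with `y ∈ Jⁿ`, and the kernel of
`α` consists of `t`-power torsion. -/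
structure IsDilatationAlgebra {B C : Type*} [CommRing B] [CommRing C] (α : B →+* C) (J : Ideal B)
    (t : B) : Prop where
  mem : t ∈ J
  regular : ∀ c, α t * c = 0 → c = 0
  exists_div : ∀ j ∈ J, ∃ c, α t * c = α j
  exists_frac : ∀ c, ∃ (n : ℕ), ∃ y ∈ J ^ n, α t ^ n * c = α y
  torsion : ∀ x, α x = 0 → ∃ k : ℕ, t ^ k * x = 0

section Rees

open HomogeneousLocalization

variable {B : Type u} [CommRing B] (J : Ideal B) (t : B) (ht : t ∈ J ^ 1)

lemma reesMonomial_pow (k : ℕ) : reesMonomial J 1 t ht ^ k =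
    reesMonomial J k (t ^ k) (Ideal.pow_mem_pow (by simpa using ht) k) := by
  apply Subtype.ext
  simp [reesMonomial, Polynomial.monomial_pow]

lemma reesMonomial_mul {m n : ℕ} (a b : B) (ha : a ∈ J ^ m) (hb : b ∈ J ^ n) :
    reesMonomial J m a ha * reesMonomial J n b hb =
      reesMonomial J (m + n) (a * b) (by rw [pow_add]; exact Ideal.mul_mem_mul ha hb) := by
  apply Subtype.ext
  simp [reesMonomial, Polynomial.monomial_mul_monomial]

lemma smul_reesMonomial {n : ℕ} (a b : B) (hb : b ∈ J ^ n) :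
    a • reesMonomial J n b hb = reesMonomial J n (a * b) (Ideal.mul_mem_left _ _ hb) := by
  apply Subtype.ext
  simp [reesMonomial, Polynomial.smul_monomial]

lemma reesMonomial_eq_zero_iff {n : ℕ} (a : B) (ha : a ∈ J ^ n) :
    reesMonomial J n a ha = 0 ↔ a = 0 := by
  rw [← Subtype.coe_inj]
  exact Polynomial.monomial_eq_zero_iff a n

/-- The fraction `y / tⁿ` in the homogeneous localization of the Rees algebra at `t T`. -/
def reesFrac (n : ℕ) (y : B) (hy : y ∈ J ^ n) : Away (reesGrading J) (reesMonomial J 1 t ht) :=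
  Away.mk (reesGrading J) (reesMonomial_mem J 1 t ht) n (reesMonomial J n y hy)
    (by rw [smul_eq_mul, mul_one]; exact reesMonomial_mem J n y hy)

lemma reesFrac_surjective (c : Away (reesGrading J) (reesMonomial J 1 t ht)) :
    ∃ n y hy, reesFrac J t ht n y hy = c := by
  obtain ⟨n, x, hx, rfl⟩ := Away.mk_surjective _ (reesMonomial_mem J 1 t ht) c
  have hx' : x ∈ reesGrading J n := by simpa using hx
  refine ⟨n, _, (mem_reesAlgebra_iff J _).mp x.2 n, ?_⟩
  rw [reesFrac]
  congr 1
  exact (eq_reesMonomial hx').symm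

lemma reesToAway_mul_reesFrac (n : ℕ) (y : B) (hy : y ∈ J ^ n) (r : B) :
    reesToAway J (reesMonomial J 1 t ht) r * reesFrac J t ht n y hy =
      reesFrac J t ht n (r * y) (Ideal.mul_mem_left _ _ hy) := by
  rw [reesFrac, reesToAway_mul_mk, reesFrac]
  congr 1
  exact smul_reesMonomial J r y hy

lemma reesFrac_self (n : ℕ) :
    reesFrac J t ht n (t ^ n) (Ideal.pow_mem_pow (by simpa using ht) n) = 1 := by
  rw [HomogeneousLocalization.ext_iff_val, reesFrac, Away.val_mk, HomogeneousLocalization.val_one]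
  refine Eq.trans ?_ (Localization.mk_self
    (⟨reesMonomial J 1 t ht ^ n, n, rfl⟩ : Submonoid.powers (reesMonomial J 1 t ht)))
  congr 1
  exact (reesMonomial_pow J t ht n).symm

lemma reesFrac_eq_zero_iff (n : ℕ) (y : B) (hy : y ∈ J ^ n) :
    reesFrac J t ht n y hy = 0 ↔ ∃ k : ℕ, t ^ k * y = 0 := by
  rw [reesFrac, mk_eq_zero_iff]
  refine exists_congr fun k => ?_
  rw [reesMonomial_pow, reesMonomial_mul, reesMonomial_eq_zero_iff]

lemma reesToAway_eq_reesFrac (n : ℕ) (r : B) : reesToAway J (reesMonomial J 1 t ht) r =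
    reesFrac J t ht n (r * t ^ n)
      (Ideal.mul_mem_left _ _ (Ideal.pow_mem_pow (by simpa using ht) n)) := by
  rw [← reesToAway_mul_reesFrac J t ht n _ (Ideal.pow_mem_pow (by simpa using ht) n),
    reesFrac_self]
  exact (mul_one (M := Away (reesGrading J) (reesMonomial J 1 t ht)) _).symm

/-- The degree zero part of the Rees algebra localized at `t T` is the affine dilatation algebra. -/
lemma isDilatationAlgebra_reesToAway :
    IsDilatationAlgebra (reesToAway J (reesMonomial J 1 t ht)) J t where
  mem := by simpa using ht
  regular c hc := by
    obtain ⟨n, y, hy, rfl⟩ := reesFrac_surjective J t ht c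
    rw [reesToAway_mul_reesFrac, reesFrac_eq_zero_iff] at hc
    obtain ⟨k, hk⟩ := hc
    exact (reesFrac_eq_zero_iff J t ht n y hy).mpr ⟨k + 1, by rw [pow_succ, mul_assoc, hk]⟩
  exists_div j hj := by
    refine ⟨reesFrac J t ht 1 j (by simpa using hj), ?_⟩
    rw [reesToAway_mul_reesFrac, reesToAway_eq_reesFrac J t ht 1 j]
    congr 1
    ring
  exists_frac c := by
    obtain ⟨n, y, hy, rfl⟩ := reesFrac_surjective J t ht c
    refine ⟨n, y, hy, ?_⟩
    rw [← map_pow, reesToAway_mul_reesFrac, reesToAway_eq_reesFrac J t ht n y]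
    congr 1
    ring
  torsion x hx := by
    rw [reesToAway_eq_reesFrac J t ht 0 x, reesFrac_eq_zero_iff] at hx
    simpa using hx

end Rees

/-- A form of degree `d` in `aᵢ / t` becomes its value at `a` after multiplication by `tᵈ`. -/
lemma pow_mul_eval₂_eq {B C : Type*} [CommRing B] [CommRing C] (α : B →+* C)
    {t : B} {n : ℕ} {a : Fin n → B} {q : Fin n → C} (hq : ∀ i, α t * q i = α (a i))
    {d : ℕ} {F : MvPolynomial (Fin n) B} (hF : F.IsHomogeneous d) :
    α t ^ d * MvPolynomial.eval₂ α q F = α (MvPolynomial.eval a F) := by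
  rw [MvPolynomial.eval₂_eq, MvPolynomial.eval_eq, map_sum, Finset.mul_sum]
  refine Finset.sum_congr rfl fun m hm => ?_
  have hd : d = ∑ i ∈ m.support, m i := by
    have := hF (MvPolynomial.mem_support_iff.mp hm)
    rw [← this]
    exact (DFunLike.congr_fun (Finsupp.degree_eq_weight_one (R := ℕ)) m).symm
  rw [hd, map_mul, map_prod, ← Finset.prod_pow_eq_pow_sum, mul_left_comm,
    ← Finset.prod_mul_distrib]
  simp [← hq, mul_pow]

namespace IsDilatationAlgebra

variable {B C : Type*} [CommRing B] [CommRing C] {α : B →+* C} {J : Ideal B} {t : B}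
  (h : IsDilatationAlgebra α J t)

include h

lemma cancel {c d : C} (e : α t * c = α t * d) : c = d :=
  sub_eq_zero.mp (h.regular _ (by rw [mul_sub, e, sub_self]))

lemma cancel_pow (n : ℕ) {c d : C} (e : α t ^ n * c = α t ^ n * d) : c = d := by
  induction n with
  | zero => simpa using e
  | succ n ih => exact ih (h.cancel (by rw [← mul_assoc, ← mul_assoc, ← pow_succ', e]))

lemma map_eq_span : J.map α = Ideal.span {α t} := by
  refine le_antisymm (Ideal.map_le_iff_le_comap.mpr fun j hj => ?_)
    ((Ideal.span_singleton_le_iff_mem _).mpr (Ideal.mem_map_of_mem _ h.mem))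
  obtain ⟨c, hc⟩ := h.exists_div j hj
  exact Ideal.mem_span_singleton.mpr ⟨c, hc.symm⟩

/-- The dilatation algebra is generated by the quotients `j / t` with `j ∈ J`. -/
lemma mem_subring (S : Subring C) (hB : ∀ b, α b ∈ S) (hJ : ∀ j ∈ J, ∀ c, α t * c = α j → c ∈ S)
    (c : C) : c ∈ S := by
  obtain ⟨n, y, hy, e⟩ := h.exists_frac c
  suffices H : ∀ n, ∀ y ∈ J ^ n, ∃ c ∈ S, α t ^ n * c = α y by
    obtain ⟨c', hc', e'⟩ := H n y hy
    rwa [h.cancel_pow n (e.trans e'.symm)]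
  intro n
  induction n with
  | zero => exact fun y _ => ⟨α y, hB y, by simp⟩
  | succ n ih =>
    intro y hy
    rw [pow_succ] at hy
    refine Submodule.mul_induction_on hy ?_ ?_
    · intro u hu j hj
      obtain ⟨c, hc, e⟩ := ih u hu
      obtain ⟨d, hd⟩ := h.exists_div j hj
      exact ⟨c * d, mul_mem hc (hJ j hj d hd), by rw [map_mul, ← e, ← hd]; ring⟩
    · rintro x y ⟨c, hc, e⟩ ⟨d, hd, e'⟩
      exact ⟨c + d, add_mem hc hd, by rw [mul_add, e, e', map_add]⟩

/-- If `K` is generated by a quasi-regular family `a`, then `C / JC` is a polynomial ring over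
`B / J` in the classes of the fractions `aᵢ / t`: a polynomial that vanishes at them has its
coefficients in `J`. -/
lemma mem_map_C_of_eval₂_mem {n : ℕ} {a : Fin n → B} (ha : QuasiRegular a)
    (ht : ∀ y, t * y ∈ Ideal.span (Set.range a) → y ∈ Ideal.span (Set.range a))
    (hJ : Ideal.span (Set.range a) ⊔ Ideal.span {t} = J)
    {q : Fin n → C} (hq : ∀ i, α t * q i = α (a i)) (F : MvPolynomial (Fin n) B)
    (hF : MvPolynomial.eval₂ α q F ∈ J.map α) :
    F ∈ J.map (MvPolynomial.C : B →+* MvPolynomial (Fin n) B) := by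
  rw [h.map_eq_span, Ideal.mem_span_singleton] at hF
  obtain ⟨c, hc⟩ := hF
  obtain ⟨l, y, hy, e⟩ := h.exists_frac c
  set N := F.totalDegree with hN
  -- the homogenization of `F` in degree `M`, evaluated at `a` and `t`
  let S (M : ℕ) : B := ∑ i ∈ Finset.range (N + 1),
    t ^ (M - i) * MvPolynomial.eval a (F.homogeneousComponent i)
  have hS (M : ℕ) (hM : N ≤ M) : α t ^ M * MvPolynomial.eval₂ α q F = α (S M) := by
    conv_lhs => rw [← MvPolynomial.sum_homogeneousComponent F]
    rw [← MvPolynomial.coe_eval₂Hom, map_sum, Finset.mul_sum, map_sum]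
    refine Finset.sum_congr rfl fun i hi => ?_
    rw [Finset.mem_range] at hi
    rw [map_mul, MvPolynomial.coe_eval₂Hom,
      ← pow_mul_eval₂_eq α hq (MvPolynomial.homogeneousComponent_isHomogeneous i F), map_pow,
      ← mul_assoc, ← pow_add, Nat.sub_add_cancel (by omega)]
  have hS' (M : ℕ) (hM : N ≤ M) : S M = ∑ j ∈ Finset.range (M + 1),
      t ^ j * MvPolynomial.eval a (F.homogeneousComponent (M - j)) := by
    rw [← Finset.sum_range_reflect]
    refine (Finset.sum_subset (Finset.range_mono (by omega)) fun i hi hi' => ?_).trans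
      (Finset.sum_congr rfl fun i hi => ?_)
    · rw [Finset.mem_range] at hi'
      rw [MvPolynomial.homogeneousComponent_eq_zero i F (by omega)]
      simp
    · rw [Finset.mem_range] at hi
      rw [show M + 1 - 1 - i = M - i by omega, show M - (M - i) = i by omega]
  have hmul (k M : ℕ) (hM : N ≤ M) : S (M + k) = t ^ k * S M := by
    simp only [S, Finset.mul_sum]
    refine Finset.sum_congr rfl fun i hi => ?_
    rw [Finset.mem_range] at hi
    rw [← mul_assoc, ← pow_add, show M + k - i = k + (M - i) by omega]
  -- the equation `F(q) = t · y / tˡ` holds in `B` after multiplication by a power of `t`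
  obtain ⟨k, hk⟩ := h.torsion (S (N + l) - t ^ (N + 1) * y) (by
    rw [map_sub, ← hS _ (by omega), hc, map_mul, map_pow, ← e, sub_eq_zero]
    ring)
  rw [mul_sub, ← hmul k _ (by omega), sub_eq_zero] at hk
  rw [← hJ]
  refine ha.mem_map_C_of_homogenization_mem ht (N + l + k) F (by omega) ?_
  rw [← hS' _ (by omega), hk, hJ, ← mul_assoc, ← pow_add,
    show N + l + k + 1 = k + (N + 1) + l by omega, pow_add]
  exact Ideal.mul_mem_mul (Ideal.pow_mem_pow h.mem _) hy

end IsDilatationAlgebra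

end AffineDilatation

/-! ### The local form of the canonical morphism -/

section LocalCanonical

variable {B A R C Q : Type u} [CommRing B] [CommRing A] [CommRing R] [CommRing C] [CommRing Q]

/-- The rings occurring in an affine chart of the dilatation: surjections `φ : B → A` and
`ψ : A → R` with kernels `K` and `I`, an element `t` of `B` whose image generates `I`, the dilatation
algebra `α : B → C` of the kernel `J` of `ψ ∘ φ`, and its reduction `χ : C → Q = C / JC`, with
structure map `ρ : R → Q`. -/
structure IsDilatationChart (φ : B →+* A) (ψ : A →+* R) (K J : Ideal B) (I : Ideal A) (t : B)
    (α : B →+* C) (χ : C →+* Q) (ρ : R →+* Q) : Prop where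
  surjective_left : Function.Surjective φ
  surjective_right : Function.Surjective ψ
  ker_left : RingHom.ker φ = K
  ker_right : RingHom.ker ψ = I
  ker_comp : RingHom.ker (ψ.comp φ) = J
  span_eq : Ideal.span {φ t} = I
  isDilatationAlgebra : IsDilatationAlgebra α J t
  surjective : Function.Surjective χ
  ker : RingHom.ker χ = J.map α
  comm : ρ.comp (ψ.comp φ) = χ.comp α

namespace IsDilatationChart

variable {φ : B →+* A} {ψ : A →+* R} {K J : Ideal B} {I : Ideal A} {t : B}
  {α : B →+* C} {χ : C →+* Q} {ρ : R →+* Q} (h : IsDilatationChart φ ψ K J I t α χ ρ)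

include h

lemma comm_apply (b : B) : ρ (ψ (φ b)) = χ (α b) := RingHom.congr_fun h.comm b

lemma le_ker : K ≤ J := fun k hk => by
  rw [← h.ker_left, RingHom.mem_ker] at hk
  rw [← h.ker_comp, RingHom.mem_ker, RingHom.comp_apply, hk, map_zero]

lemma map_mem : φ t ∈ I := by
  rw [← h.span_eq]
  exact Ideal.mem_span_singleton_self _

lemma exists_quotient (k : K) : ∃ c, α t * c = α k :=
  h.isDilatationAlgebra.exists_div k (h.le_ker k.2)

/-- The quotient `k / t` in the dilatation algebra. -/
def quotient (k : K) : C := (h.exists_quotient k).choose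

lemma mul_quotient (k : K) : α t * h.quotient k = α k := (h.exists_quotient k).choose_spec

lemma eq_quotient {k : K} {c : C} (e : α t * c = α k) : c = h.quotient k :=
  h.isDilatationAlgebra.cancel (e.trans (h.mul_quotient k).symm)

/-- The ring homomorphism sending `k ⊗ μ` to the class of `μ(t) · (k / t)`. -/
def symHom : TwistedSym φ ψ K I →+* Q :=
  twistedSymLift φ ψ ρ (fun k μ => ρ (ψ (μ ⟨φ t, h.map_mem⟩)) * χ (h.quotient k))
    (fun k k' μ => by
      rw [← mul_add, ← map_add]
      congr 2
      refine (h.eq_quotient ?_).symm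
      rw [mul_add, mul_quotient, mul_quotient, ← map_add]
      rfl)
    (fun k μ μ' => by rw [LinearMap.add_apply, map_add, map_add, add_mul])
    (fun b k μ => by
      have e : h.quotient (b • k) = α b * h.quotient k := (h.eq_quotient (by
        rw [mul_left_comm, mul_quotient, ← map_mul]
        rfl)).symm
      rw [e, map_mul, h.comm_apply]
      ring)
    (fun a k μ => by
      rw [LinearMap.smul_apply, smul_eq_mul, map_mul, map_mul, mul_assoc])

lemma symHom_algebraMap (r : R) : h.symHom (algebraMap R _ r) = ρ r :=
  twistedSymLift_algebraMap ..

/-- The formula for the image of `k ⊗ μ` holds with any multiple `s` of `t` in place of `t`. -/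
lemma symHom_gen (k : K) (μ : Module.Dual A I) {s : B} (hs : s ∈ Ideal.span {t}) (hs' : φ s ∈ I)
    {q : C} (hq : α s * q = α k) :
    h.symHom (twistedGen φ ψ k μ) = ρ (ψ (μ ⟨φ s, hs'⟩)) * χ q := by
  obtain ⟨u, rfl⟩ := Ideal.mem_span_singleton'.mp hs
  refine (twistedSymLift_gen ..).trans ?_
  have e1 : α u * q = h.quotient k := h.eq_quotient (by rw [← hq, map_mul]; ring)
  have e2 : (⟨φ (u * t), hs'⟩ : I) = φ u • ⟨φ t, h.map_mem⟩ := Subtype.ext (map_mul φ u t)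
  rw [← e1, e2, map_smul, smul_eq_mul, map_mul, map_mul, map_mul, h.comm_apply]
  ring

lemma ker_eq_sup : K ⊔ Ideal.span {t} = J := by
  refine le_antisymm (sup_le h.le_ker ((Ideal.span_singleton_le_iff_mem _).mpr
    h.isDilatationAlgebra.mem)) fun j hj => ?_
  rw [← h.ker_comp, RingHom.mem_ker, RingHom.comp_apply, ← RingHom.mem_ker, h.ker_right,
    ← h.span_eq] at hj
  obtain ⟨a, ha⟩ := Ideal.mem_span_singleton'.mp hj
  obtain ⟨b, rfl⟩ := h.surjective_left a
  rw [← sub_add_cancel j (b * t)]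
  refine Ideal.add_mem _ (Ideal.mem_sup_left ?_)
    (Ideal.mem_sup_right (Ideal.mul_mem_left _ _ (Ideal.mem_span_singleton_self t)))
  rw [← h.ker_left, RingHom.mem_ker, map_sub, map_mul, ha, sub_self]

section Invertible

variable [Module.Invertible A I]

/-- As `I` is invertible, its generator `φ t` is a basis, in particular a nonzerodivisor. -/
lemma bijective_toSpanSingleton :
    Function.Bijective (LinearMap.toSpanSingleton A I ⟨φ t, h.map_mem⟩) := by
  refine Module.Invertible.bijective_of_surjective fun x => ?_
  have hx : x.1 ∈ Ideal.span {φ t} := by rw [h.span_eq]; exact x.2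
  obtain ⟨a, ha⟩ := Ideal.mem_span_singleton'.mp hx
  exact ⟨a, Subtype.ext ha⟩

lemma exists_dual : ∃ μ : Module.Dual A I, μ ⟨φ t, h.map_mem⟩ = 1 := by
  let e := LinearEquiv.ofBijective _ h.bijective_toSpanSingleton
  refine ⟨e.symm.toLinearMap, ?_⟩
  refine e.injective ((e.apply_symm_apply _).trans ?_)
  exact (LinearMap.toSpanSingleton_apply_one A I _).symm

lemma mem_of_mul_mem (y : B) (hy : t * y ∈ K) : y ∈ K := by
  rw [← h.ker_left, RingHom.mem_ker] at hy ⊢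
  refine h.bijective_toSpanSingleton.1 ?_
  rw [map_zero]
  exact Subtype.ext ((mul_comm _ _).trans ((map_mul φ t y).symm.trans hy))

lemma symHom_surjective : Function.Surjective h.symHom := by
  obtain ⟨μ, hμ⟩ := h.exists_dual
  have hB (b : B) : α b ∈ h.symHom.range.comap χ := ⟨algebraMap R _ (ψ (φ b)), by
    rw [h.symHom_algebraMap, h.comm_apply]⟩
  have hK (k : K) : h.quotient k ∈ h.symHom.range.comap χ := ⟨twistedGen φ ψ k μ, by
    rw [h.symHom_gen k μ (Ideal.mem_span_singleton_self t) h.map_mem (h.mul_quotient k), hμ,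
      map_one, map_one, one_mul]⟩
  intro q
  obtain ⟨c, rfl⟩ := h.surjective q
  refine h.isDilatationAlgebra.mem_subring (h.symHom.range.comap χ) hB (fun j hj c hc => ?_) c
  rw [← h.ker_eq_sup] at hj
  obtain ⟨k, hk, s, hs, rfl⟩ := Submodule.mem_sup.mp hj
  obtain ⟨b, rfl⟩ := Ideal.mem_span_singleton'.mp hs
  have e : c = h.quotient ⟨k, hk⟩ + α b := h.isDilatationAlgebra.cancel (by
    rw [hc, mul_add, h.mul_quotient, map_add, map_mul, mul_comm (α t)])
  rw [e]
  exact add_mem (hK _) (hB b)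

omit h [Module.Invertible A I] in
/-- The symmetric algebra is generated by the elements `k ⊗ μ`. -/
lemma twistedSym_mem_subring (S : Subring (TwistedSym φ ψ K I))
    (hR : ∀ r, algebraMap R (TwistedSym φ ψ K I) r ∈ S) (hg : ∀ k μ, twistedGen φ ψ k μ ∈ S)
    (x : TwistedSym φ ψ K I) : x ∈ S := by
  let N : Submodule R (TwistedConormal φ ψ K I) :=
    Submodule.span R (Set.range fun p : K × Module.Dual A I => TwistedConormal.mk φ ψ K I p.1 p.2)
  -- two maps that agree on all `k ⊗ μ` are equal, so the quotient by their span vanishes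
  have hN : N.mkQ = 0 := twistedConormal_hom_ext φ ψ fun k μ => by
    rw [LinearMap.zero_apply, Submodule.mkQ_apply, Submodule.Quotient.mk_eq_zero]
    exact Submodule.subset_span ⟨(k, μ), rfl⟩
  induction x using SymmetricAlgebra.induction with
  | algebraMap r => exact hR r
  | ι m =>
    have hm : m ∈ N := by
      rw [← Submodule.Quotient.mk_eq_zero, ← Submodule.mkQ_apply, hN, LinearMap.zero_apply]
    induction hm using Submodule.span_induction with
    | mem m hm =>
      obtain ⟨⟨k, μ⟩, rfl⟩ := hm
      exact hg k μ
    | zero => rw [map_zero]; exact zero_mem _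
    | add m m' _ _ hm hm' => rw [map_add]; exact add_mem hm hm'
    | smul r m _ hm => rw [map_smul, Algebra.smul_def]; exact mul_mem (hR r) hm
  | mul a b ha hb => exact mul_mem ha hb
  | add a b ha hb => exact add_mem ha hb

/-- If `K` is generated by a weakly regular sequence `r₁, …, rₘ`, then the symmetric algebra is a
quotient of a polynomial ring in variables mapping to the classes of `rᵢ / t`, so a relation among
these classes is already one in the symmetric algebra. -/
lemma symHom_injective {rs : List B} (hrs : RingTheory.Sequence.IsWeaklyRegular B rs)
    (hK : Ideal.ofList rs = K) : Function.Injective h.symHom := by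
  obtain ⟨n, a, ha, e⟩ := exists_quasiRegular rs hrs
  rw [hK] at e
  obtain ⟨μ, hμ⟩ := h.exists_dual
  have haK (i : Fin n) : a i ∈ K := by
    rw [← e]
    exact Ideal.subset_span ⟨i, rfl⟩
  let θ : MvPolynomial (Fin n) B →+* TwistedSym φ ψ K I :=
    MvPolynomial.eval₂Hom ((algebraMap R (TwistedSym φ ψ K I)).comp (ψ.comp φ))
      fun i => twistedGen φ ψ ⟨a i, haK i⟩ μ
  have hθ (F : MvPolynomial (Fin n) B) : h.symHom (θ F) =
      χ (MvPolynomial.eval₂ α (fun i => h.quotient ⟨a i, haK i⟩) F) := by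
    suffices H : h.symHom.comp θ =
        χ.comp (MvPolynomial.eval₂Hom α fun i => h.quotient ⟨a i, haK i⟩) from
      RingHom.congr_fun H F
    refine MvPolynomial.ringHom_ext (fun b => ?_) fun i => ?_
    · simp only [θ, RingHom.comp_apply, MvPolynomial.eval₂Hom_C]
      rw [h.symHom_algebraMap, h.comm_apply]
    · simp only [θ, RingHom.comp_apply, MvPolynomial.eval₂Hom_X']
      rw [h.symHom_gen _ μ (Ideal.mem_span_singleton_self t) h.map_mem (h.mul_quotient _), hμ,
        map_one, map_one, one_mul]
  have hsurj (x : TwistedSym φ ψ K I) : x ∈ θ.range := by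
    have hR (r : R) : algebraMap R (TwistedSym φ ψ K I) r ∈ θ.range := by
      obtain ⟨x, rfl⟩ := h.surjective_right r
      obtain ⟨b, rfl⟩ := h.surjective_left x
      exact ⟨MvPolynomial.C b, by simp [θ]⟩
    refine twistedSym_mem_subring _ hR (fun k ν => ?_) x
    -- `μ` is a basis of the dual of `I`
    have hν : ν = ν ⟨φ t, h.map_mem⟩ • μ := by
      refine LinearMap.ext fun x => ?_
      obtain ⟨c, rfl⟩ := h.bijective_toSpanSingleton.2 x
      rw [LinearMap.toSpanSingleton_apply, LinearMap.smul_apply, map_smul, map_smul, hμ]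
      simp [mul_comm]
    rw [hν, twistedGen_smul_right]
    refine mul_mem (hR _) ?_
    obtain ⟨k, hk⟩ := k
    have hk' := hk
    rw [← e] at hk'
    induction hk' using Submodule.span_induction with
    | mem k hk' =>
      obtain ⟨i, rfl⟩ := hk'
      exact ⟨MvPolynomial.X i, by simp [θ]⟩
    | zero =>
      have := twistedGen_smul_left φ ψ 0 (⟨0, hk⟩ : K) μ
      rw [zero_smul, map_zero, map_zero, map_zero, zero_mul] at this
      exact this ▸ zero_mem _
    | add k l hk1 hl1 hk2 hl2 =>
      have := add_mem (hk2 (e ▸ hk1)) (hl2 (e ▸ hl1))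
      rw [← twistedGen_add_left] at this
      exact this
    | smul b k hk1 hk2 =>
      have := mul_mem (hR (ψ (φ b))) (hk2 (e ▸ hk1))
      rw [← twistedGen_smul_left] at this
      exact this
  refine (injective_iff_map_eq_zero _).mpr fun x hx => ?_
  obtain ⟨F, rfl⟩ := hsurj x
  rw [hθ, ← RingHom.mem_ker, h.ker] at hx
  have hF := h.isDilatationAlgebra.mem_map_C_of_eval₂_mem ha (by rw [e]; exact h.mem_of_mul_mem)
    (by rw [e]; exact h.ker_eq_sup) (fun i => h.mul_quotient ⟨a i, haK i⟩) F hx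
  have hle : J.map (MvPolynomial.C : B →+* MvPolynomial (Fin n) B) ≤ RingHom.ker θ := by
    refine Ideal.map_le_iff_le_comap.mpr fun j hj => ?_
    rw [← h.ker_comp, RingHom.mem_ker] at hj
    rw [Ideal.mem_comap, RingHom.mem_ker]
    simp only [θ, MvPolynomial.eval₂Hom_C]
    rw [RingHom.comp_apply, hj, map_zero]
  exact hle hF

end Invertible

end IsDilatationChart

end LocalCanonical

/-! ### Pullbacks of ideal sheaves to affine opens -/

section ComapIdeal

open Scheme.IdealSheafData

lemma ideal_comap_top {X Y : Scheme.{u}} [IsAffine X] [IsAffine Y] (I : Y.IdealSheafData)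
    (f : X ⟶ Y) : (I.comap f).ideal ⟨⊤, isAffineOpen_top X⟩ =
      (I.ideal ⟨⊤, isAffineOpen_top Y⟩).map f.appTop.hom := by
  refine le_antisymm ?_ ?_
  · suffices h : I.comap f ≤ ofIdealTop ((I.ideal ⟨⊤, isAffineOpen_top Y⟩).map f.appTop.hom) by
      simpa using h ⟨⊤, isAffineOpen_top X⟩
    rw [← le_map_iff_comap_le]
    refine le_of_isAffine ?_
    rw [ideal_map _ f ⟨⊤, isAffineOpen_top Y⟩ (isAffineOpen_top X)]
    refine Ideal.map_le_iff_le_comap.mp ?_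
    simp only [ofIdealTop_ideal]
    have e : X.presheaf.map (homOfLE (le_refl (⊤ : X.Opens))).op = 𝟙 _ := X.presheaf.map_id _
    refine le_of_eq (Eq.trans ?_ (congrArg (fun r => Ideal.map (CommRingCat.Hom.hom r) _) e).symm)
    exact (Ideal.map_id _).symm
  · rw [Ideal.map_le_iff_le_comap]
    have h := le_map_comap I f ⟨⊤, isAffineOpen_top Y⟩
    rwa [ideal_map _ f ⟨⊤, isAffineOpen_top Y⟩ (isAffineOpen_top X)] at h

lemma ideal_comap_of_image_eq {X Y : Scheme.{u}} (I : Y.IdealSheafData) (j : X ⟶ Y)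
    [IsOpenImmersion j] (S : X.affineOpens) (V : Y.affineOpens) (h : j ''ᵁ S.1 = V.1)
    (hS : S.1 ≤ j ⁻¹ᵁ V.1) :
    (I.comap j).ideal S = (I.ideal V).map (j.appLE V.1 S.1 hS).hom := by
  obtain ⟨V, hV⟩ := V
  obtain rfl : j ''ᵁ S.1 = V := h
  have e : (j.appLE (j ''ᵁ S.1) S.1 hS) = (j.appIso S.1).hom := by
    rw [Scheme.Hom.appIso_hom']
  rw [ideal_comap_of_isOpenImmersion, e]
  exact Ideal.comap_symm (f := (j.appIso S.1).commRingCatIsoToRingEquiv) |>.trans rfl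

lemma appLE_fromSpec_bijective {X : Scheme.{u}} {V : X.Opens} (hV : IsAffineOpen V) :
    Function.Bijective (hV.fromSpec.appLE V ⊤ hV.fromSpec_preimage_self.ge).hom := by
  have e : hV.fromSpec ''ᵁ ⊤ = V := by rw [Scheme.Hom.image_top_eq_opensRange, hV.opensRange_fromSpec]
  have h : IsIso (hV.fromSpec.appLE V ⊤ hV.fromSpec_preimage_self.ge) := by
    have : hV.fromSpec.appLE V ⊤ hV.fromSpec_preimage_self.ge =
        X.presheaf.map (eqToHom e).op ≫ (hV.fromSpec.appIso ⊤).hom := by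
      rw [Scheme.Hom.appIso_hom', Scheme.Hom.map_appLE]
    rw [this]
    infer_instance
  exact ConcreteCategory.bijective_of_isIso (hV.fromSpec.appLE V ⊤ hV.fromSpec_preimage_self.ge)

/-- The pullback of a quasi-coherent ideal sheaf is computed on affine opens by extension of
ideals. -/
lemma ideal_comap_eq_map {X Y : Scheme.{u}} (I : Y.IdealSheafData) (f : X ⟶ Y) (V : X.affineOpens)
    (U : Y.affineOpens) (h : V.1 ≤ f ⁻¹ᵁ U.1) :
    (I.comap f).ideal V = (I.ideal U).map (f.appLE U.1 V.1 h).hom := by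
  obtain ⟨V, hV⟩ := V
  obtain ⟨U, hU⟩ := U
  change IsAffineOpen V at hV
  change IsAffineOpen U at hU
  change V ≤ f ⁻¹ᵁ U at h
  have him {Z : Scheme.{u}} {W : Z.Opens} (hW : IsAffineOpen W) : hW.fromSpec ''ᵁ ⊤ = W := by
    rw [Scheme.Hom.image_top_eq_opensRange, hW.opensRange_fromSpec]
  let e : Γ(X, V) ≃+* Γ(Spec Γ(X, V), ⊤) := RingEquiv.ofBijective _ (appLE_fromSpec_bijective hV)
  -- transport along `Γ(X, V) ≃ Γ(Spec Γ(X, V), ⊤)`, where the pullback factors through `Spec Γ(Y, U)`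
  refine (Ideal.comap_injective_of_surjective e.symm e.symm.surjective) ?_
  rw [Ideal.comap_symm, Ideal.comap_symm]
  change ((I.comap f).ideal ⟨V, hV⟩).map (hV.fromSpec.appLE V ⊤ hV.fromSpec_preimage_self.ge).hom =
    ((I.ideal ⟨U, hU⟩).map (f.appLE U V h).hom).map
      (hV.fromSpec.appLE V ⊤ hV.fromSpec_preimage_self.ge).hom
  rw [← ideal_comap_of_image_eq (I.comap f) hV.fromSpec ⟨⊤, isAffineOpen_top _⟩ ⟨V, hV⟩ (him hV),
    ← comap_comp, Ideal.map_map, ← CommRingCat.hom_comp, Scheme.Hom.appLE_comp_appLE]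
  have e2 : hV.fromSpec ≫ f = Spec.map (f.appLE U V h) ≫ hU.fromSpec :=
    (IsAffineOpen.SpecMap_appLE_fromSpec f hU hV h).symm
  simp only [e2]
  rw [comap_comp, ideal_comap_top,
    ideal_comap_of_image_eq I hU.fromSpec ⟨⊤, isAffineOpen_top _⟩ ⟨U, hU⟩ (him hU)
      hU.fromSpec_preimage_self.ge, Ideal.map_map, ← CommRingCat.hom_comp]
  rw [Scheme.Hom.appTop, Scheme.Hom.app_eq_appLE]
  exact congrArg (fun r => Ideal.map (CommRingCat.Hom.hom r) _)
    (Scheme.Hom.appLE_comp_appLE _ _ _ _ _ _ _)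

end ComapIdeal

/-! ### Affine charts of the dilatation -/

section BlowUpChart

open Scheme.AffineZariskiSite

variable {Y : Scheme.{u}} (J : Y.IdealSheafData)

lemma gluedCover_w {S : Scheme.{u}} {𝒰 : S.OpenCover} [Category 𝒰.I₀] [𝒰.LocallyDirected]
    (d : 𝒰.RelativeGluingData) [Small.{u} 𝒰.I₀] [Quiver.IsThin 𝒰.I₀] {i j : 𝒰.I₀} (a : i ⟶ j) :
    d.functor.map a ≫ d.cover.f j = d.cover.f i :=
  colimit.w d.functor a

/-- The restriction of functions between objects of the affine Zariski site. -/
def siteRes {V W : Y.AffineZariskiSite} (i : V ⟶ W) : Γ(Y, W.toOpens) →+* Γ(Y, V.toOpens) :=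
  (Y.presheaf.map (homOfLE (toOpens_mono i.le)).op).hom

lemma map_siteRes {V W : Y.AffineZariskiSite} (i : V ⟶ W) :
    (J.ideal (aff W)).map (siteRes i) = J.ideal (aff V) :=
  map_ideal_site J i

/-- The inclusion of local blow-ups over a basic open. -/
def blowUpRes {V W : Y.AffineZariskiSite} (i : V ⟶ W) :
    reesProj (J.ideal (aff V)) ⟶ reesProj (J.ideal (aff W)) :=
  reesProjMap (siteRes i) _ _ (map_siteRes J i)

lemma blowUpRes_blowUpι {V W : Y.AffineZariskiSite} (i : V ⟶ W) :
    blowUpRes J i ≫ blowUpι J (aff W) = blowUpι J (aff V) :=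
  gluedCover_w (blowUpGluingData J) i

lemma blowUpι_blowUpRes {V W : Y.AffineZariskiSite} (i : V ⟶ W)
    (z : reesProj (J.ideal (aff V))) :
    blowUpι J (aff W) (blowUpRes J i z) = blowUpι J (aff V) z := by
  rw [← blowUpRes_blowUpι J i, Scheme.Hom.comp_apply]

lemma blowUpRes_mem_basicOpen {V W : Y.AffineZariskiSite} (i : V ⟶ W) (n : ℕ)
    (b : Γ(Y, W.toOpens)) (hb : b ∈ J.ideal (aff W) ^ n)
    (hb' : siteRes i b ∈ J.ideal (aff V) ^ n)
    (z : reesProj (J.ideal (aff V))) :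
    blowUpRes J i z ∈ Proj.basicOpen (reesGrading (J.ideal (aff W)))
        (reesMonomial (J.ideal (aff W)) n b hb) ↔
      z ∈ Proj.basicOpen (reesGrading (J.ideal (aff V)))
        (reesMonomial (J.ideal (aff V)) n _ hb') := by
  have h := reesMap_reesMonomial (siteRes i)
    (J.ideal (aff W)) (J.ideal (aff V)) (map_siteRes J i).le n b hb
  rw [← h]
  rfl

lemma map_pow_mem_site {V W : Y.AffineZariskiSite} (i : V ⟶ W) {n : ℕ} {b : Γ(Y, W.toOpens)}
    (hb : b ∈ J.ideal (aff W) ^ n) :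
    siteRes i b ∈ J.ideal (aff V) ^ n := by
  have h := Ideal.mem_map_of_mem (siteRes i) hb
  rwa [Ideal.map_pow, map_siteRes J i] at h

lemma ideal_eq_span_site {V W : Y.AffineZariskiSite} (i : V ⟶ W) {t : Γ(Y, W.toOpens)}
    (ht : J.ideal (aff W) = Ideal.span {t}) : J.ideal (aff V) =
      Ideal.span {siteRes i t} := by
  rw [← Set.image_singleton, ← Ideal.map_span, ← ht]
  exact (map_siteRes J i).symm

lemma exists_site_le {V W : Y.AffineZariskiSite} {y : Y} (hV : y ∈ V.toOpens)
    (hW : y ∈ W.toOpens) : ∃ V' : Y.AffineZariskiSite, V' ≤ V ∧ V' ≤ W ∧ y ∈ V'.toOpens := by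
  obtain ⟨r, s, e, hr⟩ := exists_basicOpen_le_affine_inter V.2 W.2 y ⟨hV, hW⟩
  exact ⟨V.basicOpen r, V.basicOpen_le r, ⟨s, e.symm⟩, hr⟩

/-- If `b = c tⁿ`, then `b Tⁿ` is a multiple of `(t T)ⁿ`. -/
lemma basicOpen_reesMonomial_le {R : Type u} [CommRing R] (J : Ideal R) {t : R} (ht : t ∈ J ^ 1)
    {n : ℕ} (hn : 0 < n) {b : R} (hb : b ∈ J ^ n) (h : b ∈ Ideal.span {t} ^ n) :
    Proj.basicOpen (reesGrading J) (reesMonomial J n b hb) ≤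
      Proj.basicOpen (reesGrading J) (reesMonomial J 1 t ht) := by
  rw [Ideal.span_singleton_pow, Ideal.mem_span_singleton'] at h
  obtain ⟨c, rfl⟩ := h
  rw [← Proj.basicOpen_pow _ (reesMonomial J 1 t ht) n hn]
  refine Proj.basicOpen_mono _ _ _ ⟨algebraMap _ _ c, ?_⟩
  refine Eq.trans ?_ (mul_comm _ _)
  rw [← Algebra.smul_def, reesMonomial_pow, smul_reesMonomial]

lemma blowUpι_mem (V : Y.AffineZariskiSite) (y : reesProj (J.ideal (aff V))) :
    blowUpπ J (blowUpι J (aff V) y) ∈ V.toOpens := by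
  have h : blowUpι J (aff V) y ∈ blowUpπ J ⁻¹ᵁ (aff V).1 := by
    rw [blowUpπ_preimage]
    exact ⟨y, rfl⟩
  exact h

lemma exists_blowUpι_eq (V : Y.AffineZariskiSite) {x : blowUp J} (h : blowUpπ J x ∈ V.toOpens) :
    ∃ z, blowUpι J (aff V) z = x := by
  have h : x ∈ blowUpπ J ⁻¹ᵁ (aff V).1 := h
  rw [blowUpπ_preimage] at h
  exact h

/-- The basic open subsets defining the dilatation, restricted to `V`, lie in `D₊(t T)`. -/
lemma exists_mem_basicOpen (I' : Y.IdealSheafData) (V V₁ : Y.AffineZariskiSite)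
    (t : Γ(Y, V.toOpens)) (ht : I'.ideal (aff V) = Ideal.span {t})
    (ht' : t ∈ J.ideal (aff V) ^ 1) {n : ℕ} (hn : 0 < n) {b : Γ(Y, V₁.toOpens)}
    (hb : b ∈ I'.ideal (aff V₁) ^ n) (hb' : b ∈ J.ideal (aff V₁) ^ n)
    {y : reesProj (J.ideal (aff V₁))} (hy : y ∈ Proj.basicOpen (reesGrading (J.ideal (aff V₁)))
      (reesMonomial (J.ideal (aff V₁)) n b hb'))
    (hyV : blowUpπ J (blowUpι J (aff V₁) y) ∈ V.toOpens) :
    ∃ z ∈ Proj.basicOpen (reesGrading (J.ideal (aff V)))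
      (reesMonomial (J.ideal (aff V)) 1 t ht'), blowUpι J (aff V) z = blowUpι J (aff V₁) y := by
  -- compare the charts over `V` and `V₁` over a common basic open `W`
  obtain ⟨W, hWV, hWV₁, hxW⟩ := exists_site_le hyV (blowUpι_mem J V₁ y)
  obtain ⟨z, hz⟩ := exists_blowUpι_eq J W hxW
  obtain rfl : blowUpRes J (homOfLE hWV₁) z = y :=
    (blowUpι J (aff V₁)).injective ((blowUpι_blowUpRes J (homOfLE hWV₁) z).trans hz)
  rw [blowUpRes_mem_basicOpen J _ n b hb' (map_pow_mem_site J _ hb')] at hy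
  refine ⟨blowUpRes J (homOfLE hWV) z, ?_, (blowUpι_blowUpRes J (homOfLE hWV) z).trans hz⟩
  rw [blowUpRes_mem_basicOpen J _ 1 t ht' (map_pow_mem_site J _ ht')]
  refine basicOpen_reesMonomial_le _ _ hn _ ?_ hy
  rw [← ideal_eq_span_site I' (homOfLE hWV) ht]
  exact map_pow_mem_site I' (homOfLE hWV₁) hb

/-- On the part over `V` of the blow-up, the dilatation is the basic open `D₊(t T)` if the ideal
`I'` is generated by `t` over `V`. -/
lemma image_basicOpen_eq (I' : Y.IdealSheafData) (h : I' ≤ J) (V : Y.AffineZariskiSite)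
    (t : Γ(Y, V.toOpens)) (ht : I'.ideal (aff V) = Ideal.span {t})
    (ht' : t ∈ J.ideal (aff V) ^ 1) :
    blowUpι J (aff V) ''ᵁ Proj.basicOpen (reesGrading (J.ideal (aff V)))
      (reesMonomial (J.ideal (aff V)) 1 t ht') =
    dilatationOpen J I' h ⊓ blowUpπ J ⁻¹ᵁ V.toOpens := by
  apply le_antisymm
  · refine le_inf ?_ ?_
    · have htm : t ∈ I'.ideal (aff V) ^ 1 := by
        rw [pow_one, ht]
        exact Ideal.mem_span_singleton_self t
      exact le_iSup_of_le (aff V) (le_iSup_of_le 1 (le_iSup_of_le one_pos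
        (le_iSup_of_le ⟨t, htm⟩ le_rfl)))
    · rintro _ ⟨y, -, rfl⟩
      exact blowUpι_mem J V y
  · rintro x ⟨hx, hxV⟩
    simp only [dilatationOpen, SetLike.mem_coe, Opens.mem_iSup] at hx
    obtain ⟨V₁, n, hn, b, y, hy, rfl⟩ := hx
    exact exists_mem_basicOpen J I' V ⟨V₁.1, V₁.2⟩ t ht ht' hn b.2
      (Ideal.pow_right_mono (h V₁) n b.2) hy hxV

end BlowUpChart

/-! ### Affine charts of the dilatation and of its exceptional divisor -/

section Charts

open Scheme.AffineZariskiSite HomogeneousLocalization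

namespace IsDilatationChart

variable {B A R C Q : Type u} [CommRing B] [CommRing A] [CommRing R] [CommRing C] [CommRing Q]
  {φ : B →+* A} {ψ : A →+* R} {K J : Ideal B} {I : Ideal A} {t : B}
  {α : B →+* C} {χ : C →+* Q} {ρ : R →+* Q} (h : IsDilatationChart φ ψ K J I t α χ ρ)

include h

/-- The exceptional divisor of the chart is the fibre of the dilatation over `Spec (B / J)`. -/
lemma isPushout : IsPushout (CommRingCat.ofHom α) (CommRingCat.ofHom (ψ.comp φ))
    (CommRingCat.ofHom χ) (CommRingCat.ofHom ρ) := by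
  have hsurj : Function.Surjective (ψ.comp φ) := h.surjective_right.comp h.surjective_left
  refine ⟨⟨by rw [← CommRingCat.ofHom_comp, ← h.comm]; rfl⟩,
    ⟨PushoutCocone.IsColimit.mk _ (fun s => CommRingCat.ofHom
      (χ.liftOfSurjective h.surjective ⟨s.inl.hom, ?_⟩)) ?_ ?_ ?_⟩⟩
  · rw [h.ker, Ideal.map_le_iff_le_comap]
    intro b hb
    have hw : s.inl.hom (α b) = s.inr.hom (ψ (φ b)) :=
      RingHom.congr_fun (congrArg CommRingCat.Hom.hom s.condition) b
    rw [← h.ker_comp, RingHom.mem_ker, RingHom.comp_apply] at hb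
    rw [Ideal.mem_comap, RingHom.mem_ker, hw, hb, map_zero]
  · exact fun s => CommRingCat.hom_ext (RingHom.liftOfSurjective_comp _ _ _)
  · intro s
    refine CommRingCat.hom_ext ((RingHom.cancel_right hsurj).mp (RingHom.ext fun b => ?_))
    have hw : s.inl.hom (α b) = s.inr.hom (ψ (φ b)) :=
      RingHom.congr_fun (congrArg CommRingCat.Hom.hom s.condition) b
    refine Eq.trans ?_ hw
    change χ.liftOfSurjective h.surjective _ (ρ (ψ (φ b))) = _
    rw [h.comm_apply]
    exact RingHom.liftOfSurjective_comp_apply χ h.surjective _ _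
  · intro s m hm _
    refine CommRingCat.hom_ext ((RingHom.cancel_right h.surjective).mp ?_)
    exact (congrArg CommRingCat.Hom.hom hm).trans
      (RingHom.liftOfSurjective_comp χ h.surjective ⟨s.inl.hom, _⟩).symm

end IsDilatationChart

variable {X Y : Scheme.{u}} (f : Y ⟶ X) (g : X ⟶ Y) (hg : g ≫ f = 𝟙 X)
  (D : EffectiveCartierDivisor X) {V : Y.AffineZariskiSite}
  {t : Γ(Y, V.toOpens)} (ht : (D.ideal.comap f).ideal (aff V) = Ideal.span {t})

include hg in
lemma comap_comap_section (I : X.IdealSheafData) : (I.comap f).comap g = I := by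
  rw [← Scheme.IdealSheafData.comap_comp, hg, Scheme.IdealSheafData.comap_id]

include hg ht in
lemma mem_imageIdeal : t ∈ (imageIdeal g D.ideal).ideal (aff V) ^ 1 := by
  rw [pow_one]
  refine comap_le_imageIdeal f g hg D.ideal (aff V) ?_
  rw [ht]
  exact Ideal.mem_span_singleton_self t

/-- The coordinate ring of the dilatation over an affine open `V` on which the inverse image of `D`
has the equation `t`: the degree zero part of the localization of the Rees algebra at `t T`. -/
abbrev ChartRing : Type u :=
  Away (reesGrading ((imageIdeal g D.ideal).ideal (aff V)))
    (reesMonomial ((imageIdeal g D.ideal).ideal (aff V)) 1 t (mem_imageIdeal f g hg D ht))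

/-- The structure map of `ChartRing`. -/
abbrev chartMap : Γ(Y, V.toOpens) →+* ChartRing f g hg D ht := reesToAway _ _

/-- The coordinate ring of the exceptional divisor over `V`. -/
abbrev ChartQuot : Type u :=
  ChartRing f g hg D ht ⧸ ((imageIdeal g D.ideal).ideal (aff V)).map (chartMap f g hg D ht)

/-- The reduction of functions on the dilatation to the exceptional divisor. -/
abbrev chartMk : ChartRing f g hg D ht →+* ChartQuot f g hg D ht := Ideal.Quotient.mk _

/-- The inclusion of the dilatation in the blow-up. -/
def dilatationToBlowUp : dilatation f g hg D.ideal ⟶ blowUp (imageIdeal g D.ideal) :=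
  (dilatationOpen (imageIdeal g D.ideal) (D.ideal.comap f)
    (comap_le_imageIdeal f g hg D.ideal)).ι

instance : IsOpenImmersion (dilatationToBlowUp f g hg D) :=
  inferInstanceAs (IsOpenImmersion (Scheme.Opens.ι _))

lemma opensRange_dilatationToBlowUp : (dilatationToBlowUp f g hg D).opensRange =
    dilatationOpen (imageIdeal g D.ideal) (D.ideal.comap f)
      (comap_le_imageIdeal f g hg D.ideal) :=
  Scheme.Opens.opensRange_ι _

lemma dilatationToBlowUp_π : dilatationToBlowUp f g hg D ≫ blowUpπ (imageIdeal g D.ideal) =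
    dilatationπ f g hg D.ideal := rfl

/-- The affine chart `D₊(t T)` of the blow-up. -/
def chartToBlowUp : Spec (.of (ChartRing f g hg D ht)) ⟶ blowUp (imageIdeal g D.ideal) :=
  Proj.awayι (reesGrading ((imageIdeal g D.ideal).ideal (aff V))) _
    (reesMonomial_mem _ _ _ (mem_imageIdeal f g hg D ht)) one_pos ≫
    blowUpι (imageIdeal g D.ideal) (aff V)

instance : IsOpenImmersion (chartToBlowUp f g hg D ht) := by
  unfold chartToBlowUp; infer_instance

lemma opensRange_chartToBlowUp : (chartToBlowUp f g hg D ht).opensRange =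
    dilatationOpen (imageIdeal g D.ideal) (D.ideal.comap f)
      (comap_le_imageIdeal f g hg D.ideal) ⊓ blowUpπ (imageIdeal g D.ideal) ⁻¹ᵁ V.toOpens := by
  unfold chartToBlowUp
  rw [Scheme.Hom.opensRange_comp, Proj.opensRange_awayι]
  exact image_basicOpen_eq _ _ _ _ _ ht _

lemma chartToBlowUp_π : chartToBlowUp f g hg D ht ≫ blowUpπ (imageIdeal g D.ideal) =
    Spec.map (CommRingCat.ofHom (chartMap f g hg D ht)) ≫ V.2.fromSpec := by
  rw [chartToBlowUp, Category.assoc, blowUpι_π, ← Category.assoc, awayι_reesProjToSpec]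

/-- The affine chart of the dilatation over `V`. -/
def dilatationι : Spec (.of (ChartRing f g hg D ht)) ⟶ dilatation f g hg D.ideal :=
  IsOpenImmersion.lift (dilatationToBlowUp f g hg D) (chartToBlowUp f g hg D ht) <| by
    change (chartToBlowUp f g hg D ht).opensRange ≤ (dilatationToBlowUp f g hg D).opensRange
    rw [opensRange_chartToBlowUp, opensRange_dilatationToBlowUp]
    exact inf_le_left

lemma dilatationι_toBlowUp : dilatationι f g hg D ht ≫ dilatationToBlowUp f g hg D =
    chartToBlowUp f g hg D ht :=
  IsOpenImmersion.lift_fac _ _ _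

lemma dilatationι_π : dilatationι f g hg D ht ≫ dilatationπ f g hg D.ideal =
    Spec.map (CommRingCat.ofHom (chartMap f g hg D ht)) ≫ V.2.fromSpec := by
  rw [← chartToBlowUp_π, ← dilatationι_toBlowUp, Category.assoc, dilatationToBlowUp_π]

instance : IsOpenImmersion (dilatationι f g hg D ht) := by
  have : IsOpenImmersion (dilatationι f g hg D ht ≫ dilatationToBlowUp f g hg D) := by
    rw [dilatationι_toBlowUp]; infer_instance
  exact IsOpenImmersion.of_comp _ (dilatationToBlowUp f g hg D)

lemma opensRange_dilatationι : (dilatationι f g hg D ht).opensRange =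
    dilatationπ f g hg D.ideal ⁻¹ᵁ V.toOpens := by
  apply (dilatationToBlowUp f g hg D).image_injective
  dsimp only
  rw [← Scheme.Hom.opensRange_comp]
  simp only [dilatationι_toBlowUp]
  rw [opensRange_chartToBlowUp, ← dilatationToBlowUp_π, Scheme.Hom.comp_preimage,
    Scheme.Hom.image_preimage_eq_opensRange_inf, opensRange_dilatationToBlowUp]

/-- The chart of the dilatation over `V` is the preimage of `V`. -/
lemma isPullback_dilatationι : IsPullback (dilatationι f g hg D ht)
    (Spec.map (CommRingCat.ofHom (chartMap f g hg D ht))) (dilatationπ f g hg D.ideal)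
    V.2.fromSpec :=
  (IsOpenImmersion.isPullback _ _ _ _ (dilatationι_π f g hg D ht) (by
    rw [opensRange_dilatationι, IsAffineOpen.opensRange_fromSpec])).flip

variable [IsClosedImmersion g]

/-- The composite of the surjections of coordinate rings belonging to `D → X → Y`. -/
abbrev divisorRes (V : Y.affineOpens) :
    Γ(Y, V.1) →+* Γ(D.ideal.subscheme, D.ideal.subschemeι ⁻¹ᵁ g ⁻¹ᵁ V.1) :=
  (D.ideal.subschemeι.app (g ⁻¹ᵁ V.1)).hom.comp (g.app V.1).hom

lemma surjective_app (V : Y.affineOpens) : Function.Surjective (g.app V.1).hom :=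
  Scheme.Hom.app_surjective g V.1 V.2

lemma surjective_divisor_app (V : Y.affineOpens) :
    Function.Surjective (D.ideal.subschemeι.app (g ⁻¹ᵁ V.1)).hom :=
  D.ideal.subschemeι_app_surjective ⟨g ⁻¹ᵁ V.1, V.2.preimage g⟩

lemma surjective_divisorRes (V : Y.affineOpens) : Function.Surjective (divisorRes g D V) :=
  (surjective_divisor_app g D V).comp (surjective_app g V)

lemma ker_divisorRes (V : Y.affineOpens) :
    RingHom.ker (divisorRes g D V) = (imageIdeal g D.ideal).ideal V := by
  rw [imageIdeal, Scheme.Hom.ker_apply, Scheme.Hom.comp_app]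
  rfl

/-- The structure map of `ChartQuot` from functions on `D`. It exists because the kernel of the
surjection from functions on `V` is the ideal of `g(D)`. -/
def chartStr : Γ(D.ideal.subscheme, D.ideal.subschemeι ⁻¹ᵁ g ⁻¹ᵁ V.toOpens) →+*
    ChartQuot f g hg D ht :=
  (divisorRes g D (aff V)).liftOfSurjective (surjective_divisorRes g D (aff V))
    ⟨(chartMk f g hg D ht).comp (chartMap f g hg D ht), by
      rw [ker_divisorRes]
      intro b hb
      exact Ideal.Quotient.eq_zero_iff_mem.mpr (Ideal.mem_map_of_mem _ hb)⟩

/-- The chart rings satisfy the hypotheses of the affine theory. -/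
lemma isDilatationChart : IsDilatationChart (g.app (aff V).1).hom
    (D.ideal.subschemeι.app (g ⁻¹ᵁ (aff V).1)).hom (g.ker.ideal (aff V))
    ((imageIdeal g D.ideal).ideal (aff V)) (divisorIdeal g D (aff V)) t (chartMap f g hg D ht)
    (chartMk f g hg D ht) (chartStr f g hg D ht) where
  surjective_left := surjective_app g (aff V)
  surjective_right := surjective_divisor_app g D (aff V)
  ker_left := (Scheme.Hom.ker_apply g (aff V)).symm
  ker_right := D.ideal.ker_subschemeι_app ⟨g ⁻¹ᵁ V.toOpens, V.2.preimage g⟩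
  ker_comp := ker_divisorRes g D (aff V)
  span_eq := by
    have h := ideal_comap_eq_map (D.ideal.comap f) g ⟨g ⁻¹ᵁ V.toOpens, V.2.preimage g⟩ (aff V) le_rfl
    rw [comap_comap_section f g hg, ht, Ideal.map_span, Set.image_singleton] at h
    rw [divisorIdeal, h, ← Scheme.Hom.app_eq_appLE]
  isDilatationAlgebra := isDilatationAlgebra_reesToAway _ _ _
  surjective := Ideal.Quotient.mk_surjective
  ker := Ideal.mk_ker
  comm := RingHom.liftOfSurjective_comp _ _ _

/-- The affine chart of `D` over an affine open `V` of `Y`. -/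
abbrev divisorι (V : Y.affineOpens) :
    Spec Γ(D.ideal.subscheme, D.ideal.subschemeι ⁻¹ᵁ g ⁻¹ᵁ V.1) ⟶ D.ideal.subscheme :=
  ((V.2.preimage g).preimage D.ideal.subschemeι).fromSpec

lemma opensRange_divisorι (V : Y.affineOpens) :
    (divisorι g D V).opensRange = D.ideal.subschemeι ⁻¹ᵁ g ⁻¹ᵁ V.1 :=
  ((V.2.preimage g).preimage D.ideal.subschemeι).opensRange_fromSpec

lemma divisorι_comp (V : Y.affineOpens) : divisorι g D V ≫ D.ideal.subschemeι ≫ g =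
    Spec.map (CommRingCat.ofHom (divisorRes g D V)) ≫ V.2.fromSpec := by
  have h := SpecMap_comp_fromSpec g D.ideal.subschemeι V.2 (𝟙 _)
  rw [Category.comp_id, Spec.map_id, Category.id_comp] at h
  exact h.symm

lemma isPullback_comp_dilatationι : IsPullback
    (Spec.map (CommRingCat.ofHom (chartMk f g hg D ht)) ≫ dilatationι f g hg D ht)
    (Spec.map (CommRingCat.ofHom (chartStr f g hg D ht))) (dilatationπ f g hg D.ideal)
    (divisorι g D (aff V) ≫ D.ideal.subschemeι ≫ g) := by
  have h := (isPullback_SpecMap_of_isPushout _ _ _ _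
    (isDilatationChart f g hg D ht).isPushout).paste_horiz
    (isPullback_dilatationι f g hg D ht)
  rw [divisorι_comp]
  exact h

/-- The affine chart of the exceptional divisor over `V`. -/
def exceptionalι : Spec (.of (ChartQuot f g hg D ht)) ⟶ exceptionalDivisor f g hg D.ideal :=
  pullback.lift (Spec.map (CommRingCat.ofHom (chartMk f g hg D ht)) ≫ dilatationι f g hg D ht)
    (Spec.map (CommRingCat.ofHom (chartStr f g hg D ht)) ≫ divisorι g D (aff V))
    ((isPullback_comp_dilatationι f g hg D ht).w.trans (Category.assoc _ _ _).symm)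

lemma exceptionalι_ι : exceptionalι f g hg D ht ≫ exceptionalDivisorι f g hg D.ideal =
    Spec.map (CommRingCat.ofHom (chartMk f g hg D ht)) ≫ dilatationι f g hg D ht :=
  pullback.lift_fst _ _ _

lemma exceptionalι_toDivisor :
    exceptionalι f g hg D ht ≫ exceptionalDivisorToDivisor f g hg D.ideal =
    Spec.map (CommRingCat.ofHom (chartStr f g hg D ht)) ≫ divisorι g D (aff V) :=
  pullback.lift_snd _ _ _

/-- The chart of the exceptional divisor over `V` is the preimage of the chart of `D`. -/
lemma isPullback_exceptionalι : IsPullback (exceptionalι f g hg D ht)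
    (Spec.map (CommRingCat.ofHom (chartStr f g hg D ht)))
    (exceptionalDivisorToDivisor f g hg D.ideal) (divisorι g D (aff V)) := by
  refine IsPullback.of_right ?_ (exceptionalι_toDivisor f g hg D ht)
    (IsPullback.of_hasPullback (dilatationπ f g hg D.ideal) (D.ideal.subschemeι ≫ g))
  have h := isPullback_comp_dilatationι f g hg D ht
  rw [← exceptionalι_ι] at h
  exact h

instance : IsOpenImmersion (exceptionalι f g hg D ht) :=
  MorphismProperty.of_isPullback (isPullback_exceptionalι f g hg D ht).flip inferInstance

lemma opensRange_exceptionalι : (exceptionalι f g hg D ht).opensRange =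
    exceptionalOpen f g hg D V.toOpens := by
  have h := IsOpenImmersion.image_preimage_eq_preimage_image_of_isPullback
    (isPullback_exceptionalι f g hg D ht).flip ⊤
  rw [Scheme.Hom.preimage_top, Scheme.Hom.image_top_eq_opensRange,
    Scheme.Hom.image_top_eq_opensRange, opensRange_divisorι] at h
  exact h

/-- The chart of the bundle over `V` is the preimage of the chart of `D`. -/
lemma isPullback_normalBundleι (V : Y.affineOpens) : IsPullback (normalBundleι g D V)
    (Spec.map (normalStr g D V)) (normalBundleToDivisor g D) (divisorι g D V) :=
  (IsOpenImmersion.isPullback _ _ _ _ (normalBundleι_toDivisor g D V) (by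
    rw [opensRange_divisorι, normalBundle_preimage, Scheme.Hom.image_top_eq_opensRange])).flip

end Charts

/-! ### Existence of good charts -/

section GoodChart

open Scheme.AffineZariskiSite

/-- An invertible ideal becomes principal after inverting a suitable element outside a given prime
ideal. -/
lemma exists_mul_mem_span {A : Type*} [CommRing A] (I : Ideal A) [Module.Invertible A I]
    (p : Ideal A) (hp : p ≠ ⊤) : ∃ r ∉ p, ∃ x ∈ I, ∀ y ∈ I, r * y ∈ Ideal.span {x} := by
  by_contra! H
  refine hp ((Ideal.eq_top_iff_one p).mpr ?_)
  obtain ⟨z, hz⟩ := (Module.Invertible.bijective (R := A) (M := I)).2 1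
  rw [← hz]
  clear hz
  induction z with
  | zero => simp
  | add a b ha hb => rw [map_add]; exact add_mem ha hb
  | tmul μ x =>
    rw [contractLeft_apply]
    by_contra hn
    obtain ⟨y, hy, hy'⟩ := H _ hn x x.2
    -- `μ(x) y = μ(x y) = μ(y) x`
    refine hy' (Ideal.mem_span_singleton'.mpr ⟨μ ⟨y, hy⟩, ?_⟩)
    have e : y • x = (x : A) • (⟨y, hy⟩ : I) := Subtype.ext (mul_comm _ _)
    have e' := congrArg μ e
    rw [map_smul, map_smul, smul_eq_mul, smul_eq_mul] at e'
    rw [mul_comm, ← e', mul_comm]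

/-- An effective Cartier divisor has an equation in a neighbourhood of each point. -/
lemma EffectiveCartierDivisor.exists_eq_span {X : Scheme.{u}} (D : EffectiveCartierDivisor X)
    (x : X) : ∃ U : X.affineOpens, x ∈ U.1 ∧ ∃ τ : Γ(X, U.1), D.ideal.ideal U = Ideal.span {τ} := by
  obtain ⟨U, hU, hx, -⟩ := exists_isAffineOpen_mem_and_subset (show x ∈ (⊤ : X.Opens) from trivial)
  have := D.invertible ⟨U, hU⟩
  let p := (IsLocalRing.maximalIdeal (X.presheaf.stalk x)).comap (X.presheaf.germ U x hx).hom
  obtain ⟨r, hr, s, hs, H⟩ := exists_mul_mem_span (D.ideal.ideal ⟨U, hU⟩) p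
    (Ideal.comap_ne_top _ (IsLocalRing.maximalIdeal.isMaximal _).ne_top)
  have hr' : IsUnit ((X.presheaf.germ U x hx).hom r) := by
    by_contra h
    exact hr ((IsLocalRing.mem_maximalIdeal _).mpr h)
  refine ⟨⟨X.basicOpen r, hU.basicOpen r⟩, (X.mem_basicOpen r x hx).mpr hr',
    X.presheaf.map (homOfLE (X.basicOpen_le r)).op s, ?_⟩
  let res := (X.presheaf.map (homOfLE (X.basicOpen_le r)).op).hom
  have hI : (D.ideal.ideal ⟨U, hU⟩).map res = D.ideal.ideal ⟨X.basicOpen r, hU.basicOpen r⟩ :=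
    D.ideal.map_ideal' (U := ⟨X.basicOpen r, hU.basicOpen r⟩) (V := ⟨U, hU⟩) _
  have hres : IsUnit (res r) := RingedSpace.isUnit_res_basicOpen _ r
  refine le_antisymm ?_ ?_
  · rw [← hI, Ideal.map_le_iff_le_comap]
    intro y hy
    have h := Ideal.mem_map_of_mem res (H y hy)
    rw [Ideal.map_span, Set.image_singleton, map_mul] at h
    exact (Ideal.unit_mul_mem_iff_mem _ hres).mp h
  · rw [Ideal.span_singleton_le_iff_mem, ← hI]
    exact Ideal.mem_map_of_mem res hs

variable {X Y : Scheme.{u}} (f : Y ⟶ X) (g : X ⟶ Y) (hg : g ≫ f = 𝟙 X)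
  (D : EffectiveCartierDivisor X) [IsClosedImmersion g]

/-- An affine open `V` of `Y` is a good chart, with equation `t`, if `t` generates the inverse image
of the ideal of `D` over `V`, is the inverse image `f^*τ` of a section `τ` of that ideal over an
affine open of `X`, and if the ideal of `g` is generated by a regular sequence over `V`. -/
structure IsGoodChart (V : Y.AffineZariskiSite) (t : Γ(Y, V.toOpens)) : Prop where
  ideal_eq : (D.ideal.comap f).ideal (aff V) = Ideal.span {t}
  exists_eq : ∃ (U : X.affineOpens) (h : V.toOpens ≤ f ⁻¹ᵁ U.1) (τ : D.ideal.ideal U),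
    (f.appLE U.1 V.toOpens h).hom τ.1 = t
  exists_regular : ∃ rs : List Γ(Y, V.toOpens),
    RingTheory.Sequence.IsWeaklyRegular Γ(Y, V.toOpens) rs ∧
      Ideal.ofList rs = g.ker.ideal (aff V)

omit [IsClosedImmersion g] in
/-- Regular generating sequences restrict to basic opens, by flatness of localization. -/
lemma exists_regular_of_hom {V V' : Y.AffineZariskiSite} (i : V' ⟶ V)
    (h : ∃ rs : List Γ(Y, V.toOpens), RingTheory.Sequence.IsWeaklyRegular Γ(Y, V.toOpens) rs ∧
      Ideal.ofList rs = g.ker.ideal (aff V)) :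
    ∃ rs : List Γ(Y, V'.toOpens), RingTheory.Sequence.IsWeaklyRegular Γ(Y, V'.toOpens) rs ∧
      Ideal.ofList rs = g.ker.ideal (aff V') := by
  obtain ⟨rs, hrs, hK⟩ := h
  obtain ⟨s, hs⟩ := i.le
  have hloc := isLocalization_of_eq_basicOpen V.2 s _ hs.symm (toOpens_mono i.le)
  let := (siteRes i).toAlgebra
  have : IsLocalization.Away s Γ(Y, V'.toOpens) := hloc
  refine ⟨rs.map (siteRes i), hrs.of_isLocalization Γ(Y, V'.toOpens) (Submonoid.powers s), ?_⟩
  rw [← Ideal.map_ofList, hK, map_siteRes]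

variable {f} in
lemma siteRes_appLE {V V' : Y.AffineZariskiSite} (i : V' ⟶ V) {U : X.Opens}
    (h : V.toOpens ≤ f ⁻¹ᵁ U) (τ : Γ(X, U)) : siteRes i ((f.appLE U V.toOpens h).hom τ) =
      (f.appLE U V'.toOpens ((toOpens_mono i.le).trans h)).hom τ :=
  RingHom.congr_fun (congrArg CommRingCat.Hom.hom (Scheme.Hom.appLE_map f h _)) τ

include hg in
/-- Every affine neighbourhood of a point of `g(X)` contains a good chart that is basic open in it. -/
lemma exists_isGoodChart (hreg : IsRegularImmersion g) (x : X) (W : Y.AffineZariskiSite)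
    (hx : g x ∈ W.toOpens) : ∃ V ≤ W, ∃ t, g x ∈ V.toOpens ∧ IsGoodChart f g D V t := by
  obtain ⟨V₁, hxV₁, h₁⟩ := hreg x
  obtain ⟨V₂, hV₂W, hV₂V₁, hxV₂⟩ := exists_site_le hx (W := ⟨V₁.1, V₁.2⟩) hxV₁
  obtain ⟨U, hxU, τ, hτ⟩ := D.exists_eq_span x
  have hfx : f (g x) = x := by
    rw [← Scheme.Hom.comp_apply, hg]; rfl
  obtain ⟨s, hsU, hxs⟩ := V₂.2.exists_basicOpen_le (V := f ⁻¹ᵁ U.1)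
    ⟨g x, show f (g x) ∈ U.1 by rwa [hfx]⟩ hxV₂
  have hle := V₂.basicOpen_le s
  refine ⟨V₂.basicOpen s, hle.trans hV₂W, f.appLE U.1 _ hsU τ, hxs, ?_,
    ⟨U, hsU, ⟨τ, hτ ▸ Ideal.mem_span_singleton_self τ⟩, rfl⟩,
    exists_regular_of_hom g (V := ⟨V₁.1, V₁.2⟩) (homOfLE (hle.trans hV₂V₁)) h₁⟩
  rw [ideal_comap_eq_map D.ideal f (aff (V₂.basicOpen s)) U hsU, hτ, Ideal.map_span,
    Set.image_singleton]
  rfl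

end GoodChart

/-! ### Evaluation of sections along morphisms from affine schemes -/

section Eval

variable {Z Z' : Scheme.{u}} {R S : CommRingCat.{u}}

/-- The pullback of sections over `W` along a morphism `h : Spec R ⟶ Z` with image in `W`. -/
def evalAt (h : Spec R ⟶ Z) (W : Z.Opens) (hW : ⊤ ≤ h ⁻¹ᵁ W) : Γ(Z, W) →+* R :=
  (h.appLE W ⊤ hW ≫ (Scheme.ΓSpecIso R).hom).hom

lemma evalAt_congr {h h' : Spec R ⟶ Z} (e : h = h') (W : Z.Opens) (hW : ⊤ ≤ h ⁻¹ᵁ W)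
    (s : Γ(Z, W)) : evalAt h W hW s = evalAt h' W (e ▸ hW) s := by
  subst e; rfl

lemma top_le_preimage_comp {h : Spec R ⟶ Z} {φ : Z ⟶ Z'} {W : Z'.Opens} {W' : Z.Opens}
    (e : W' ≤ φ ⁻¹ᵁ W) (hW : ⊤ ≤ h ⁻¹ᵁ W') : ⊤ ≤ (h ≫ φ) ⁻¹ᵁ W :=
  hW.trans (h.preimage_mono e)

lemma evalAt_appLE (h : Spec R ⟶ Z) (φ : Z ⟶ Z') {W : Z'.Opens} {W' : Z.Opens}
    (e : W' ≤ φ ⁻¹ᵁ W) (hW : ⊤ ≤ h ⁻¹ᵁ W') (s : Γ(Z', W)) :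
    evalAt h W' hW (φ.appLE W W' e s) = evalAt (h ≫ φ) W (top_le_preimage_comp e hW) s := by
  have H := Scheme.Hom.appLE_comp_appLE h φ W W' ⊤ e hW
  have H' := RingHom.congr_fun (congrArg CommRingCat.Hom.hom H) s
  exact congrArg (Scheme.ΓSpecIso R).hom.hom H'

lemma evalAt_app (h : Spec R ⟶ Z) (φ : Z ⟶ Z') {W : Z'.Opens} (hW : ⊤ ≤ h ⁻¹ᵁ φ ⁻¹ᵁ W)
    (s : Γ(Z', W)) : evalAt h (φ ⁻¹ᵁ W) hW (φ.app W s) = evalAt (h ≫ φ) W hW s := by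
  rw [Scheme.Hom.app_eq_appLE]
  exact evalAt_appLE h φ le_rfl hW s

lemma evalAt_map (h : Spec R ⟶ Z) {W W' : Z.Opens} (e : W' ≤ W) (hW : ⊤ ≤ h ⁻¹ᵁ W')
    (s : Γ(Z, W)) : evalAt h W' hW (Z.presheaf.map (homOfLE e).op s) =
      evalAt h W (hW.trans (h.preimage_mono e)) s := by
  have H := Scheme.Hom.map_appLE h hW (homOfLE e).op
  exact congrArg (Scheme.ΓSpecIso R).hom.hom (RingHom.congr_fun (congrArg CommRingCat.Hom.hom H) s)

lemma evalAt_SpecMap (ψ : R ⟶ S) (h : Spec R ⟶ Z) (W : Z.Opens) (hW : ⊤ ≤ h ⁻¹ᵁ W)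
    (hW' : ⊤ ≤ (Spec.map ψ ≫ h) ⁻¹ᵁ W) (s : Γ(Z, W)) :
    evalAt (Spec.map ψ ≫ h) W hW' s = ψ.hom (evalAt h W hW s) := by
  have H := Scheme.Hom.appLE_comp_appLE (Spec.map ψ) h W ⊤ ⊤ hW
    ((Spec.map ψ).preimage_top).ge
  have H2 : (Spec.map ψ).appLE ⊤ ⊤ ((Spec.map ψ).preimage_top).ge ≫ (Scheme.ΓSpecIso S).hom =
      (Scheme.ΓSpecIso R).hom ≫ ψ := by
    exact (congrArg (· ≫ _) (Scheme.Hom.appLE_eq_app (Spec.map ψ))).trans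
      (Scheme.ΓSpecIso_naturality ψ)
  have H3 : (Spec.map ψ ≫ h).appLE W ⊤ hW' ≫ (Scheme.ΓSpecIso S).hom =
      (h.appLE W ⊤ hW ≫ (Scheme.ΓSpecIso R).hom) ≫ ψ := by
    rw [← H, Category.assoc, H2, Category.assoc]
  exact RingHom.congr_fun (congrArg CommRingCat.Hom.hom H3) s

lemma evalAt_of_comp_eq {Q Q' : Type u} [CommRing Q] [CommRing Q'] (c : Q →+* Q')
    {h : Spec (.of Q) ⟶ Z} {h' : Spec (.of Q') ⟶ Z} (e : Spec.map (CommRingCat.ofHom c) ≫ h = h')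
    (W : Z.Opens) (hW : ⊤ ≤ h ⁻¹ᵁ W) (hW' : ⊤ ≤ h' ⁻¹ᵁ W) (s : Γ(Z, W)) :
    evalAt h' W hW' s = c (evalAt h W hW s) := by
  subst e
  exact evalAt_SpecMap _ _ _ hW hW' s

lemma evalAt_fromSpec {V : Z.Opens} (hV : IsAffineOpen V) (hW : ⊤ ≤ hV.fromSpec ⁻¹ᵁ V)
    (s : Γ(Z, V)) : evalAt hV.fromSpec V hW s = s := by
  have H : hV.fromSpec.appLE V ⊤ hW ≫ (Scheme.ΓSpecIso Γ(Z, V)).hom = 𝟙 _ := by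
    rw [Scheme.Hom.appLE, hV.fromSpec_app_self, Category.assoc, Category.assoc, Iso.inv_comp_eq,
      Category.comp_id, ← Functor.map_comp_assoc]
    exact (congrArg (· ≫ _) ((Spec Γ(Z, V)).presheaf.map_id _)).trans (Category.id_comp _)
  exact RingHom.congr_fun (congrArg CommRingCat.Hom.hom H) s

lemma isIso_appLE_of_opensRange_eq {Z Z' : Scheme.{u}} (h : Z ⟶ Z') [IsOpenImmersion h]
    (W : Z'.Opens) (hW : ⊤ ≤ h ⁻¹ᵁ W) (e : h.opensRange = W) : IsIso (h.appLE W ⊤ hW) := by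
  rw [← Scheme.Hom.image_top_eq_opensRange] at e
  have : h.appLE W ⊤ hW = Z'.presheaf.map (eqToHom e).op ≫ (h.appIso ⊤).hom := by
    rw [Scheme.Hom.appIso_hom', Scheme.Hom.map_appLE]
  rw [this]
  infer_instance

lemma evalAt_bijective (h : Spec R ⟶ Z) [IsOpenImmersion h] (W : Z.Opens) (hW : ⊤ ≤ h ⁻¹ᵁ W)
    (e : h.opensRange = W) : Function.Bijective (evalAt h W hW) := by
  have := isIso_appLE_of_opensRange_eq h W hW e
  exact ConcreteCategory.bijective_of_isIso (h.appLE W ⊤ hW ≫ (Scheme.ΓSpecIso R).hom)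

/-- Sections that agree after pullback to an affine open neighbourhood of each point are equal. -/
lemma eq_of_evalAt_eq {W : Z.Opens} {a b : Γ(Z, W)} (H : ∀ z ∈ W, ∃ (R : CommRingCat.{u})
    (h : Spec R ⟶ Z) (_ : IsOpenImmersion h) (hW : ⊤ ≤ h ⁻¹ᵁ W), z ∈ h.opensRange ∧
      evalAt h W hW a = evalAt h W hW b) : a = b := by
  choose R h hopen hle hmem heq using H
  have hrange (z : W) : (h z.1 z.2).opensRange ≤ W := by
    rw [← Scheme.Hom.image_top_eq_opensRange]
    exact ((h z.1 z.2).image_mono (hle z.1 z.2)).trans (Scheme.Hom.image_preimage_le _ _)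
  refine Z.sheaf.eq_of_locally_eq' (fun z : W => (h z.1 z.2).opensRange) W
    (fun z => homOfLE (hrange z)) (fun z hz => Opens.mem_iSup.mpr ⟨⟨z, hz⟩, hmem z hz⟩) a b
    fun z => ?_
  have hi := (evalAt_bijective (h z.1 z.2) _ (h z.1 z.2).preimage_opensRange.ge rfl).1
  exact hi ((evalAt_map _ (hrange z) _ a).trans ((heq z.1 z.2).trans
    (evalAt_map _ (hrange z) _ b).symm))

lemma top_le_preimage_of_opensRange_le (h : Spec R ⟶ Z) [IsOpenImmersion h] {W : Z.Opens}
    (e : h.opensRange ≤ W) : ⊤ ≤ h ⁻¹ᵁ W := by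
  rw [← Scheme.Hom.preimage_opensRange h]
  exact h.preimage_mono e

/-- A morphism from an affine scheme with image in an affine open chart is given by a ring
homomorphism. -/
lemma exists_hom_of_range_le (j : Spec R ⟶ Z) [IsOpenImmersion j] (h : Spec S ⟶ Z)
    (H : ⊤ ≤ h ⁻¹ᵁ j.opensRange) : ∃ c : R ⟶ S, Spec.map c ≫ j = h := by
  have H' : Set.range h ⊆ Set.range j := by
    rintro _ ⟨z, rfl⟩
    exact H (show z ∈ (⊤ : (Spec S).Opens) from trivial)
  exact ⟨Spec.preimage (IsOpenImmersion.lift j h H'), by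
    rw [Spec.map_preimage, IsOpenImmersion.lift_fac]⟩

variable {X Y : Scheme.{u}} (g : X ⟶ Y) [IsClosedImmersion g] (D : EffectiveCartierDivisor X)

lemma opensRange_normalBundleι (V : Y.affineOpens) : (normalBundleι g D V).opensRange =
    normalBundleToDivisor g D ⁻¹ᵁ D.ideal.subschemeι ⁻¹ᵁ g ⁻¹ᵁ V.1 := by
  rw [normalBundle_preimage, Scheme.Hom.image_top_eq_opensRange]

lemma evalAt_normalBundleι (V : Y.affineOpens) (hW) (s : NormalSym g D V) :
    evalAt (normalBundleι g D V) _ hW (normalBundleFun g D V s) = s := by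
  have H : ((Scheme.ΓSpecIso (.of (NormalSym g D V))).inv ≫ ((normalBundleι g D V).appIso ⊤).inv ≫
      (normalBundle g D).presheaf.map (eqToHom (normalBundle_preimage g D V)).op) ≫
      (normalBundleι g D V).appLE _ ⊤ hW ≫ (Scheme.ΓSpecIso (.of (NormalSym g D V))).hom = 𝟙 _ := by
    rw [Category.assoc, Category.assoc, Scheme.Hom.map_appLE_assoc, ← Scheme.Hom.appIso_hom']
    simp
  exact RingHom.congr_fun (congrArg CommRingCat.Hom.hom H) s

end Eval

/-! ### The canonical morphism on the charts -/

section LocalMorphism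

open Scheme.AffineZariskiSite

variable {X Y : Scheme.{u}} (f : Y ⟶ X) (g : X ⟶ Y) (hg : g ≫ f = 𝟙 X)
  (D : EffectiveCartierDivisor X) [IsClosedImmersion g]

/-- The function `μ(τ) · q|_{E_(D)}` on the part of the exceptional divisor over `V`. -/
def canonicalSection {U : X.affineOpens} {V : Y.affineOpens} (hUV : V.1 ≤ f ⁻¹ᵁ U.1)
    (τ : D.ideal.ideal U) (μ : Module.Dual Γ(X, g ⁻¹ᵁ V.1) (divisorIdeal g D V))
    (q : Γ(dilatation f g hg D.ideal, dilatationπ f g hg D.ideal ⁻¹ᵁ V.1)) :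
    Γ(exceptionalDivisor f g hg D.ideal, exceptionalOpen f g hg D V.1) :=
  (exceptionalDivisorToDivisor f g hg D.ideal).app _
    (D.ideal.subschemeι.app _ (μ (restrictDivisorIdeal f g hg D hUV τ))) *
  (exceptionalDivisorι f g hg D.ideal).appLE _ _ (exceptionalOpen_le f g hg D V.1) q

include hg in
omit [IsClosedImmersion g] in
lemma app_appLE_section {U : X.Opens} {V : Y.Opens} (hUV : V ≤ f ⁻¹ᵁ U) (τ : Γ(X, U)) :
    (g.app V).hom ((f.appLE U V hUV).hom τ) =
      X.presheaf.map (homOfLE (preimage_le_of_le f g hg hUV)).op τ := by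
  have h : f.appLE U V hUV ≫ g.app V =
      X.presheaf.map (homOfLE (preimage_le_of_le f g hg hUV)).op := by
    rw [Scheme.Hom.app_eq_appLE, Scheme.Hom.appLE_comp_appLE]
    simp only [hg]
    exact Category.id_comp _
  exact RingHom.congr_fun (congrArg CommRingCat.Hom.hom h) τ

variable {V V' : Y.AffineZariskiSite} {t : Γ(Y, V.toOpens)} {t' : Γ(Y, V'.toOpens)}
  (ht : (D.ideal.comap f).ideal (aff V) = Ideal.span {t})
  (ht' : (D.ideal.comap f).ideal (aff V') = Ideal.span {t'})

/-- The homomorphism of coordinate rings giving the canonical morphism over `V`. -/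
def chartSymHom : NormalSym g D (aff V) →+* ChartQuot f g hg D ht :=
  (isDilatationChart f g hg D ht).symHom

/-- The canonical morphism on the chart over `V`. -/
def chartMorphism : Spec (.of (ChartQuot f g hg D ht)) ⟶ normalBundle g D :=
  Spec.map (CommRingCat.ofHom (chartSymHom f g hg D ht)) ≫ normalBundleι g D (aff V)

lemma chartMorphism_toDivisor : chartMorphism f g hg D ht ≫ normalBundleToDivisor g D =
    exceptionalι f g hg D ht ≫ exceptionalDivisorToDivisor f g hg D.ideal := by
  have h : normalStr g D (aff V) ≫ CommRingCat.ofHom (chartSymHom f g hg D ht) =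
      CommRingCat.ofHom (chartStr f g hg D ht) :=
    CommRingCat.hom_ext (RingHom.ext fun r => (isDilatationChart f g hg D ht).symHom_algebraMap r)
  rw [chartMorphism, Category.assoc, normalBundleι_toDivisor, ← Spec.map_comp_assoc, h,
    exceptionalι_toDivisor]

omit [IsClosedImmersion g] in
lemma evalAt_dilatationι (i : V' ⟶ V) (hW) (b : Γ(Y, V.toOpens)) :
    evalAt (dilatationι f g hg D ht') (dilatationπ f g hg D.ideal ⁻¹ᵁ V.toOpens) hW
      ((dilatationπ f g hg D.ideal).app V.toOpens b) = chartMap f g hg D ht' (siteRes i b) := by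
  have hV' : ⊤ ≤ V'.2.fromSpec ⁻¹ᵁ V'.toOpens := V'.2.fromSpec_preimage_self.ge
  have hV := hV'.trans (V'.2.fromSpec.preimage_mono (toOpens_mono i.le))
  refine (evalAt_app _ _ _ _).trans ((evalAt_congr (dilatationι_π f g hg D ht') _ _ _).trans
    ((evalAt_SpecMap _ _ _ hV _ _).trans ?_))
  refine congrArg (chartMap f g hg D ht') ?_
  refine (evalAt_map V'.2.fromSpec (toOpens_mono i.le) hV' b).symm.trans ?_
  exact evalAt_fromSpec V'.2 hV' _

lemma evalAt_exceptionalι_divisor (i : V' ⟶ V) (hW)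
    (r : Γ(D.ideal.subscheme, D.ideal.subschemeι ⁻¹ᵁ g ⁻¹ᵁ V.toOpens)) :
    evalAt (exceptionalι f g hg D ht') (exceptionalOpen f g hg D V.toOpens) hW
      ((exceptionalDivisorToDivisor f g hg D.ideal).app _ r) =
      chartStr f g hg D ht' ((normalRes g D i).r r) := by
  have hV' : ⊤ ≤ divisorι g D (aff V') ⁻¹ᵁ D.ideal.subschemeι ⁻¹ᵁ g ⁻¹ᵁ V'.toOpens :=
    ((V'.2.preimage g).preimage D.ideal.subschemeι).fromSpec_preimage_self.ge
  have hle := D.ideal.subschemeι.preimage_mono (g.preimage_mono (toOpens_mono i.le))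
  have hV := hV'.trans ((divisorι g D (aff V')).preimage_mono hle)
  refine (evalAt_app _ _ _ _).trans
    ((evalAt_congr (exceptionalι_toDivisor f g hg D ht') _ _ _).trans
      ((evalAt_SpecMap _ _ _ hV _ _).trans ?_))
  refine congrArg (chartStr f g hg D ht') ?_
  refine (evalAt_map (divisorι g D (aff V')) hle hV' r).symm.trans ?_
  exact evalAt_fromSpec _ hV' _

include ht' in
omit [IsClosedImmersion g] in
lemma siteRes_section_mem_span (i : V' ⟶ V) {U : X.affineOpens} (hUV : V.toOpens ≤ f ⁻¹ᵁ U.1)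
    (τ : D.ideal.ideal U) :
    siteRes i ((f.appLE U.1 V.toOpens hUV).hom τ.1) ∈ Ideal.span {t'} := by
  rw [← ht', ideal_comap_eq_map D.ideal f (aff V') U ((toOpens_mono i.le).trans hUV), siteRes_appLE]
  exact Ideal.mem_map_of_mem _ τ.2

lemma app_siteRes_section (i : V' ⟶ V) {U : X.affineOpens} (hUV : V.toOpens ≤ f ⁻¹ᵁ U.1)
    (τ : D.ideal.ideal U) :
    (g.app (aff V').1).hom (siteRes i ((f.appLE U.1 V.toOpens hUV).hom τ.1)) =
      (normalRes g D i).a (restrictDivisorIdeal f g hg D (V := aff V) hUV τ).1 := by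
  refine (RingHom.congr_fun (normalRes g D i).hφ _).symm.trans ?_
  exact congrArg (normalRes g D i).a (app_appLE_section f g hg hUV τ.1)

/-- On the chart over a basic open `V'` of `V`, the function `μ(τ) · (k / τ)` is the image of
`k ⊗ μ`. -/
lemma evalAt_canonicalSection (i : V' ⟶ V) {U : X.affineOpens} (hUV : V.toOpens ≤ f ⁻¹ᵁ U.1)
    (τ : D.ideal.ideal U) (k : g.ker.ideal (aff V))
    (μ : Module.Dual Γ(X, g ⁻¹ᵁ V.toOpens) (divisorIdeal g D (aff V)))
    (q : Γ(dilatation f g hg D.ideal, dilatationπ f g hg D.ideal ⁻¹ᵁ V.toOpens))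
    (hq : (dilatationπ f g hg D.ideal).app V.toOpens (f.appLE U.1 V.toOpens hUV τ.1) * q =
      (dilatationπ f g hg D.ideal).app V.toOpens k.1) (hW) :
    evalAt (exceptionalι f g hg D ht') (exceptionalOpen f g hg D (aff V).1) hW
      (canonicalSection f g hg D (V := aff V) hUV τ μ q) =
    chartSymHom f g hg D ht' ((normalRes g D i).map (twistedGen _ _ k μ)) := by
  have hle : ⊤ ≤ dilatationι f g hg D ht' ⁻¹ᵁ dilatationπ f g hg D.ideal ⁻¹ᵁ V.toOpens :=
    top_le_preimage_of_opensRange_le _ ((opensRange_dilatationι f g hg D ht').le.trans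
      ((dilatationπ f g hg D.ideal).preimage_mono (toOpens_mono i.le)))
  have hsa := app_siteRes_section f g hg D i hUV τ
  have hsI : (g.app (aff V').1).hom (siteRes i ((f.appLE U.1 V.toOpens hUV).hom τ.1)) ∈
      divisorIdeal g D (aff V') := by
    rw [hsa]
    exact map_mem_of_map_eq (normalRes g D i).hI _
  rw [TwistedRes.map_gen]
  refine Eq.trans ?_ ((isDilatationChart f g hg D ht').symHom_gen _ _
    (siteRes_section_mem_span f D ht' i hUV τ) hsI
    (q := evalAt (dilatationι f g hg D ht') _ hle q) ?_).symm
  · rw [canonicalSection, map_mul]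
    congr 1
    · refine (evalAt_exceptionalι_divisor f g hg D ht' i hW _).trans ?_
      refine congrArg (chartStr f g hg D ht') ?_
      refine (RingHom.congr_fun (normalRes g D i).hψ _).trans ?_
      refine congrArg (D.ideal.subschemeι.app (g ⁻¹ᵁ (aff V').1)).hom ?_
      refine ((normalRes g D i).mapDual_apply μ _).symm.trans ?_
      exact congrArg _ (Subtype.ext hsa.symm)
    · refine (evalAt_appLE _ _ _ _ _).trans ?_
      refine (evalAt_congr (exceptionalι_ι f g hg D ht') _ _ _).trans ?_
      exact evalAt_SpecMap _ _ _ hle _ _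
  · rw [← evalAt_dilatationι f g hg D ht' i hle, ← map_mul]
    refine (congrArg _ hq).trans ?_
    exact evalAt_dilatationι f g hg D ht' i hle k.1

end LocalMorphism

/-! ### Gluing the canonical morphism -/

section Gluing

open Scheme.AffineZariskiSite

variable {X Y : Scheme.{u}} (f : Y ⟶ X) (g : X ⟶ Y) (hg : g ≫ f = 𝟙 X)
  (D : EffectiveCartierDivisor X) [IsClosedImmersion g] {V V' : Y.AffineZariskiSite}
  {t : Γ(Y, V.toOpens)} {t' : Γ(Y, V'.toOpens)}

/-- The structure map of the symmetric algebra from functions on `D`. -/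
def normalStrHom (V : Y.affineOpens) :
    Γ(D.ideal.subscheme, D.ideal.subschemeι ⁻¹ᵁ g ⁻¹ᵁ V.1) →+* NormalSym g D V :=
  twistedStr _ _ _ _

lemma SpecMap_normalBundleι_toDivisor {V : Y.affineOpens} {Q : Type u} [CommRing Q]
    (v : NormalSym g D V →+* Q) :
    Spec.map (CommRingCat.ofHom v) ≫ normalBundleι g D V ≫ normalBundleToDivisor g D =
      Spec.map (CommRingCat.ofHom (v.comp (normalStrHom g D V))) ≫ divisorι g D V := by
  rw [normalBundleι_toDivisor, ← Spec.map_comp_assoc]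
  rfl

lemma normalSym_hom_ext (V : Y.affineOpens) {T : Type*} [CommRing T] {u v : NormalSym g D V →+* T}
    (h : u.comp (normalStrHom g D V) = v.comp (normalStrHom g D V))
    (h' : ∀ (k : g.ker.ideal V) (μ : Module.Dual Γ(X, g ⁻¹ᵁ V.1) (divisorIdeal g D V)),
      u (twistedGen (g.app V.1).hom (D.ideal.subschemeι.app (g ⁻¹ᵁ V.1)).hom k μ) =
      v (twistedGen (g.app V.1).hom (D.ideal.subschemeι.app (g ⁻¹ᵁ V.1)).hom k μ)) : u = v :=
  twistedSym_hom_ext _ _ h h'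

lemma chartSymHom_comp_normalStr {V : Y.AffineZariskiSite} {t : Γ(Y, V.toOpens)}
    (ht : (D.ideal.comap f).ideal (aff V) = Ideal.span {t}) :
    (chartSymHom f g hg D ht).comp (normalStrHom g D (aff V)) = chartStr f g hg D ht :=
  RingHom.ext fun r => (isDilatationChart f g hg D ht).symHom_algebraMap r

lemma hom_ext_of_comp_divisorι {V : Y.affineOpens} {Q : Type u} [CommRing Q]
    {a b : Γ(D.ideal.subscheme, D.ideal.subschemeι ⁻¹ᵁ g ⁻¹ᵁ V.1) →+* Q}
    (e : Spec.map (CommRingCat.ofHom a) ≫ divisorι g D V =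
      Spec.map (CommRingCat.ofHom b) ≫ divisorι g D V) : a = b :=
  congrArg CommRingCat.Hom.hom (Spec.map_injective ((cancel_mono _).mp e))

lemma normalRes_map_comp_normalStr {V V' : Y.AffineZariskiSite} (i : V' ⟶ V) :
    (normalRes g D i).map.comp (normalStrHom g D (aff V)) =
      (normalStrHom g D (aff V')).comp (normalRes g D i).r :=
  RingHom.ext fun r => (normalRes g D i).map_algebraMap r

lemma normalRes_id_map (V : Y.AffineZariskiSite) :
    (normalRes g D (𝟙 V)).map = RingHom.id (NormalSym g D (aff V)) :=
  congrArg CommRingCat.Hom.hom ((normalAlgebra g D).map_id (Opposite.op V))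

lemma normalRes_id_r (V : Y.AffineZariskiSite) : (normalRes g D (𝟙 V)).r = RingHom.id _ :=
  congrArg CommRingCat.Hom.hom (D.ideal.subscheme.presheaf.map_id _)

lemma normalBundleι_res (i : V' ⟶ V) :
    Spec.map (CommRingCat.ofHom (normalRes g D i).map) ≫ normalBundleι g D (aff V) =
      normalBundleι g D (aff V') :=
  gluedCover_w (normalGluingData g D) i

/-- On a good chart with equation `t = f^*τ`, the quotient `k / t` is a function on the part of the
dilatation over `V`. -/
lemma IsGoodChart.exists_quotient (h : IsGoodChart f g D V t) (k : g.ker.ideal (aff V)) :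
    ∃ (U : X.affineOpens) (hUV : V.toOpens ≤ f ⁻¹ᵁ U.1) (τ : D.ideal.ideal U)
      (q : Γ(dilatation f g hg D.ideal, dilatationπ f g hg D.ideal ⁻¹ᵁ V.toOpens)),
      (dilatationπ f g hg D.ideal).app V.toOpens (f.appLE U.1 V.toOpens hUV τ.1) * q =
        (dilatationπ f g hg D.ideal).app V.toOpens k.1 := by
  obtain ⟨U, hUV, τ, hτ⟩ := h.exists_eq
  have hr := opensRange_dilatationι f g hg D h.ideal_eq
  have hle := top_le_preimage_of_opensRange_le _ hr.le
  have hbij := evalAt_bijective (dilatationι f g hg D h.ideal_eq) _ hle hr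
  have hid (b : Γ(Y, V.toOpens)) : siteRes (𝟙 V) b = b :=
    RingHom.congr_fun (congrArg CommRingCat.Hom.hom (Y.presheaf.map_id _)) b
  have H := isDilatationChart f g hg D h.ideal_eq
  obtain ⟨q, hq⟩ := hbij.2 (H.quotient k)
  refine ⟨U, hUV, τ, q, hbij.1 ?_⟩
  refine (map_mul _ _ _).trans ?_
  refine (congrArg₂ _ (evalAt_dilatationι f g hg D h.ideal_eq (𝟙 V) hle _) hq).trans ?_
  refine Eq.trans ?_ (evalAt_dilatationι f g hg D h.ideal_eq (𝟙 V) hle _).symm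
  rw [hid, hid]
  refine Eq.trans ?_ (H.mul_quotient k)
  exact congrArg (fun b => chartMap f g hg D h.ideal_eq b * H.quotient k) hτ

variable (ht : (D.ideal.comap f).ideal (aff V) = Ideal.span {t})
  (ht' : (D.ideal.comap f).ideal (aff V') = Ideal.span {t'})

lemma top_le_exceptionalι (i : V' ⟶ V) :
    ⊤ ≤ exceptionalι f g hg D ht' ⁻¹ᵁ exceptionalOpen f g hg D V.toOpens := by
  refine top_le_preimage_of_opensRange_le _ ((opensRange_exceptionalι f g hg D ht').le.trans ?_)
  exact (exceptionalDivisorToDivisor f g hg D.ideal).preimage_mono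
    (D.ideal.subschemeι.preimage_mono (g.preimage_mono (toOpens_mono i.le)))

/-- The inclusion of the chart of the exceptional divisor over a basic open. -/
def exceptionalRes (i : V' ⟶ V) :
    Spec (.of (ChartQuot f g hg D ht')) ⟶ Spec (.of (ChartQuot f g hg D ht)) :=
  IsOpenImmersion.lift (exceptionalι f g hg D ht) (exceptionalι f g hg D ht') <| by
    rintro _ ⟨z, rfl⟩
    have h := (opensRange_exceptionalι f g hg D ht).ge
    exact h (top_le_exceptionalι f g hg D ht' i (show z ∈ ⊤ from trivial))

lemma exceptionalRes_exceptionalι (i : V' ⟶ V) :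
    exceptionalRes f g hg D ht ht' i ≫ exceptionalι f g hg D ht = exceptionalι f g hg D ht' :=
  IsOpenImmersion.lift_fac _ _ _

section Compatible

variable (i : V' ⟶ V) {c : ChartQuot f g hg D ht →+* ChartQuot f g hg D ht'}
  (hc : Spec.map (CommRingCat.ofHom c) = exceptionalRes f g hg D ht ht' i)

include hc

lemma map_evalAt_exceptionalι
    (s : Γ(exceptionalDivisor f g hg D.ideal, exceptionalOpen f g hg D V.toOpens)) :
    c (evalAt (exceptionalι f g hg D ht) _ (top_le_exceptionalι f g hg D ht (𝟙 V)) s) =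
      evalAt (exceptionalι f g hg D ht') _ (top_le_exceptionalι f g hg D ht' i) s :=
  (evalAt_of_comp_eq c (by rw [hc, exceptionalRes_exceptionalι]) _ _ _ s).symm

lemma comp_chartStr :
    c.comp (chartStr f g hg D ht) = (chartStr f g hg D ht').comp (normalRes g D i).r := by
  refine RingHom.ext fun r => ?_
  have h1 := evalAt_exceptionalι_divisor f g hg D ht (𝟙 V) (top_le_exceptionalι f g hg D ht (𝟙 V)) r
  have h2 := evalAt_exceptionalι_divisor f g hg D ht' i (top_le_exceptionalι f g hg D ht' i) r
  rw [normalRes_id_r] at h1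
  rw [← map_evalAt_exceptionalι f g hg D ht ht' i hc, h1] at h2
  exact h2

lemma map_chartSymHom_gen (h : IsGoodChart f g D V t) (k : g.ker.ideal (aff V))
    (μ : Module.Dual Γ(X, g ⁻¹ᵁ V.toOpens) (divisorIdeal g D (aff V))) :
    c (chartSymHom f g hg D ht (twistedGen _ _ k μ)) =
      chartSymHom f g hg D ht' ((normalRes g D i).map (twistedGen _ _ k μ)) := by
  obtain ⟨U, hUV, τ, q, hq⟩ := h.exists_quotient f g hg D k
  have h1 := evalAt_canonicalSection f g hg D ht (𝟙 V) hUV τ k μ q hq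
    (top_le_exceptionalι f g hg D ht (𝟙 V))
  have h2 := evalAt_canonicalSection f g hg D ht' i hUV τ k μ q hq
    (top_le_exceptionalι f g hg D ht' i)
  rw [normalRes_id_map] at h1
  exact (congrArg c h1).symm.trans
    ((map_evalAt_exceptionalι f g hg D ht ht' i hc _).trans h2)

lemma comp_chartSymHom (h : IsGoodChart f g D V t) : c.comp (chartSymHom f g hg D ht) =
    (chartSymHom f g hg D ht').comp (normalRes g D i).map := by
  refine normalSym_hom_ext g D (aff V) ?_ fun k μ => ?_
  · rw [RingHom.comp_assoc, RingHom.comp_assoc, chartSymHom_comp_normalStr,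
      normalRes_map_comp_normalStr, ← RingHom.comp_assoc, chartSymHom_comp_normalStr]
    exact comp_chartStr f g hg D ht ht' i hc
  · exact map_chartSymHom_gen f g hg D ht ht' i hc h k μ

end Compatible

/-- The canonical morphisms on the charts are compatible. -/
lemma exceptionalRes_chartMorphism (h : IsGoodChart f g D V t) (i : V' ⟶ V) :
    exceptionalRes f g hg D h.ideal_eq ht' i ≫ chartMorphism f g hg D h.ideal_eq =
      chartMorphism f g hg D ht' := by
  obtain ⟨c, hc⟩ : ∃ c : ChartQuot f g hg D h.ideal_eq →+* ChartQuot f g hg D ht',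
      Spec.map (CommRingCat.ofHom c) = exceptionalRes f g hg D h.ideal_eq ht' i := by
    obtain ⟨c, hc⟩ := Spec.map_surjective (exceptionalRes f g hg D h.ideal_eq ht' i)
    exact ⟨c.hom, hc⟩
  have e : chartMorphism f g hg D ht' = Spec.map (CommRingCat.ofHom
      ((chartSymHom f g hg D ht').comp (normalRes g D i).map)) ≫ normalBundleι g D (aff V) := by
    rw [CommRingCat.ofHom_comp, Spec.map_comp, Category.assoc, normalBundleι_res]
    rfl
  have e' : CommRingCat.ofHom (chartSymHom f g hg D h.ideal_eq) ≫ CommRingCat.ofHom c =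
      CommRingCat.ofHom ((chartSymHom f g hg D ht').comp (normalRes g D i).map) :=
    congrArg CommRingCat.ofHom (comp_chartSymHom f g hg D h.ideal_eq ht' i hc h)
  rw [e, ← e', ← hc, Spec.map_comp, Category.assoc]
  rfl

/-- The good charts with their equations, the index type of the covers used for gluing. -/
structure GoodChart where
  /-- the affine open -/
  site : Y.AffineZariskiSite
  /-- the equation -/
  eqn : Γ(Y, site.toOpens)
  isGoodChart : IsGoodChart f g D site eqn

variable {f g D}

/-- The part of the exceptional divisor in a good chart. -/
abbrev GoodChart.scheme (c : GoodChart f g D) : Scheme.{u} :=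
  Spec (.of (ChartQuot f g hg D c.isGoodChart.ideal_eq))

/-- The open immersion of the part of the exceptional divisor in a good chart. -/
abbrev GoodChart.ι (c : GoodChart f g D) : c.scheme hg ⟶ exceptionalDivisor f g hg D.ideal :=
  exceptionalι f g hg D c.isGoodChart.ideal_eq

/-- The canonical morphism on a good chart. -/
abbrev GoodChart.morphism (c : GoodChart f g D) : c.scheme hg ⟶ normalBundle g D :=
  chartMorphism f g hg D c.isGoodChart.ideal_eq

include hg in
lemma exists_goodChart (hreg : IsRegularImmersion g) (z : D.ideal.subscheme)
    (W : Y.AffineZariskiSite) (hz : g (D.ideal.subschemeι z) ∈ W.toOpens) :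
    ∃ c : GoodChart f g D, c.site ≤ W ∧ g (D.ideal.subschemeι z) ∈ c.site.toOpens := by
  obtain ⟨V, hV, t, hx, h⟩ := exists_isGoodChart f g hg D hreg _ W hz
  exact ⟨⟨V, t, h⟩, hV, hx⟩

include hg in
lemma exists_goodChart_mem (hreg : IsRegularImmersion g) (z : D.ideal.subscheme) :
    ∃ c : GoodChart f g D, g (D.ideal.subschemeι z) ∈ c.site.toOpens := by
  obtain ⟨W, hW, hz, -⟩ := exists_isAffineOpen_mem_and_subset
    (show g (D.ideal.subschemeι z) ∈ (⊤ : Y.Opens) from trivial)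
  obtain ⟨c, -, hc⟩ := exists_goodChart hg hreg z ⟨W, hW⟩ hz
  exact ⟨c, hc⟩

lemma GoodChart.exists_ι_eq (c : GoodChart f g D) {z : exceptionalDivisor f g hg D.ideal}
    (hz : g (D.ideal.subschemeι (exceptionalDivisorToDivisor f g hg D.ideal z)) ∈
      c.site.toOpens) : ∃ w, c.ι hg w = z :=
  (opensRange_exceptionalι f g hg D c.isGoodChart.ideal_eq).ge hz

/-- The cover of the exceptional divisor by the good charts. -/
def goodCover (hreg : IsRegularImmersion g) :
    (exceptionalDivisor f g hg D.ideal).OpenCover :=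
  Scheme.Cover.mkOfCovers (GoodChart f g D) (fun c => c.scheme hg) (fun c => c.ι hg)
    (fun z => by
      obtain ⟨c, hc⟩ := exists_goodChart_mem hg hreg
        (exceptionalDivisorToDivisor f g hg D.ideal z)
      exact ⟨c, c.exists_ι_eq hg hc⟩)

/-- The cover of the bundle by its parts over the good charts. -/
def goodBundleCover (hreg : IsRegularImmersion g) : (normalBundle g D).OpenCover :=
  Scheme.Cover.mkOfCovers (GoodChart f g D) (fun c => Spec (.of (NormalSym g D (aff c.site))))
    (fun c => normalBundleι g D (aff c.site))
    (fun z => by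
      obtain ⟨c, hc⟩ := exists_goodChart_mem hg hreg (normalBundleToDivisor g D z)
      exact ⟨c, (opensRange_normalBundleι g D (aff c.site)).ge hc⟩)

lemma goodCharts_compatible (hreg : IsRegularImmersion g) (c₁ c₂ : GoodChart f g D) :
    pullback.fst (c₁.ι hg) (c₂.ι hg) ≫ c₁.morphism hg =
      pullback.snd (c₁.ι hg) (c₂.ι hg) ≫ c₂.morphism hg := by
  -- the fibre product is covered by good charts that are basic open in both charts
  let S := {c : GoodChart f g D // c.site ≤ c₁.site ∧ c.site ≤ c₂.site}
  let r₁ (c : S) := exceptionalRes f g hg D c₁.isGoodChart.ideal_eq c.1.isGoodChart.ideal_eq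
    (homOfLE c.2.1)
  let r₂ (c : S) := exceptionalRes f g hg D c₂.isGoodChart.ideal_eq c.1.isGoodChart.ideal_eq
    (homOfLE c.2.2)
  have hr₁ (c : S) : r₁ c ≫ c₁.ι hg = c.1.ι hg := exceptionalRes_exceptionalι ..
  have hr₂ (c : S) : r₂ c ≫ c₂.ι hg = c.1.ι hg := exceptionalRes_exceptionalι ..
  let l (c : S) : c.1.scheme hg ⟶ pullback (c₁.ι hg) (c₂.ι hg) :=
    pullback.lift (r₁ c) (r₂ c) ((hr₁ c).trans (hr₂ c).symm)
  let p : pullback (c₁.ι hg) (c₂.ι hg) ⟶ exceptionalDivisor f g hg D.ideal :=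
    pullback.fst _ _ ≫ c₁.ι hg
  have hl (c : S) : l c ≫ p = c.1.ι hg := by
    rw [← Category.assoc, pullback.lift_fst, hr₁]
  have hopen (c : S) : IsOpenImmersion (l c) := by
    have : IsOpenImmersion (l c ≫ p) := by rw [hl]; infer_instance
    exact IsOpenImmersion.of_comp _ p
  have hcov (z : ↥(pullback (c₁.ι hg) (c₂.ι hg))) : ∃ c w, l c w = z := by
    have h₁ := (opensRange_exceptionalι f g hg D c₁.isGoodChart.ideal_eq).le
      ⟨pullback.fst (c₁.ι hg) (c₂.ι hg) z, rfl⟩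
    have h₂ := (opensRange_exceptionalι f g hg D c₂.isGoodChart.ideal_eq).le
      ⟨pullback.snd (c₁.ι hg) (c₂.ι hg) z, rfl⟩
    rw [← Scheme.Hom.comp_apply] at h₁ h₂
    rw [← pullback.condition] at h₂
    obtain ⟨W, hW₁, hW₂, hW⟩ := exists_site_le h₁ h₂
    obtain ⟨c, hcW, hc⟩ := exists_goodChart hg hreg _ W hW
    obtain ⟨w, hw⟩ := c.exists_ι_eq hg hc
    refine ⟨⟨c, hcW.trans hW₁, hcW.trans hW₂⟩, w, p.injective ?_⟩
    rw [← Scheme.Hom.comp_apply, hl]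
    exact hw
  let 𝒰 : (pullback (c₁.ι hg) (c₂.ι hg)).OpenCover :=
    Scheme.Cover.mkOfCovers S (fun c => c.1.scheme hg) l hcov
  refine 𝒰.hom_ext _ _ fun c => ?_
  change l c ≫ _ = l c ≫ _
  rw [pullback.lift_fst_assoc, pullback.lift_snd_assoc]
  exact (exceptionalRes_chartMorphism f g hg D _ c₁.isGoodChart _).trans
    (exceptionalRes_chartMorphism f g hg D _ c₂.isGoodChart _).symm

/-- The canonical morphism `E_(D) ⟶ V(𝓝_g ⊗ 𝓞_D(D))`. -/
def canonicalMorphism (hreg : IsRegularImmersion g) :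
    exceptionalDivisor f g hg D.ideal ⟶ normalBundle g D :=
  (goodCover hg hreg).glueMorphisms (fun c => c.morphism hg) (goodCharts_compatible hg hreg)

lemma ι_canonicalMorphism (hreg : IsRegularImmersion g) (c : GoodChart f g D) :
    c.ι hg ≫ canonicalMorphism hg hreg = c.morphism hg :=
  Scheme.Cover.ι_glueMorphisms (goodCover hg hreg) _ _ c

lemma canonicalMorphism_toDivisor (hreg : IsRegularImmersion g) :
    canonicalMorphism hg hreg ≫ normalBundleToDivisor g D =
      exceptionalDivisorToDivisor f g hg D.ideal := by
  refine (goodCover hg hreg).hom_ext _ _ fun c => ?_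
  refine (Category.assoc _ _ _).symm.trans ?_
  refine (congrArg (· ≫ normalBundleToDivisor g D) (ι_canonicalMorphism hg hreg c)).trans ?_
  exact chartMorphism_toDivisor f g hg D c.isGoodChart.ideal_eq

/-- Over a good chart the canonical morphism is an isomorphism. -/
lemma GoodChart.bijective (c : GoodChart f g D) :
    Function.Bijective (chartSymHom f g hg D c.isGoodChart.ideal_eq) := by
  obtain ⟨rs, hrs, hK⟩ := c.isGoodChart.exists_regular
  exact ⟨(isDilatationChart f g hg D c.isGoodChart.ideal_eq).symHom_injective hrs hK,
    (isDilatationChart f g hg D c.isGoodChart.ideal_eq).symHom_surjective⟩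

/-- Being an isomorphism is local on the target, and the part of `E_(D)` over a good chart is the
pullback of the part of the bundle, both being pulled back from `D`. -/
lemma isIso_canonicalMorphism (hreg : IsRegularImmersion g) :
    IsIso (canonicalMorphism (D := D) hg hreg) := by
  change MorphismProperty.isomorphisms _ _
  rw [IsZariskiLocalAtTarget.iff_of_openCover (P := .isomorphisms Scheme)
    (goodBundleCover hg hreg)]
  intro c
  change GoodChart f g D at c
  have h : IsPullback (c.ι hg)
      (Spec.map (CommRingCat.ofHom (chartSymHom f g hg D c.isGoodChart.ideal_eq)))
      (canonicalMorphism hg hreg) (normalBundleι g D (aff c.site)) := by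
    refine IsPullback.of_bot ?_ (ι_canonicalMorphism hg hreg c)
      (isPullback_normalBundleι g D (aff c.site))
    have e : normalStr g D (aff c.site) ≫
        CommRingCat.ofHom (chartSymHom f g hg D c.isGoodChart.ideal_eq) =
        CommRingCat.ofHom (chartStr f g hg D c.isGoodChart.ideal_eq) :=
      CommRingCat.hom_ext (RingHom.ext fun r =>
        (isDilatationChart f g hg D c.isGoodChart.ideal_eq).symHom_algebraMap r)
    rw [canonicalMorphism_toDivisor, ← Spec.map_comp, e]
    exact isPullback_exceptionalι f g hg D c.isGoodChart.ideal_eq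
  have : IsIso (CommRingCat.ofHom (chartSymHom f g hg D c.isGoodChart.ideal_eq)) :=
    (ConcreteCategory.isIso_iff_bijective _).mpr (c.bijective hg)
  change IsIso (pullback.snd (canonicalMorphism hg hreg) (normalBundleι g D (aff c.site)))
  rw [← h.isoPullback_inv_snd]
  infer_instance

lemma evalAt_of_SpecMap_normalBundleι {V : Y.affineOpens} {Q : Type u} [CommRing Q]
    {ψ : Spec (.of Q) ⟶ normalBundle g D} (v : NormalSym g D V →+* Q)
    (hv : Spec.map (CommRingCat.ofHom v) ≫ normalBundleι g D V = ψ) (s : NormalSym g D V) (hW) :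
    evalAt ψ (normalBundleToDivisor g D ⁻¹ᵁ D.ideal.subschemeι ⁻¹ᵁ g ⁻¹ᵁ V.1) hW
      (normalBundleFun g D V s) = v s := by
  have hV := top_le_preimage_of_opensRange_le _ (opensRange_normalBundleι g D V).le
  rw [evalAt_of_comp_eq v hv _ hV, evalAt_normalBundleι]

/-- The pullback of functions on the bundle over `V` to a chart over a basic open `V'` of `V`. -/
lemma evalAt_chartMorphism (i : V' ⟶ V) (s : NormalSym g D (aff V)) (hW) :
    evalAt (chartMorphism f g hg D ht') (normalBundleToDivisor g D ⁻¹ᵁ D.ideal.subschemeι ⁻¹ᵁ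
      g ⁻¹ᵁ (aff V).1) hW (normalBundleFun g D (aff V) s) =
      chartSymHom f g hg D ht' ((normalRes g D i).map s) := by
  have e : chartMorphism f g hg D ht' = Spec.map (CommRingCat.ofHom
      ((chartSymHom f g hg D ht').comp (normalRes g D i).map)) ≫ normalBundleι g D (aff V) := by
    rw [chartMorphism, ← normalBundleι_res g D i, ← Spec.map_comp_assoc]
    rfl
  exact evalAt_of_SpecMap_normalBundleι _ e.symm s hW

lemma isCanonicalMap_canonicalMorphism (hreg : IsRegularImmersion g) :
    IsCanonicalMap f g hg D (canonicalMorphism hg hreg) := by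
  refine ⟨canonicalMorphism_toDivisor hg hreg, fun U V hUV τ k μ q hq => ?_⟩
  let W : Y.AffineZariskiSite := ⟨V.1, V.2⟩
  refine eq_of_evalAt_eq fun z hz => ?_
  obtain ⟨c, hcW, hc⟩ := exists_goodChart hg hreg
    (exceptionalDivisorToDivisor f g hg D.ideal z) W hz
  refine ⟨_, c.ι hg, inferInstance,
    top_le_exceptionalι f g hg D c.isGoodChart.ideal_eq (homOfLE hcW),
    c.exists_ι_eq hg hc, ?_⟩
  refine Eq.trans ?_ (evalAt_canonicalSection f g hg D c.isGoodChart.ideal_eq (homOfLE hcW) hUV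
    τ k μ q hq (top_le_exceptionalι f g hg D c.isGoodChart.ideal_eq (homOfLE hcW))).symm
  refine (evalAt_appLE _ _ _ _ _).trans ?_
  refine (evalAt_congr (ι_canonicalMorphism hg hreg c) _ _ _).trans ?_
  exact evalAt_chartMorphism hg c.isGoodChart.ideal_eq (homOfLE hcW) _ _

section Uniqueness

variable {φ : exceptionalDivisor f g hg D.ideal ⟶ normalBundle g D}
  (hφ : IsCanonicalMap f g hg D φ) (c : GoodChart f g D)

include hφ

lemma IsCanonicalMap.exists_hom : ∃ v : NormalSym g D (aff c.site) →+*
    ChartQuot f g hg D c.isGoodChart.ideal_eq,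
    Spec.map (CommRingCat.ofHom v) ≫ normalBundleι g D (aff c.site) = c.ι hg ≫ φ := by
  obtain ⟨hover, -⟩ := hφ
  obtain ⟨v, hv⟩ := exists_hom_of_range_le (normalBundleι g D (aff c.site)) (c.ι hg ≫ φ) (by
    rw [opensRange_normalBundleι]
    exact (top_le_exceptionalι f g hg D c.isGoodChart.ideal_eq (𝟙 c.site)).trans
      ((c.ι hg).preimage_mono (exceptionalOpen_le_preimage f g hg D φ hover _)))
  exact ⟨v.hom, hv⟩

variable {v : NormalSym g D (aff c.site) →+* ChartQuot f g hg D c.isGoodChart.ideal_eq}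
  (hv : Spec.map (CommRingCat.ofHom v) ≫ normalBundleι g D (aff c.site) = c.ι hg ≫ φ)

include hv

lemma IsCanonicalMap.hom_comp_normalStrHom :
    v.comp (normalStrHom g D (aff c.site)) = chartStr f g hg D c.isGoodChart.ideal_eq := by
  obtain ⟨hover, -⟩ := hφ
  refine hom_ext_of_comp_divisorι g D ?_
  refine (SpecMap_normalBundleι_toDivisor g D v).symm.trans ?_
  rw [reassoc_of% hv, hover]
  exact exceptionalι_toDivisor f g hg D c.isGoodChart.ideal_eq

lemma IsCanonicalMap.hom_gen (k : g.ker.ideal (aff c.site))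
    (μ : Module.Dual Γ(X, g ⁻¹ᵁ c.site.toOpens) (divisorIdeal g D (aff c.site))) :
    v (twistedGen _ _ k μ) =
      chartSymHom f g hg D c.isGoodChart.ideal_eq (twistedGen _ _ k μ) := by
  obtain ⟨hover, hcan⟩ := hφ
  obtain ⟨U, hUV, τ, q, hq⟩ := c.isGoodChart.exists_quotient f g hg D k
  have hle := top_le_exceptionalι f g hg D c.isGoodChart.ideal_eq (𝟙 c.site)
  have h1 := evalAt_canonicalSection f g hg D c.isGoodChart.ideal_eq (𝟙 c.site) hUV τ k μ q hq hle
  rw [normalRes_id_map, RingHom.id_apply] at h1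
  have h2 := (congrArg (evalAt (c.ι hg) _ hle) (hcan U (aff c.site) hUV τ k μ q hq)).trans h1
  have h3 := (evalAt_appLE _ _ _ _ _).symm.trans h2
  exact (evalAt_of_SpecMap_normalBundleι v hv _ _).symm.trans h3

omit hv in
/-- A canonical morphism is determined on the good charts by the values on the generators. -/
lemma IsCanonicalMap.ι_comp : c.ι hg ≫ φ = c.morphism hg := by
  obtain ⟨v, hv⟩ := hφ.exists_hom hg c
  have hvs : v = chartSymHom f g hg D c.isGoodChart.ideal_eq :=
    normalSym_hom_ext g D (aff c.site)
      ((hφ.hom_comp_normalStrHom hg c hv).trans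
        (chartSymHom_comp_normalStr f g hg D c.isGoodChart.ideal_eq).symm)
      (hφ.hom_gen hg c hv)
  rw [← hv, hvs]
  rfl

end Uniqueness

lemma IsCanonicalMap.eq_canonicalMorphism (hreg : IsRegularImmersion g)
    {φ : exceptionalDivisor f g hg D.ideal ⟶ normalBundle g D}
    (hφ : IsCanonicalMap f g hg D φ) : φ = canonicalMorphism hg hreg :=
  (goodCover hg hreg).hom_ext _ _ fun c =>
    (hφ.ι_comp hg c).trans (ι_canonicalMorphism hg hreg c).symm

end Gluing

end Dilatation

end

theorem mainTheorem8 {X Y : Scheme.{u}} (f : Y ⟶ X) [IsSeparated f] (g : X ⟶ Y)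
    (hg : g ≫ f = 𝟙 X) (D : EffectiveCartierDivisor X) :
    haveI : IsClosedImmersion g := isClosedImmersion_section f g hg
    IsRegularImmersion g →
      ∃ e : exceptionalDivisor f g hg D.ideal ≅ normalBundle g D,
        IsCanonicalMap f g hg D e.hom ∧
          ∀ φ : exceptionalDivisor f g hg D.ideal ⟶ normalBundle g D,
            IsCanonicalMap f g hg D φ → φ = e.hom := by
  have : IsClosedImmersion g := isClosedImmersion_section f g hg
  intro hreg
  have := isIso_canonicalMorphism (D := D) hg hreg
  exact ⟨asIso (canonicalMorphism hg hreg), isCanonicalMap_canonicalMorphism hg hreg,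
    fun φ hφ => hφ.eq_canonicalMorphism hg hreg⟩
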